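/- Work over $\mathbb C$. For a vector space $W$, $W((x_1,x_2))$ denotes series with finitely many negative powers of both $x_1$ and $x_2$; $\mathbb C_*((x_1,x_2))$ is the fraction field of $\mathbb C((x_1,x_2))$, and $\iota_{x_2,x_1}:\mathbb C_*((x_1,x_2))\to\mathbb C((x_2))((x_1))$ is the canonical embedding. **Nonlocal vertex algebras.** A nonlocal vertex algebra is a vector space $V$ with a linear map $Y(\cdot,x):V\to \mathrm{Hom}(V,V((x)))$ and a vector $\mathbf 1\in V$ such that $Y(\mathbf 1,x)v=v$, $Y(v,x)\mathbf 1\in V[[x]]$, $\lim_{x\to0}Y(v,x)\mathbf 1=v$, and for all $u,v\in V$ there is $k\in\mathbb N$ with $(x_1-x_2)^kY(u,x_1)Y(v,x_2)\in\mathrm{Hom}(V,V((x_1,x_2)))$ and $\big((x_1-x_2)^kY(u,x_1)Y(v,x_2)\big)|_{x_1=x_2+x_0}=x_0^kY(Y(u,x_0)v,x_2)$. A $V$-module is a vector space $W$ with a linear map $Y_W(\cdot,x):V\to\mathrm{Hom}(W,W((x)))$ such that $Y_W(\mathbf 1,x)=1_W$ and the same condition holds for $Y_W(u,x_1)Y_W(v,x_2)$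 and $Y_W(Y(u,x_0)v,x_2)$. A nonlocal vertex bialgebra is a nonlocal vertex algebra $H$ with a coalgebra structure $(\Delta,\varepsilon)$ such that $\Delta:H\to H\otimes H$ and $\varepsilon:H\to\mathbb C$ are homomorphisms of nonlocal vertex algebras. We write $\Delta(h)=\sum h_{(1)}\otimes h_{(2)}$. An $H$-module nonlocal vertex algebra is a nonlocal vertex algebra $V$ with an $H$-module structure $Y_V^H(\cdot,x)$ such that $Y_V^H(h,x)v\in V\otimes\mathbb C((x))$, $Y_V^H(h,x)\mathbf 1=\varepsilon(h)\mathbf 1$ and $$Y_V^H(h,x_1)Y(u,x_2)v=\sum Y\big(Y_V^H(h_{(1)},x_1-x_2)u,x_2\big)Y_V^H(h_{(2)},x_1)v .$$ A right $H$-comodule nonlocal vertex algebra is a nonlocal vertex algebra $V$ with a homomorphism $\rho:V\to V\otimes H$ of nonlocal vertex algebras that is a right comodule structure for the coalgebra $H$; write $\rho(v)=\sum v_{(1)}\otimes v_{(2)}$. It is compatible with $Y_V^H$ if $\rho(Y_V^H(h,x)v)=(Y_V^H(h,x)\otimes1)\rho(v)$. **Group actions.** Let $G$ be a group with linear characters $\chi,\chi_\phi:G\to\mathbb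 C^\times$. A $(G,\chi)$-module nonlocal vertex algebra is a nonlocal vertex algebra $V$ with a representation $R$ of $G$ such that $R(g)\mathbf 1=\mathbf 1$ and $R(g)Y(v,x)R(g)^{-1}=Y(R(g)v,\chi(g)x)$. A $(G,\chi)$-module nonlocal vertex bialgebra is a nonlocal vertex bialgebra that is a $(G,\chi)$-module nonlocal vertex algebra on which $G$ acts by automorphisms of the coalgebra. For a group homomorphism $\psi:G\to\mathbb C^\times$, $\mathbb C_{\psi(G)}[x]$ is the multiplicative monoid generated by the polynomials $x-\psi(g)$, $g\in G$. **$\phi$-coordinated quasi modules.** Let $0\neq p(x)\in\mathbb C((x))$ and $\phi(x,z)=e^{zp(x)\frac{d}{dx}}x$, and assume $\phi(x,\chi(g)z)=\chi_\phi(g)\,\phi(\chi_\phi(g)^{-1}x,z)$ for all $g\in G$. For $A(x_1,x_2)\in W((x_1,x_2))$ put $A(\phi(x,z),x)=\big(e^{zp(x_1)\partial_{x_1}}A(x_1,x_2)\big)|_{x_1=x_2=x}$; for $W=\mathbb C$ this gives a field embedding $\mathbb C_*((x_1,x_2))\to\mathbb C((x))((z))$, $F\mapsto F(\phi(x,z),x)$.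 A $\phi$-coordinated quasi $V$-module is a vector space $W$ with a linear map $Y_W(\cdot,x):V\to\mathrm{Hom}(W,W((x)))$ such that $Y_W(\mathbf 1,x)=1_W$ and for all $u,v\in V$ there is a nonzero $f\in\mathbb C((x_1,x_2))$ with $f(x_1,x_2)Y_W(u,x_1)Y_W(v,x_2)\in\mathrm{Hom}(W,W((x_1,x_2)))$ and $$\big(f(x_1,x_2)Y_W(u,x_1)Y_W(v,x_2)\big)|_{x_1=\phi(x_2,z)}=f(\phi(x_2,z),x_2)\,Y_W(Y(u,z)v,x_2).$$ If $V$ is a $(G,\chi)$-module nonlocal vertex algebra, such a $W$ is $(G,\chi_\phi)$-equivariant if $Y_W(R(g)v,x)=Y_W(v,\chi_\phi(g)^{-1}x)$ and for all $u,v\in V$ there is $q\in\mathbb C_{\chi_\phi(G)}[x]$ with $q(x_1/x_2)Y_W(u,x_1)Y_W(v,x_2)\in\mathrm{Hom}(W,W((x_1,x_2)))$. **$\phi$-compatibility.** Let $\mathbb C_\phi((x_1,x_2))$ be the set of $F\in\mathbb C_*((x_1,x_2))$ with $p(x_1)\partial_{x_1}F=-p(x_2)\partial_{x_2}F$. Then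 $F\mapsto F(\phi(x,z),x)$ defines an embedding $\pi_\phi:\mathbb C_\phi((x_1,x_2))\to\mathbb C((z))$, with image denoted $\mathbb C_\phi((z))$. For a $(G,\chi)$-module nonlocal vertex bialgebra $H$, an $H$-module nonlocal vertex algebra $(V,Y_V^H)$ is $\phi$-compatible if $Y_V^H(h,z)v\in V\otimes\mathbb C_\phi((z))$ for all $h\in H$, $v\in V$ and if, with $\widehat Y_V^H(h,x_1,x_2)v=(1\otimes\pi_\phi^{-1})Y_V^H(h,z)v$, there is for all $h,v$ some $q\in\mathbb C_{\chi_\phi(G)}[x]$ with $q(x_2/x_1)\widehat Y_V^H(h,x_1,x_2)v\in V\otimes\mathbb C((x_1,x_2))$. A $(G,\chi_\phi)$-equivariant $\phi$-coordinated quasi $(H,V)$-module, where $V$ is in addition a $(G,\chi)$-module nonlocal vertex algebra, is a vector space $W$ with structures $Y_W^H$ and $Y_W^V$ of a $(G,\chi_\phi)$-equivariant $\phi$-coordinated quasi module for $H$ and for $V$ such that $Y_W^H(h,x)w\in W\otimes\mathbb C((x))$ and $$Y_W^H(h,x_1)Y_W^V(v,x_2)=\sum Y_W^V\big(\iota_{x_2,x_1}\widehat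 Y_V^H(h_{(1)},x_1,x_2)v,\,x_2\big)Y_W^H(h_{(2)},x_1).$$ **Statement.** Let $H$ be a cocommutative $(G,\chi)$-module nonlocal vertex bialgebra, $V$ a $(G,\chi)$-module nonlocal vertex algebra with a $\phi$-compatible $H$-module nonlocal vertex algebra structure $Y_V^H$ satisfying $$R_V(g)Y_V^H(h,x)v=Y_V^H(R_H(g)h,\chi(g)x)R_V(g)v\qquad(g\in G,\ h\in H,\ v\in V),$$ and let $\rho:V\to V\otimes H$ be a right $H$-comodule nonlocal vertex algebra structure that is compatible with $Y_V^H$ and is a homomorphism of $G$-modules. Let $\mathfrak D^\rho_{Y_V^H}(V)$ be the space $V$ with vacuum vector $\mathbf 1$, vertex operator map $v\mapsto\sum Y(v_{(1)},x)Y_V^H(v_{(2)},x)$ and representation $R_V$. Let $(W,Y_W^H,Y_W^V)$ be a $(G,\chi_\phi)$-equivariant $\phi$-coordinated quasi $(H,V)$-module. Then $\mathfrak D^\rho_{Y_V^H}(V)$ is a $(G,\chi)$-module nonlocal vertex algebra, and $W$ with $$Y_W^{\sharp\rho}(v,x)=\sum Y_W^V(v_{(1)},x)\,Y_W^H(v_{(2)},x)\qquad(v\in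 V)$$ is a $(G,\chi_\phi)$-equivariant $\phi$-coordinated quasi $\mathfrak D^\rho_{Y_V^H}(V)$-module. -/

import Mathlib

open scoped TensorProduct

noncomputable section

namespace VertexDeformation

/-! ## Formal series

Over the field `ℂ` and for a vector space `W`:
* `HahnSeries ℤ W` is `W((x))`;
* `HahnSeries (ℤ × ℤ) W` (product order) is `W((x₁, x₂))`: the coefficient of `x₁ ^ a * x₂ ^ b` sits
  at `(a, b)`, and a subset of `ℤ × ℤ` is partially well-ordered for the product order exactly when
  both coordinates are bounded below on it;
* `HahnSeries (ℤ ×ₗ ℤ) W` (lexicographic order) is `W((y))((z))`: the coefficient of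
  `z ^ a * y ^ b` sits at `toLex (a, b)`. The *outer* variable comes first. -/

variable {G V H W : Type*}
variable [AddCommGroup V] [Module ℂ V] [AddCommGroup H] [Module ℂ H]
variable [AddCommGroup W] [Module ℂ W]

/-- `ℂ((x₁, x₂))`. -/
abbrev Two : Type := HahnSeries (ℤ × ℤ) ℂ

/-- `ℂ((y))((z))`, with outer variable `z`. -/
abbrev Iter : Type := HahnSeries (ℤ ×ₗ ℤ) ℂ

/-- `ℂ_*((x₁, x₂))`, the fraction field of `ℂ((x₁, x₂))`. -/
abbrev TwoFrac : Type := FractionRing Two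

/-- The product `f A` of a scalar series `f` with a `W`-valued series `A` in the same variables. -/
def act {Γ : Type*} [AddCommMonoid Γ] [PartialOrder Γ] [IsOrderedCancelAddMonoid Γ] :
    HahnSeries Γ ℂ →ₗ[ℂ] HahnSeries Γ W →ₗ[ℂ] HahnSeries Γ W :=
  LinearMap.mk₂ ℂ
    (fun f A => (HahnModule.of ℂ).symm (f • HahnModule.of ℂ A))
    (fun f g A => by rw [add_smul]; rfl)
    (fun c f A => by rw [smul_assoc]; rfl)
    (fun f A B => by rw [HahnModule.of_add, smul_add]; rfl)
    (fun c f A => by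
      ext a
      have hs : ((HahnModule.of ℂ).symm (HahnModule.of ℂ (c • A))).support ⊆ A.support :=
        Function.support_const_smul_subset c A.coeff
      rw [HahnModule.coeff_smul_right A.isPWO_support hs, HahnSeries.coeff_smul,
        HahnModule.coeff_smul, Finset.smul_sum]
      exact Finset.sum_congr rfl fun _ _ => smul_comm _ _ _)

/-- `∑ₙ zⁿ cₙ(y)` as an element of `W((y))[[z]] ⊆ W((y))((z))`. -/
def ofCoeffs (c : ℕ → HahnSeries ℤ W) : HahnSeries (ℤ ×ₗ ℤ) W :=
  HahnSeries.ofIterate (HahnSeries.ofSuppBddBelow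
    (fun n : ℤ => if 0 ≤ n then c n.toNat else 0)
    ⟨0, fun n hn => by
      by_contra h
      exact hn (if_neg h)⟩)

theorem ofCoeffs_coeff {W : Type*} [AddCommGroup W] (c : ℕ → HahnSeries ℤ W) (g : ℤ ×ₗ ℤ) :
    (ofCoeffs c).coeff g =
      if 0 ≤ (ofLex g).1 then (c (ofLex g).1.toNat).coeff (ofLex g).2 else 0 := by
  change (if 0 ≤ (ofLex g).1 then c (ofLex g).1.toNat else 0).coeff (ofLex g).2 = _
  split_ifs <;> rfl

/-- The expansion `W((x₁, x₂)) → W((x₁))((x₂))`. -/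
def iota12 : HahnSeries (ℤ × ℤ) W →ₗ[ℂ] HahnSeries (ℤ ×ₗ ℤ) W where
  toFun A :=
    { coeff := fun g => A.coeff ((ofLex g).2, (ofLex g).1)
      isPWO_support' := by
        refine (A.isPWO_support.image_of_monotone
          (f := fun g : ℤ × ℤ => toLex (g.2, g.1)) ?_).mono ?_
        · intro a b hab
          exact Prod.Lex.toLex_mono ⟨hab.2, hab.1⟩
        · intro g hg
          exact ⟨((ofLex g).2, (ofLex g).1), hg, rfl⟩ }
  map_add' _ _ := rfl
  map_smul' _ _ := rfl

/-- The expansion `W((x₁, x₂)) → W((x₂))((x₁))`. -/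
def iota21 : HahnSeries (ℤ × ℤ) W →ₗ[ℂ] HahnSeries (ℤ ×ₗ ℤ) W where
  toFun A :=
    { coeff := fun g => A.coeff (ofLex g)
      isPWO_support' := by
        refine (A.isPWO_support.image_of_monotone
          (f := fun g : ℤ × ℤ => toLex g) ?_).mono ?_
        · intro a b hab
          exact Prod.Lex.toLex_mono hab
        · intro g hg
          exact ⟨ofLex g, hg, rfl⟩ }
  map_add' _ _ := rfl
  map_smul' _ _ := rfl

/-- The expansion `ℂ((x₁, x₂)) → ℂ((x₂))((x₁))` as a homomorphism of algebras. -/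
def iota21Hom : Two →ₐ[ℂ] Iter :=
  AlgHom.ofLinearMap iota21
    (by
      ext g
      change (1 : Two).coeff (ofLex g) = _
      rw [HahnSeries.coeff_one, HahnSeries.coeff_one]
      rfl)
    (by
      intro f g
      ext a
      change (f * g).coeff (ofLex a) = (iota21 f * iota21 g).coeff a
      rw [HahnSeries.coeff_mul, HahnSeries.coeff_mul]
      refine Finset.sum_bij (fun b _ => (toLex b.1, toLex b.2)) ?_ ?_ ?_ ?_
      · intro b hb
        rw [Finset.mem_antidiagonal] at hb ⊢
        exact ⟨hb.1, hb.2.1, congrArg toLex hb.2.2⟩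
      · intro b _ c _ h
        exact h
      · intro b hb
        rw [Finset.mem_antidiagonal] at hb
        refine ⟨(ofLex b.1, ofLex b.2), ?_, rfl⟩
        rw [Finset.mem_antidiagonal]
        exact ⟨hb.1, hb.2.1, congrArg ofLex hb.2.2⟩
      · intro b hb
        rfl)

theorem iota21Hom_injective : Function.Injective iota21Hom := by
  intro f g h
  ext a
  exact congrArg (fun F : Iter => F.coeff (toLex a)) h

instance : IsDomain Two :=
  iota21Hom_injective.isDomain iota21Hom.toRingHom

/-- The expansion `ι_{x₂,x₁} : ℂ_*((x₁, x₂)) → ℂ((x₂))((x₁))` of fractions. -/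
def iota21Frac : TwoFrac →ₐ[ℂ] Iter :=
  IsFractionRing.liftAlgHom iota21Hom_injective

/-- `W((x₁)) → W((x₁, x₂))`. -/
def inX1 : HahnSeries ℤ W →ₗ[ℂ] HahnSeries (ℤ × ℤ) W where
  toFun f :=
    { coeff := fun g => if g.2 = 0 then f.coeff g.1 else 0
      isPWO_support' := by
        refine (f.isPWO_support.image_of_monotone (f := fun a : ℤ => (a, (0 : ℤ))) ?_).mono ?_
        · intro a b hab
          exact ⟨hab, le_rfl⟩
        · rintro ⟨a, b⟩ hg
          rw [Function.mem_support, ite_ne_right_iff] at hg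
          obtain ⟨rfl, h⟩ := hg
          exact ⟨a, h, rfl⟩ }
  map_add' f g := by
    ext a
    by_cases h : a.2 = 0 <;> simp [h]
  map_smul' c f := by
    ext a
    by_cases h : a.2 = 0 <;> simp [h]

/-- `W((x₂)) → W((x₁, x₂))`. -/
def inX2 : HahnSeries ℤ W →ₗ[ℂ] HahnSeries (ℤ × ℤ) W where
  toFun f :=
    { coeff := fun g => if g.1 = 0 then f.coeff g.2 else 0
      isPWO_support' := by
        refine (f.isPWO_support.image_of_monotone (f := fun a : ℤ => ((0 : ℤ), a)) ?_).mono ?_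
        · intro a b hab
          exact ⟨le_rfl, hab⟩
        · rintro ⟨a, b⟩ hg
          rw [Function.mem_support, ite_ne_right_iff] at hg
          obtain ⟨rfl, h⟩ := hg
          exact ⟨b, h, rfl⟩ }
  map_add' f g := by
    ext a
    by_cases h : a.1 = 0 <;> simp [h]
  map_smul' c f := by
    ext a
    by_cases h : a.1 = 0 <;> simp [h]

/-- The canonical map `W ⊗ ℂ((x)) → W((x))`. -/
def toSeries : W ⊗[ℂ] HahnSeries ℤ ℂ →ₗ[ℂ] HahnSeries ℤ W :=
  TensorProduct.lift (LinearMap.mk₂ ℂ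
    (fun w f => f.map (LinearMap.toSpanSingleton ℂ W w))
    (fun a b f => by
      ext n
      simp only [HahnSeries.map_coeff, LinearMap.toSpanSingleton_apply, HahnSeries.coeff_add,
        smul_add])
    (fun c a f => by
      ext n
      simp only [HahnSeries.map_coeff, LinearMap.toSpanSingleton_apply, HahnSeries.coeff_smul]
      exact smul_comm _ _ _)
    (fun a f g => by
      ext n
      simp only [HahnSeries.map_coeff, LinearMap.toSpanSingleton_apply, HahnSeries.coeff_add,
        add_smul])
    (fun c a f => by
      ext n
      simp only [HahnSeries.map_coeff, LinearMap.toSpanSingleton_apply, HahnSeries.coeff_smul,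
        smul_assoc]))

/-- The diagonal restriction `A(x₁, x₂) ↦ A(x, x)` from `W((x₁, x₂))` to `W((x))`. -/
def diag (A : HahnSeries (ℤ × ℤ) W) : HahnSeries ℤ W where
  coeff c := ∑ᶠ a : ℤ, A.coeff (a, c - a)
  isPWO_support' := by
    refine (A.isPWO_support.image_of_monotone (f := fun g : ℤ × ℤ => g.1 + g.2) ?_).mono ?_
    · intro a b hab
      exact add_le_add hab.1 hab.2
    · intro c hc
      obtain ⟨a, ha⟩ : ∃ a : ℤ, A.coeff (a, c - a) ≠ 0 := by
        by_contra h
        push Not at h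
        exact hc ((finsum_congr h).trans finsum_zero)
      exact ⟨(a, c - a), ha, by simp⟩

/-- `∂/∂x₁` on `W((x₁, x₂))`. -/
def pderiv1 (A : HahnSeries (ℤ × ℤ) W) : HahnSeries (ℤ × ℤ) W where
  coeff g := ((g.1 : ℂ) + 1) • A.coeff (g.1 + 1, g.2)
  isPWO_support' := by
    refine (A.isPWO_support.image_of_monotone (f := fun g : ℤ × ℤ => (g.1 - 1, g.2)) ?_).mono ?_
    · intro a b hab
      exact ⟨sub_le_sub_right hab.1 1, hab.2⟩
    · intro g hg
      refine ⟨(g.1 + 1, g.2), fun h => hg ?_, by simp⟩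
      change _ • A.coeff (g.1 + 1, g.2) = 0
      rw [h, smul_zero]

/-- `∂/∂x₂` on `W((x₁, x₂))`. -/
def pderiv2 (A : HahnSeries (ℤ × ℤ) W) : HahnSeries (ℤ × ℤ) W where
  coeff g := ((g.2 : ℂ) + 1) • A.coeff (g.1, g.2 + 1)
  isPWO_support' := by
    refine (A.isPWO_support.image_of_monotone (f := fun g : ℤ × ℤ => (g.1, g.2 - 1)) ?_).mono ?_
    · intro a b hab
      exact ⟨hab.1, sub_le_sub_right hab.2 1⟩
    · intro g hg
      refine ⟨(g.1, g.2 + 1), fun h => hg ?_, by simp⟩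
      change _ • A.coeff (g.1, g.2 + 1) = 0
      rw [h, smul_zero]

/-- `p(x₁) ∂/∂x₁` on `W((x₁, x₂))`. -/
def D1 (p : HahnSeries ℤ ℂ) (A : HahnSeries (ℤ × ℤ) W) : HahnSeries (ℤ × ℤ) W :=
  act (inX1 p) (pderiv1 A)

/-- `p(x₂) ∂/∂x₂` on `W((x₁, x₂))`. -/
def D2 (p : HahnSeries ℤ ℂ) (A : HahnSeries (ℤ × ℤ) W) : HahnSeries (ℤ × ℤ) W :=
  act (inX2 p) (pderiv2 A)

/-- The coefficient of `zⁿ` in `φ(x, z) = exp (z p(x) d/dx) x`. -/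
def phiCoeff (p : HahnSeries ℤ ℂ) (n : ℕ) : HahnSeries ℤ ℂ :=
  (n.factorial : ℂ)⁻¹ •
    (fun f : HahnSeries ℤ ℂ => p * LaurentSeries.derivative ℂ f)^[n] (HahnSeries.single 1 1)

/-- The substitution `A(x₁, x₂) ↦ A(φ(x, z), x) = (exp (z p(x₁) ∂/∂x₁) A)|_{x₁ = x₂ = x}` from
`W((x₁, x₂))` to `W((x))[[z]] ⊆ W((x))((z))`, where `φ(x, z) = exp (z p(x) d/dx) x`.
For `p = 1` it is the substitution `x₁ = x + z`. -/
def subst (p : HahnSeries ℤ ℂ) (A : HahnSeries (ℤ × ℤ) W) : HahnSeries (ℤ ×ₗ ℤ) W :=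
  ofCoeffs fun n => (n.factorial : ℂ)⁻¹ • diag ((D1 p)^[n] A)

/-- A series `s(z) ∈ ℂ((z))` regarded as an element of `ℂ((x))((z))`. -/
def constInX (s : HahnSeries ℤ ℂ) : Iter :=
  HahnSeries.ofIterate (s.map (HahnSeries.C : ℂ →+* HahnSeries ℤ ℂ))

/-- The expansion `f(x₁ - x₂) = ∑ₙ (-x₂)ⁿ f⁽ⁿ⁾(x₁) / n! ∈ ℂ((x₁))[[x₂]] ⊆ ℂ((x₁))((x₂))`. -/
def shiftSub : HahnSeries ℤ ℂ →ₗ[ℂ] Iter where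
  toFun f := ofCoeffs fun n => (-1 : ℂ) ^ n • LaurentSeries.hasseDeriv ℂ n f
  map_add' f g := by
    ext a
    rw [HahnSeries.coeff_add, ofCoeffs_coeff, ofCoeffs_coeff, ofCoeffs_coeff]
    split_ifs
    · rw [map_add, smul_add, HahnSeries.coeff_add]
    · rw [add_zero]
  map_smul' c f := by
    ext a
    rw [RingHom.id_apply, HahnSeries.coeff_smul, ofCoeffs_coeff, ofCoeffs_coeff]
    split_ifs
    · rw [map_smul, smul_comm, HahnSeries.coeff_smul]
    · rw [smul_zero]

theorem finite_support_tmul (A : HahnSeries ℤ V) (B : HahnSeries ℤ H) (c : ℤ) :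
    (Function.support fun a : ℤ => A.coeff a ⊗ₜ[ℂ] B.coeff (c - a)).Finite := by
  refine (Set.finite_Icc A.order (c - B.order)).subset fun a ha => ?_
  rw [Function.mem_support] at ha
  constructor
  · by_contra h
    exact ha (by rw [HahnSeries.coeff_eq_zero_of_lt_order (not_le.mp h), TensorProduct.zero_tmul])
  · by_contra h
    exact ha (by
      rw [HahnSeries.coeff_eq_zero_of_lt_order (x := B) (by omega), TensorProduct.tmul_zero])

/-- The product `A(x) ⊗ B(x) ∈ (V ⊗ H)((x))` of `A ∈ V((x))` and `B ∈ H((x))`. -/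
def tensorSeriesFun (A : HahnSeries ℤ V) (B : HahnSeries ℤ H) : HahnSeries ℤ (V ⊗[ℂ] H) :=
  HahnSeries.ofSuppBddBelow
    (fun c : ℤ => ∑ᶠ a : ℤ, A.coeff a ⊗ₜ[ℂ] B.coeff (c - a))
    ⟨A.order + B.order, fun c hc => by
      by_contra h
      refine hc ((finsum_congr fun a => ?_).trans finsum_zero)
      by_cases ha : a < A.order
      · rw [HahnSeries.coeff_eq_zero_of_lt_order ha, TensorProduct.zero_tmul]
      · rw [HahnSeries.coeff_eq_zero_of_lt_order (x := B) (by omega),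
          TensorProduct.tmul_zero]⟩

theorem tensorSeriesFun_coeff (A : HahnSeries ℤ V) (B : HahnSeries ℤ H) (c : ℤ) :
    (tensorSeriesFun A B).coeff c = ∑ᶠ a : ℤ, A.coeff a ⊗ₜ[ℂ] B.coeff (c - a) := rfl

/-- The bilinear product `V((x)) × H((x)) → (V ⊗ H)((x))`. -/
def tensorSeries : HahnSeries ℤ V →ₗ[ℂ] HahnSeries ℤ H →ₗ[ℂ] HahnSeries ℤ (V ⊗[ℂ] H) :=
  LinearMap.mk₂ ℂ tensorSeriesFun
    (fun A A' B => by
      ext c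
      simp only [HahnSeries.coeff_add, tensorSeriesFun_coeff, TensorProduct.add_tmul]
      exact finsum_add_distrib (finite_support_tmul A B c) (finite_support_tmul A' B c))
    (fun r A B => by
      ext c
      simp only [HahnSeries.coeff_smul, tensorSeriesFun_coeff]
      rw [smul_finsum' r (finite_support_tmul A B c)]
      exact finsum_congr fun a => TensorProduct.smul_tmul' _ _ _)
    (fun A B B' => by
      ext c
      simp only [HahnSeries.coeff_add, tensorSeriesFun_coeff, TensorProduct.tmul_add]
      exact finsum_add_distrib (finite_support_tmul A B c) (finite_support_tmul A B' c))
    (fun r A B => by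
      ext c
      simp only [HahnSeries.coeff_smul, tensorSeriesFun_coeff]
      rw [smul_finsum' r (finite_support_tmul A B c)]
      exact finsum_congr fun a => TensorProduct.tmul_smul _ _ _)

/-! ## Vertex operator maps

A linear map `Y(·, x) : V → Hom(W, W((x)))` is an element of `V →ₗ[ℂ] W →ₗ[ℂ] HahnSeries ℤ W`;
a linear map `V → Hom(W, W ⊗ ℂ((x)))` is an element of
`V →ₗ[ℂ] W →ₗ[ℂ] W ⊗[ℂ] HahnSeries ℤ ℂ`. -/

/-- The map `W → W((x))` underlying a map `W → W ⊗ ℂ((x))`. -/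
def toField (Y : H →ₗ[ℂ] W →ₗ[ℂ] W ⊗[ℂ] HahnSeries ℤ ℂ) : H →ₗ[ℂ] W →ₗ[ℂ] HahnSeries ℤ W :=
  Y.compr₂ toSeries

/-- `a(x₁) b(x₂) w ∈ W((x₁))((x₂))`. -/
def prodField (a b : W →ₗ[ℂ] HahnSeries ℤ W) (w : W) : HahnSeries (ℤ ×ₗ ℤ) W :=
  HahnSeries.ofIterate ((b w).map a)

/-- `Y_W(Y(u, z)v, x)w ∈ W((x))((z))`. -/
def iterField (Y : V →ₗ[ℂ] V →ₗ[ℂ] HahnSeries ℤ V) (YW : V →ₗ[ℂ] W →ₗ[ℂ] HahnSeries ℤ W)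
    (u v : V) (w : W) : HahnSeries (ℤ ×ₗ ℤ) W :=
  HahnSeries.ofIterate ((Y u v).map (YW.flip w))

/-- For a map `a(x) : W → W((x))` and `w ⊗ f ∈ W ⊗ ℂ((x))`, the product `f(x) a(x)w`. -/
def extendField (a : W →ₗ[ℂ] HahnSeries ℤ W) : W ⊗[ℂ] HahnSeries ℤ ℂ →ₗ[ℂ] HahnSeries ℤ W :=
  TensorProduct.lift (act.flip ∘ₗ a)

/-- The map `v ⊗ h ↦ Y_W^V(v, x) Y_W^H(h, x)`. -/
def sharp (YWV : V →ₗ[ℂ] W →ₗ[ℂ] HahnSeries ℤ W)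
    (YWH : H →ₗ[ℂ] W →ₗ[ℂ] W ⊗[ℂ] HahnSeries ℤ ℂ) :
    V ⊗[ℂ] H →ₗ[ℂ] W →ₗ[ℂ] HahnSeries ℤ W :=
  TensorProduct.lift (LinearMap.mk₂ ℂ
    (fun v h => extendField (YWV v) ∘ₗ YWH h)
    (fun u v h => by
      have : extendField (YWV (u + v)) = extendField (YWV u) + extendField (YWV v) :=
        TensorProduct.ext' fun w f => by simp [extendField]
      rw [this, LinearMap.add_comp])
    (fun c v h => by
      have : extendField (YWV (c • v)) = c • extendField (YWV v) :=
        TensorProduct.ext' fun w f => by simp [extendField]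
      rw [this, LinearMap.smul_comp])
    (fun v h k => by rw [map_add, LinearMap.comp_add])
    (fun c v h => by rw [map_smul, LinearMap.comp_smul]))

/-- The deformed vertex operator map `𝔇(Y)(a, x) = ∑ Y(a₍₁₎, x) Y_V^H(a₍₂₎, x)`. -/
def deform (YV : V →ₗ[ℂ] V →ₗ[ℂ] HahnSeries ℤ V)
    (YVH : H →ₗ[ℂ] V →ₗ[ℂ] V ⊗[ℂ] HahnSeries ℤ ℂ) (ρ : V →ₗ[ℂ] V ⊗[ℂ] H) :
    V →ₗ[ℂ] V →ₗ[ℂ] HahnSeries ℤ V :=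
  sharp YV YVH ∘ₗ ρ

/-- The map `Y_W^{♯ρ}(v, x) = ∑ Y_W^V(v₍₁₎, x) Y_W^H(v₍₂₎, x)`. -/
def sharpRho (YWV : V →ₗ[ℂ] W →ₗ[ℂ] HahnSeries ℤ W)
    (YWH : H →ₗ[ℂ] W →ₗ[ℂ] W ⊗[ℂ] HahnSeries ℤ ℂ) (ρ : V →ₗ[ℂ] V ⊗[ℂ] H) :
    V →ₗ[ℂ] W →ₗ[ℂ] HahnSeries ℤ W :=
  sharp YWV YWH ∘ₗ ρ

/-- The vertex operator map `Y^⊗(v ⊗ h, x) = Y(v, x) ⊗ Y(h, x)` on `V ⊗ H`. -/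
def tensorY (YV : V →ₗ[ℂ] V →ₗ[ℂ] HahnSeries ℤ V) (YH : H →ₗ[ℂ] H →ₗ[ℂ] HahnSeries ℤ H) :
    V ⊗[ℂ] H →ₗ[ℂ] V ⊗[ℂ] H →ₗ[ℂ] HahnSeries ℤ (V ⊗[ℂ] H) :=
  (TensorProduct.map₂ YV YH).compr₂ (TensorProduct.lift tensorSeries)

/-- The product `F A(x₂)` of a scalar series `F` in two variables with a series `A(x₂) ∈ W((x₂))`,
as a linear map on `W((x₂)) ⊗ ℂ((x₁))((x₂))`. -/
def mulOuter : HahnSeries ℤ W ⊗[ℂ] Iter →ₗ[ℂ] HahnSeries (ℤ ×ₗ ℤ) W :=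
  TensorProduct.lift (act.flip ∘ₗ iota12 ∘ₗ inX2)

/-- The same on `W((x₂)) ⊗ ℂ((x₂))((x₁))`. -/
def mulInner : HahnSeries ℤ W ⊗[ℂ] Iter →ₗ[ℂ] HahnSeries (ℤ ×ₗ ℤ) W :=
  TensorProduct.lift (act.flip ∘ₗ iota21 ∘ₗ inX2)

/-! ## Nonlocal vertex algebras and modules -/

/-- `(W, Y_W)` satisfies the axioms of a module for `(V, Y, 𝟏)`: the vacuum acts as the identity and,
for `u, v ∈ V`, there is `k` with `(x₁ - x₂)ᵏ Y_W(u, x₁) Y_W(v, x₂) ∈ Hom(W, W((x₁, x₂)))` and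
`((x₁ - x₂)ᵏ Y_W(u, x₁) Y_W(v, x₂))|_{x₁ = x₂ + z} = zᵏ Y_W(Y(u, z)v, x₂)`. -/
structure IsModule (Y : V →ₗ[ℂ] V →ₗ[ℂ] HahnSeries ℤ V) (vac : V)
    (YW : V →ₗ[ℂ] W →ₗ[ℂ] HahnSeries ℤ W) : Prop where
  vacuum : ∀ w, YW vac w = HahnSeries.single 0 w
  assoc : ∀ u v, ∃ k : ℕ, ∀ w, ∃ B : HahnSeries (ℤ × ℤ) W,
    iota12 B = act (iota12 ((HahnSeries.single (1, 0) 1 - HahnSeries.single (0, 1) 1 : Two) ^ k))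
      (prodField (YW u) (YW v) w) ∧
    subst 1 B = act (HahnSeries.single (toLex ((k : ℤ), (0 : ℤ))) 1) (iterField Y YW u v w)

/-- `(V, Y, 𝟏)` is a nonlocal vertex algebra. -/
structure IsNonlocalVertexAlgebra (Y : V →ₗ[ℂ] V →ₗ[ℂ] HahnSeries ℤ V) (vac : V) : Prop
    extends IsModule Y vac Y where
  creation_regular : ∀ v, ∀ n < 0, (Y v vac).coeff n = 0
  creation : ∀ v, (Y v vac).coeff 0 = v

/-- `(H, Y, 𝟏)` with the coalgebra structure of `H` is a nonlocal vertex bialgebra: comultiplication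
and counit are homomorphisms of nonlocal vertex algebras. -/
structure IsNonlocalVertexBialgebra [Coalgebra ℂ H]
    (Y : H →ₗ[ℂ] H →ₗ[ℂ] HahnSeries ℤ H) (vac : H) : Prop
    extends IsNonlocalVertexAlgebra Y vac where
  comul_vacuum : Coalgebra.comul (R := ℂ) vac = vac ⊗ₜ[ℂ] vac
  comul_Y : ∀ h k, (Y h k).map (Coalgebra.comul (R := ℂ) (A := H)) =
    tensorY Y Y (Coalgebra.comul h) (Coalgebra.comul k)
  counit_vacuum : Coalgebra.counit (R := ℂ) vac = 1
  counit_Y : ∀ h k, (Y h k).map (Coalgebra.counit (R := ℂ) (A := H)) =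
    HahnSeries.single 0 (Coalgebra.counit (R := ℂ) h * Coalgebra.counit (R := ℂ) k)

/-- For `u, v ∈ V`, the bilinear map sending `(h, k)` to
`Y(Y_V^H(h, x₁ - x₂)u, x₂) Y_V^H(k, x₁)v ∈ V((x₁))((x₂))`. -/
def moduleAlgebraRHS (YV : V →ₗ[ℂ] V →ₗ[ℂ] HahnSeries ℤ V)
    (YVH : H →ₗ[ℂ] V →ₗ[ℂ] V ⊗[ℂ] HahnSeries ℤ ℂ) (u v : V) :
    H →ₗ[ℂ] H →ₗ[ℂ] HahnSeries (ℤ ×ₗ ℤ) V :=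
  ((TensorProduct.map₂ YV
      ((act (Γ := ℤ ×ₗ ℤ) (W := ℂ)).compl₁₂ shiftSub (iota12 ∘ₗ inX1))).compl₁₂
    (YVH.flip u) (YVH.flip v)).compr₂ mulOuter

/-- `(V, Y_V, 𝟏)` with `Y_V^H` is an `H`-module nonlocal vertex algebra. -/
structure IsModuleAlgebra [Coalgebra ℂ H] (YH : H →ₗ[ℂ] H →ₗ[ℂ] HahnSeries ℤ H) (vacH : H)
    (YV : V →ₗ[ℂ] V →ₗ[ℂ] HahnSeries ℤ V) (vacV : V)
    (YVH : H →ₗ[ℂ] V →ₗ[ℂ] V ⊗[ℂ] HahnSeries ℤ ℂ) : Prop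
    extends IsModule YH vacH (toField YVH) where
  act_vacuum : ∀ h, YVH h vacV = Coalgebra.counit (R := ℂ) h • (vacV ⊗ₜ[ℂ] 1)
  act_Y : ∀ h u v, prodField (toField YVH h) (YV u) v =
    TensorProduct.lift (moduleAlgebraRHS YV YVH u v) (Coalgebra.comul h)

/-- `ρ : V → V ⊗ H` makes `(V, Y_V, 𝟏)` a right `H`-comodule nonlocal vertex algebra. -/
structure IsComoduleAlgebra [Coalgebra ℂ H] (YH : H →ₗ[ℂ] H →ₗ[ℂ] HahnSeries ℤ H) (vacH : H)
    (YV : V →ₗ[ℂ] V →ₗ[ℂ] HahnSeries ℤ V) (vacV : V) (ρ : V →ₗ[ℂ] V ⊗[ℂ] H) : Prop where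
  map_vacuum : ρ vacV = vacV ⊗ₜ[ℂ] vacH
  map_Y : ∀ u v, (YV u v).map ρ = tensorY YV YH (ρ u) (ρ v)
  coassoc : ∀ v, TensorProduct.assoc ℂ V H H (ρ.rTensor H (ρ v)) =
    (Coalgebra.comul (R := ℂ) (A := H)).lTensor V (ρ v)
  counit : ∀ v, (Coalgebra.counit (R := ℂ) (A := H)).lTensor V (ρ v) = v ⊗ₜ[ℂ] 1

/-- Compatibility of `ρ` with `Y_V^H`: `ρ(Y_V^H(h, x)v) = (Y_V^H(h, x) ⊗ 1)ρ(v)`. -/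
def IsCompatible (YVH : H →ₗ[ℂ] V →ₗ[ℂ] V ⊗[ℂ] HahnSeries ℤ ℂ) (ρ : V →ₗ[ℂ] V ⊗[ℂ] H) : Prop :=
  ∀ h v, ρ.rTensor (HahnSeries ℤ ℂ) (YVH h v) =
    TensorProduct.rightComm ℂ V (HahnSeries ℤ ℂ) H ((YVH h).rTensor H (ρ v))

/-! ## Group actions -/

/-- `(V, Y, 𝟏)` with the representation `R` is a `(G, χ)`-module nonlocal vertex algebra:
`R(g)𝟏 = 𝟏` and `R(g) Y(v, x) R(g)⁻¹ = Y(R(g)v, χ(g)x)`. -/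
structure IsGroupModuleAlgebra [Group G] (χ : G →* ℂˣ)
    (Y : V →ₗ[ℂ] V →ₗ[ℂ] HahnSeries ℤ V) (vac : V) (R : Representation ℂ G V) : Prop
    extends IsNonlocalVertexAlgebra Y vac where
  map_vacuum : ∀ g, R g vac = vac
  map_Y : ∀ g v w n, R g ((Y v (R g⁻¹ w)).coeff n) = (χ g : ℂ) ^ n • (Y (R g v) w).coeff n

/-- `(H, Y, 𝟏)` with the representation `R` is a `(G, χ)`-module nonlocal vertex bialgebra: `G` also
acts by automorphisms of the coalgebra `H`. -/
structure IsGroupModuleBialgebra [Group G] [Coalgebra ℂ H] (χ : G →* ℂˣ)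
    (Y : H →ₗ[ℂ] H →ₗ[ℂ] HahnSeries ℤ H) (vac : H) (R : Representation ℂ G H) : Prop
    extends IsNonlocalVertexBialgebra Y vac, IsGroupModuleAlgebra χ Y vac R where
  map_comul : ∀ g h, Coalgebra.comul (R := ℂ) (R g h) =
    TensorProduct.map (R g) (R g) (Coalgebra.comul (R := ℂ) h)
  map_counit : ∀ g h, Coalgebra.counit (R := ℂ) (R g h) = Coalgebra.counit (R := ℂ) h

/-- `R_V(g) Y_V^H(h, x)v = Y_V^H(R_H(g)h, χ(g)x) R_V(g)v`. -/
def IsGroupCompatible [Group G] (χ : G →* ℂˣ) (RH : Representation ℂ G H)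
    (RV : Representation ℂ G V) (YVH : H →ₗ[ℂ] V →ₗ[ℂ] V ⊗[ℂ] HahnSeries ℤ ℂ) : Prop :=
  ∀ g h v n, RV g ((toField YVH h v).coeff n) =
    (χ g : ℂ) ^ n • (toField YVH (RH g h) (RV g v)).coeff n

/-- `φ(x, χ(g)z) = χ_φ(g) φ(χ_φ(g)⁻¹x, z)` for all `g`, coefficient by coefficient. -/
def IsPhiCharacter [Group G] (χ χφ : G →* ℂˣ) (p : HahnSeries ℤ ℂ) : Prop :=
  ∀ (g : G) (n : ℕ) (m : ℤ), (χ g : ℂ) ^ n * (phiCoeff p n).coeff m =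
    (χφ g : ℂ) * (((χφ g : ℂ)⁻¹) ^ m * (phiCoeff p n).coeff m)

/-- `ℂ_{χ_φ(G)}[x]`, the multiplicative monoid generated by the polynomials `x - χ_φ(g)`. -/
def rootMonoid [Group G] (χφ : G →* ℂˣ) : Submonoid (Polynomial ℂ) :=
  Submonoid.closure (Set.range fun g : G => Polynomial.X - Polynomial.C (χφ g : ℂ))

/-- `q(x₁ / x₂) ∈ ℂ((x₁, x₂))`. -/
def evalRatio12 (q : Polynomial ℂ) : Two :=
  Polynomial.aeval (HahnSeries.single ((1 : ℤ), (-1 : ℤ)) (1 : ℂ)) q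

/-- `q(x₂ / x₁) ∈ ℂ((x₁, x₂))`. -/
def evalRatio21 (q : Polynomial ℂ) : Two :=
  Polynomial.aeval (HahnSeries.single ((-1 : ℤ), (1 : ℤ)) (1 : ℂ)) q

/-! ## `φ`-coordinated quasi modules -/

/-- `(W, Y_W)` is a `φ`-coordinated quasi module for `(V, Y, 𝟏)`, `φ(x, z) = exp (z p(x) d/dx) x`. -/
structure IsPhiQuasiModule (p : HahnSeries ℤ ℂ) (Y : V →ₗ[ℂ] V →ₗ[ℂ] HahnSeries ℤ V) (vac : V)
    (YW : V →ₗ[ℂ] W →ₗ[ℂ] HahnSeries ℤ W) : Prop where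
  vacuum : ∀ w, YW vac w = HahnSeries.single 0 w
  assoc : ∀ u v, ∃ f : Two, f ≠ 0 ∧ ∀ w, ∃ B : HahnSeries (ℤ × ℤ) W,
    iota12 B = act (iota12 f) (prodField (YW u) (YW v) w) ∧
    subst p B = act (subst p f) (iterField Y YW u v w)

/-- `(W, Y_W)` is a `(G, χ_φ)`-equivariant `φ`-coordinated quasi module for `(V, Y, 𝟏, R)`. -/
structure IsEquivariantPhiQuasiModule [Group G] (χφ : G →* ℂˣ) (p : HahnSeries ℤ ℂ)
    (Y : V →ₗ[ℂ] V →ₗ[ℂ] HahnSeries ℤ V) (vac : V) (R : Representation ℂ G V)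
    (YW : V →ₗ[ℂ] W →ₗ[ℂ] HahnSeries ℤ W) : Prop
    extends IsPhiQuasiModule p Y vac YW where
  equivariant : ∀ g v w n, (YW (R g v) w).coeff n = ((χφ g : ℂ)⁻¹) ^ n • (YW v w).coeff n
  quasi_local : ∀ u v, ∃ q ∈ rootMonoid χφ, ∀ w, ∃ B : HahnSeries (ℤ × ℤ) W,
    iota12 B = act (iota12 (evalRatio12 q)) (prodField (YW u) (YW v) w)

/-- The subalgebra `ℂ_φ((x₁, x₂))` of `ℂ_*((x₁, x₂))`: all `F` with
`p(x₁) ∂F/∂x₁ = - p(x₂) ∂F/∂x₂`. For `F = f / g` the derivatives are given by the quotient rule, and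
the common denominator `g²` is cleared. -/
def phiFractions (p : HahnSeries ℤ ℂ) : Set TwoFrac :=
  {F | ∃ f g : Two, g ≠ 0 ∧ F = algebraMap Two TwoFrac f / algebraMap Two TwoFrac g ∧
    g * D1 p f - f * D1 p g = -(g * D2 p f - f * D2 p g)}

/-- `s(z) = F(φ(x, z), x)` in `ℂ((x))((z))`, where `F(φ(x, z), x)` is the quotient of
`f(φ(x, z), x)` by `g(φ(x, z), x)` for `F = f / g`. -/
def IsPhiValue (p : HahnSeries ℤ ℂ) (F : TwoFrac) (s : HahnSeries ℤ ℂ) : Prop :=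
  ∃ f g : Two, g ≠ 0 ∧ F = algebraMap Two TwoFrac f / algebraMap Two TwoFrac g ∧
    constInX s = subst p f / subst p g

/-- `t ∈ V ⊗ ℂ_φ((x₁, x₂))` and `(1 ⊗ π_φ)(t) = y`, where `π_φ(F) = F(φ(x, z), x)`. As `π_φ` is
injective, `t = (1 ⊗ π_φ⁻¹)(y)` is determined by `y`; it exists if and only if
`y ∈ V ⊗ ℂ_φ((z))`. -/
def IsPhiLift (p : HahnSeries ℤ ℂ) (y : V ⊗[ℂ] HahnSeries ℤ ℂ) (t : V ⊗[ℂ] TwoFrac) : Prop :=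
  ∃ (n : ℕ) (a : Fin n → V) (F : Fin n → TwoFrac) (s : Fin n → HahnSeries ℤ ℂ),
    (∀ i, F i ∈ phiFractions p ∧ IsPhiValue p (F i) (s i)) ∧
    t = ∑ i, a i ⊗ₜ[ℂ] F i ∧ y = ∑ i, a i ⊗ₜ[ℂ] s i

/-- `Y_V^H` is a `φ`-compatible `H`-module nonlocal vertex algebra structure (relative to `χ_φ`): for
all `h, v` one has `Y_V^H(h, z)v ∈ V ⊗ ℂ_φ((z))` and there is `q ∈ ℂ_{χ_φ(G)}[x]` with
`q(x₂ / x₁) Ŷ_V^H(h, x₁, x₂)v ∈ V ⊗ ℂ((x₁, x₂))`. -/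
structure IsPhiCompatibleModuleAlgebra [Group G] [Coalgebra ℂ H] (χφ : G →* ℂˣ)
    (p : HahnSeries ℤ ℂ) (YH : H →ₗ[ℂ] H →ₗ[ℂ] HahnSeries ℤ H) (vacH : H)
    (YV : V →ₗ[ℂ] V →ₗ[ℂ] HahnSeries ℤ V) (vacV : V)
    (YVH : H →ₗ[ℂ] V →ₗ[ℂ] V ⊗[ℂ] HahnSeries ℤ ℂ) : Prop
    extends IsModuleAlgebra YH vacH YV vacV YVH where
  phi_compatible : ∀ h v, ∃ t : V ⊗[ℂ] TwoFrac, IsPhiLift p (YVH h v) t ∧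
    ∃ q ∈ rootMonoid χφ, ∃ T : V ⊗[ℂ] Two,
      (LinearMap.mulLeft ℂ (algebraMap Two TwoFrac (evalRatio21 q))).lTensor V t =
        (IsScalarTower.toAlgHom ℂ Two TwoFrac).toLinearMap.lTensor V T

/-- The bilinear map sending `v ⊗ F ∈ V ⊗ ℂ_*((x₁, x₂))` and `w ⊗ g ∈ W ⊗ ℂ((x₁))` to
`Y_W^V(ι_{x₂,x₁}(F(x₁, x₂)) v, x₂) (g(x₁) w) ∈ W((x₂))((x₁))`. -/
def pairRHS (YWV : V →ₗ[ℂ] W →ₗ[ℂ] HahnSeries ℤ W) :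
    V ⊗[ℂ] TwoFrac →ₗ[ℂ] W ⊗[ℂ] HahnSeries ℤ ℂ →ₗ[ℂ] HahnSeries (ℤ ×ₗ ℤ) W :=
  (TensorProduct.map₂ YWV
    ((act (Γ := ℤ ×ₗ ℤ) (W := ℂ)).compl₁₂ iota21Frac.toLinearMap (iota21 ∘ₗ inX1))).compr₂ mulInner

/-- `(W, Y_W^H, Y_W^V)` is a `(G, χ_φ)`-equivariant `φ`-coordinated quasi `(H, V)`-module. The
last condition is the identity
`Y_W^H(h, x₁) Y_W^V(v, x₂) = ∑ Y_W^V(ι_{x₂,x₁} Ŷ_V^H(h₍₁₎, x₁, x₂)v, x₂) Y_W^H(h₍₂₎, x₁)`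
of the coefficients of `x₁ᵐ x₂ⁿ`; the left side lies in `W((x₁))((x₂))` and the right
side in `W((x₂))((x₁))`. -/
structure IsEquivariantPhiQuasiPairModule [Group G] [Coalgebra ℂ H] (χφ : G →* ℂˣ)
    (p : HahnSeries ℤ ℂ)
    (YH : H →ₗ[ℂ] H →ₗ[ℂ] HahnSeries ℤ H) (vacH : H) (RH : Representation ℂ G H)
    (YV : V →ₗ[ℂ] V →ₗ[ℂ] HahnSeries ℤ V) (vacV : V) (RV : Representation ℂ G V)
    (YVH : H →ₗ[ℂ] V →ₗ[ℂ] V ⊗[ℂ] HahnSeries ℤ ℂ)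
    (YWH : H →ₗ[ℂ] W →ₗ[ℂ] W ⊗[ℂ] HahnSeries ℤ ℂ)
    (YWV : V →ₗ[ℂ] W →ₗ[ℂ] HahnSeries ℤ W) : Prop where
  module_H : IsEquivariantPhiQuasiModule χφ p YH vacH RH (toField YWH)
  module_V : IsEquivariantPhiQuasiModule χφ p YV vacV RV YWV
  commute : ∀ (h : H) (v : V) (w : W) (N : ℕ) (l r : Fin N → H) (t : Fin N → V ⊗[ℂ] TwoFrac),
    Coalgebra.comul (R := ℂ) h = ∑ i, l i ⊗ₜ[ℂ] r i →
    (∀ i, IsPhiLift p (YVH (l i) v) (t i)) →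
    ∀ m n : ℤ, (prodField (toField YWH h) (YWV v) w).coeff (toLex (n, m)) =
      (∑ i, pairRHS YWV (t i) (YWH (r i) w)).coeff (toLex (m, n))

end VertexDeformation

end

open scoped TensorProduct

noncomputable section

/-! Both conclusions come from one computation. Write L ~ R (`SubstRel p`) when L is the expansion
in W((x₁))((x₂)), and R the restriction to x₁ = φ(x, z), x₂ = x, of one element of W((x₁, x₂)).
Associativity of a module says f Y(u, x₁)Y(v, x₂)w ~ f(φ(x, z), x) Y(Y(u, z)v, x)w for some f. The
relation is additive and compatible with multiplication by ℂ((x₁, x₂)). The left side determines the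
right, and nonzero scalars can be cancelled because substitution is injective when p ≠ 0
(`subst_injective`).

For u ⊗ h and v ⊗ k the product to study is Y^V(u, x₁) Y^H(h, x₁) Y^V(v, x₂) Y^H(k, x₂). An exchange
relation (`IsExchange`) moves Y^H(h, x₁) past Y^V(v, x₂): after multiplication by some q, the
coefficients lie in V ⊗ ℂ((x₁, x₂)) and restrict to q Y_V^H(h₍₁₎, z)v. The two V-factors are merged
by associativity of V. The two H-factors take values in W ⊗ ℂ((x)), so their product needs no
denominator and equals the iterate after substitution (`rowX2_eq_of_assoc`). The outcome is the map
v ⊗ h ↦ Y^V(v, x) Y^H(h, x) applied to the smash product ∑ Y(u, z)Y_V^H(h₍₁₎, z)v ⊗ Y(h₍₂₎, z)k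
(`exists_substRel_sharp_tmul`). The coaction intertwines the deformed product with this smash
product, by coassociativity, compatibility with the H-action and cocommutativity (`mapL_deform`,
`smashY_tmul`), which gives associativity for `sharpRho`.

For p = 1 and W = V, exchange is the module algebra axiom with poles along x₁ = x₂ cleared by powers
of x₁ - x₂. This gives the deformed algebra. For general p it is the commutation relation of the (H,
V)-module with denominators q(x₁/x₂). Denominators are kept inside a submonoid S throughout, so the
same statement yields the exponent k in one case and quasi-locality in the other. -/

namespace VertexDeformation

/-! ### Scalar series acting on vector-valued series -/

section ActCoeff

variable {Γ : Type*} [AddCommGroup Γ] [PartialOrder Γ] [IsOrderedAddMonoid Γ]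
variable {W : Type*} [AddCommGroup W] [Module ℂ W]
variable {U : Type*} [AddCommGroup U] [Module ℂ U]

theorem finite_support_act (f : HahnSeries Γ ℂ) (A : HahnSeries Γ W) (c : Γ) :
    (Function.support fun a : Γ => f.coeff a • A.coeff (c - a)).Finite := by
  classical
  refine ((Finset.antidiagonal f.isPWO_support A.isPWO_support c).image
    Prod.fst).finite_toSet.subset ?_
  intro a ha
  rw [Function.mem_support] at ha
  rw [Finset.mem_coe, Finset.mem_image]
  refine ⟨(a, c - a), ?_, rfl⟩
  rw [Finset.mem_antidiagonal]
  exact ⟨fun h => ha (by rw [h, zero_smul]), fun h => ha (by rw [h, smul_zero]),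
    add_sub_cancel a c⟩

/-- A `finsum` over the whole group no longer mentions supports, so the convolution can be reindexed
by equivalences and pushed through linear maps. -/
theorem act_coeff (f : HahnSeries Γ ℂ) (A : HahnSeries Γ W) (c : Γ) :
    (act f A).coeff c = ∑ᶠ a : Γ, f.coeff a • A.coeff (c - a) := by
  classical
  have h1 : (act f A).coeff c = ∑ ij ∈ Finset.antidiagonal f.isPWO_support A.isPWO_support c,
      f.coeff ij.1 • A.coeff ij.2 := HahnModule.coeff_smul f ((HahnModule.of ℂ) A) c
  rw [h1, finsum_eq_sum_of_support_subset (s := (Finset.antidiagonal f.isPWO_support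
    A.isPWO_support c).image Prod.fst)]
  · rw [Finset.sum_image]
    · refine Finset.sum_congr rfl fun x hx => ?_
      rw [Finset.mem_antidiagonal] at hx
      rw [← hx.2.2, add_sub_cancel_left]
    · intro x hx y hy hxy
      rw [Finset.mem_coe, Finset.mem_antidiagonal] at hx hy
      refine Prod.ext hxy ?_
      have := hx.2.2.trans hy.2.2.symm
      rw [hxy] at this
      exact add_left_cancel this
  · intro a ha
    rw [Function.mem_support] at ha
    rw [Finset.mem_coe, Finset.mem_image]
    refine ⟨(a, c - a), ?_, rfl⟩
    rw [Finset.mem_antidiagonal]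
    exact ⟨fun h => ha (by rw [h, zero_smul]), fun h => ha (by rw [h, smul_zero]),
      add_sub_cancel a c⟩

theorem act_mul (f g : HahnSeries Γ ℂ) (A : HahnSeries Γ W) :
    act (f * g) A = act f (act g A) :=
  congrArg (HahnModule.of ℂ).symm (mul_smul f g (HahnModule.of ℂ A))

@[simp] theorem act_one (A : HahnSeries Γ W) : act (1 : HahnSeries Γ ℂ) A = A :=
  congrArg (HahnModule.of ℂ).symm (one_smul (HahnSeries Γ ℂ) (HahnModule.of ℂ A))

theorem act_eq_mul (f g : HahnSeries Γ ℂ) : act f g = f * g := rfl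

theorem act_comm (f g : HahnSeries Γ ℂ) (A : HahnSeries Γ W) :
    act f (act g A) = act g (act f A) := by
  rw [← act_mul, mul_comm, act_mul]

theorem act_single (c : Γ) (r : ℂ) (A : HahnSeries Γ W) (b : Γ) :
    (act (HahnSeries.single c r) A).coeff b = r • A.coeff (b - c) := by
  rw [act_coeff, finsum_eq_single _ c]
  · rw [HahnSeries.coeff_single_same]
  · intro a ha
    rw [HahnSeries.coeff_single_of_ne ha, zero_smul]

omit [AddCommGroup Γ] [IsOrderedAddMonoid Γ] in
/-- Application of a linear map to the coefficients of a series. -/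
def mapL (l : W →ₗ[ℂ] U) : HahnSeries Γ W →ₗ[ℂ] HahnSeries Γ U where
  toFun A := A.map l
  map_add' A B := by ext; simp
  map_smul' c A := by ext; simp

omit [AddCommGroup Γ] [IsOrderedAddMonoid Γ] in
@[simp] theorem mapL_coeff (l : W →ₗ[ℂ] U) (A : HahnSeries Γ W) (c : Γ) :
    (mapL l A).coeff c = l (A.coeff c) := rfl

theorem mapL_act (l : W →ₗ[ℂ] U) (f : HahnSeries Γ ℂ) (A : HahnSeries Γ W) :
    mapL l (act f A) = act f (mapL l A) := by
  ext c
  rw [mapL_coeff, act_coeff, act_coeff, map_finsum _ (finite_support_act f A c)]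
  exact finsum_congr fun a => by rw [map_smul, mapL_coeff]

end ActCoeff

/-! ### Cancellation over a linearly ordered exponent group -/

section Cancel

variable {Γ : Type*} [AddCommGroup Γ] [LinearOrder Γ] [IsOrderedAddMonoid Γ]
variable {W : Type*} [AddCommGroup W] [Module ℂ W]

/-- For a linear order the scalar series form a field, so a nonzero f acts invertibly. The product
order on ℤ × ℤ is not covered: cancellation takes place after expansion or substitution. -/
theorem act_injective {f : HahnSeries Γ ℂ} (hf : f ≠ 0) :
    Function.Injective (act f : HahnSeries Γ W → HahnSeries Γ W) := by
  intro A B h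
  have h2 := congrArg (act f⁻¹) h
  rwa [← act_mul, ← act_mul, inv_mul_cancel₀ hf, act_one, act_one] at h2

end Cancel

/-! ### Two-variable series: expansions, the derivation D1, the diagonal -/

section TwoVar

variable {W : Type*} [AddCommGroup W] [Module ℂ W]

theorem iota12_coeff (A : HahnSeries (ℤ × ℤ) W) (n m : ℤ) :
    (iota12 A).coeff (toLex (n, m)) = A.coeff (m, n) := rfl

theorem iota12_injective :
    Function.Injective (iota12 : HahnSeries (ℤ × ℤ) W → HahnSeries (ℤ ×ₗ ℤ) W) := by
  intro A B h
  ext ⟨a, b⟩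
  exact congrArg (fun F : HahnSeries (ℤ ×ₗ ℤ) W => F.coeff (toLex (b, a))) h

theorem iota12_act (f : Two) (A : HahnSeries (ℤ × ℤ) W) :
    iota12 (act f A) = act (iota12 f) (iota12 A) := by
  ext c
  change (act f A).coeff ((ofLex c).2, (ofLex c).1) = _
  rw [act_coeff, act_coeff]
  exact (finsum_comp_equiv ((Equiv.prodComm ℤ ℤ).trans toLex)
    (f := fun a : ℤ ×ₗ ℤ => (iota12 f).coeff a • (iota12 A).coeff (c - a))).symm ▸
    finsum_congr fun a => rfl

theorem iota21_act (f : Two) (A : HahnSeries (ℤ × ℤ) W) :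
    iota21 (act f A) = act (iota21 f) (iota21 A) := by
  ext c
  change (act f A).coeff (ofLex c) = _
  rw [act_coeff, act_coeff]
  exact (finsum_comp_equiv (toLex : ℤ × ℤ ≃ ℤ ×ₗ ℤ)
    (f := fun a : ℤ ×ₗ ℤ => (iota21 f).coeff a • (iota21 A).coeff (c - a))).symm ▸
    finsum_congr fun a => rfl

theorem iota12_mul (f g : Two) : iota12 (f * g) = iota12 f * iota12 g := iota12_act f g

theorem iota12_one : iota12 (1 : Two) = 1 := by
  ext c
  change (1 : Two).coeff ((ofLex c).2, (ofLex c).1) = (1 : Iter).coeff c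
  by_cases h : c = 0
  · subst h
    rw [HahnSeries.coeff_one, HahnSeries.coeff_one, if_pos rfl, if_pos]
    rfl
  · rw [HahnSeries.coeff_one, HahnSeries.coeff_one, if_neg h, if_neg]
    intro h2
    exact h (Prod.ext (congrArg Prod.snd h2) (congrArg Prod.fst h2) : ofLex c = 0)

/-- Series in swapped iterated completions with the same coefficients keep this property under
multiplication by a series in both variables. -/
theorem act_swap (f : Two) (P Q : HahnSeries (ℤ ×ₗ ℤ) W)
    (h : ∀ m n : ℤ, P.coeff (toLex (n, m)) = Q.coeff (toLex (m, n))) (m n : ℤ) :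
    (act (iota12 f) P).coeff (toLex (n, m)) = (act (iota21 f) Q).coeff (toLex (m, n)) := by
  rw [act_coeff, act_coeff]
  rw [← finsum_comp_equiv ((ofLex.trans (Equiv.prodComm ℤ ℤ)).trans toLex : (ℤ ×ₗ ℤ) ≃ (ℤ ×ₗ ℤ))]
  refine finsum_congr fun a => ?_
  exact congrArg₂ (· • ·) rfl (h _ _)

theorem inX1_coeff (f : HahnSeries ℤ W) (a b : ℤ) :
    (inX1 f).coeff (a, b) = if b = 0 then f.coeff a else 0 := rfl

theorem inX2_coeff (f : HahnSeries ℤ W) (a b : ℤ) :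
    (inX2 f).coeff (a, b) = if a = 0 then f.coeff b else 0 := rfl

omit [Module ℂ W] in
theorem finsum_eq_finsum_comp {α β : Type*} (F : β → W) {e : α → β} (he : Function.Injective e)
    (h : ∀ b, b ∉ Set.range e → F b = 0) : ∑ᶠ b, F b = ∑ᶠ a, F (e a) := by
  rw [← finsum_mem_range (f := F) he, finsum_mem_def]
  refine finsum_congr fun b => ?_
  by_cases hb : b ∈ Set.range e
  · rw [Set.indicator_of_mem hb]
  · rw [Set.indicator_of_notMem hb, h b hb]

theorem act_inX1_coeff (f : HahnSeries ℤ ℂ) (A : HahnSeries (ℤ × ℤ) W) (c d : ℤ) :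
    (act (inX1 f) A).coeff (c, d) = ∑ᶠ a : ℤ, f.coeff a • A.coeff (c - a, d) := by
  rw [act_coeff, finsum_eq_finsum_comp _ (e := fun a : ℤ => (a, (0 : ℤ)))
    (fun a b hab => congrArg Prod.fst hab)]
  · refine finsum_congr fun a => ?_
    rw [inX1_coeff, if_pos rfl, Prod.mk_sub_mk, sub_zero]
  · rintro ⟨a, b⟩ hb
    rw [inX1_coeff, if_neg, zero_smul]
    rintro rfl
    exact hb ⟨a, rfl⟩

theorem inX1_act (f : HahnSeries ℤ ℂ) (A : HahnSeries ℤ W) :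
    inX1 (act f A) = act (inX1 f) (inX1 A) := by
  ext ⟨c, d⟩
  rw [act_inX1_coeff, inX1_coeff]
  split_ifs with h
  · rw [act_coeff]
    exact finsum_congr fun a => by rw [inX1_coeff, if_pos h]
  · exact ((finsum_congr fun a => by rw [inX1_coeff, if_neg h, smul_zero]).trans finsum_zero).symm

theorem inX1_mul (f g : HahnSeries ℤ ℂ) : inX1 (f * g) = inX1 f * inX1 g := inX1_act f g

theorem pderiv1_coeff (A : HahnSeries (ℤ × ℤ) W) (a b : ℤ) :
    (pderiv1 A).coeff (a, b) = ((a : ℂ) + 1) • A.coeff (a + 1, b) := rfl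

theorem pderiv1_add (A B : HahnSeries (ℤ × ℤ) W) : pderiv1 (A + B) = pderiv1 A + pderiv1 B := by
  ext ⟨a, b⟩
  rw [HahnSeries.coeff_add, pderiv1_coeff, pderiv1_coeff, pderiv1_coeff, HahnSeries.coeff_add,
    smul_add]

theorem pderiv1_smul (c : ℂ) (A : HahnSeries (ℤ × ℤ) W) : pderiv1 (c • A) = c • pderiv1 A := by
  ext ⟨a, b⟩
  rw [HahnSeries.coeff_smul, pderiv1_coeff, pderiv1_coeff, HahnSeries.coeff_smul, smul_comm]

theorem pderiv1_act (f : Two) (A : HahnSeries (ℤ × ℤ) W) :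
    pderiv1 (act f A) = act (pderiv1 f) A + act f (pderiv1 A) := by
  ext ⟨c, d⟩
  rw [HahnSeries.coeff_add, pderiv1_coeff, act_coeff, act_coeff, act_coeff,
    smul_finsum' _ (finite_support_act f A (c + 1, d))]
  -- After this shift by one both sums run over the same products of coefficients, with weights a₁
  -- and c + 1 - a₁, which add up to c + 1.
  have h1 : ∑ᶠ a : ℤ × ℤ, (pderiv1 f).coeff a • A.coeff ((c, d) - a) =
      ∑ᶠ a : ℤ × ℤ, ((a.1 : ℂ) * f.coeff a) • A.coeff ((c + 1, d) - a) := by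
    rw [← finsum_comp_equiv (Equiv.addRight ((-1 : ℤ), (0 : ℤ)))]
    refine finsum_congr fun ⟨a, b⟩ => ?_
    simp only [Equiv.coe_addRight, Prod.mk_add_mk, add_zero, pderiv1_coeff, Prod.mk_sub_mk,
      smul_eq_mul, neg_add_cancel_right]
    rw [show c - (a + -1) = c + 1 - a by ring]
    push_cast
    rw [neg_add_cancel_right]
  rw [h1, ← finsum_add_distrib]
  · refine finsum_congr fun ⟨a, b⟩ => ?_
    simp only [Prod.mk_sub_mk, pderiv1_coeff]
    rw [show c - a + 1 = c + 1 - a by ring, smul_smul, smul_smul, ← add_smul]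
    congr 1
    push_cast
    ring
  · refine (finite_support_act f A (c + 1, d)).subset fun a ha h => ha ?_
    change (_ * _) • _ = (0 : W)
    rw [mul_smul]
    exact (congrArg _ h).trans (smul_zero _)
  · exact finite_support_act _ _ _

/-- `p(x₁) ∂/∂x₁` as a linear map. -/
def D1L (p : HahnSeries ℤ ℂ) : HahnSeries (ℤ × ℤ) W →ₗ[ℂ] HahnSeries (ℤ × ℤ) W where
  toFun := D1 p
  map_add' A B := by rw [D1, pderiv1_add, map_add]; rfl
  map_smul' c A := by rw [D1, pderiv1_smul, map_smul]; rfl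

theorem D1L_apply (p : HahnSeries ℤ ℂ) (A : HahnSeries (ℤ × ℤ) W) : D1L p A = D1 p A := rfl

theorem D1_act (p : HahnSeries ℤ ℂ) (f : Two) (A : HahnSeries (ℤ × ℤ) W) :
    D1 p (act f A) = act (D1 p f) A + act f (D1 p A) := by
  rw [D1, pderiv1_act, map_add, ← act_mul, act_comm]
  rfl

/-- By the Leibniz rule, D on a product lifts to D ⊗ 1 + 1 ⊗ D on the tensor product. The two
summands commute, so the binomial theorem applies. -/
theorem D1_iterate_act (p : HahnSeries ℤ ℂ) (f : Two) (A : HahnSeries (ℤ × ℤ) W) (n : ℕ) :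
    ((D1L p) ^ n) (act f A) = ∑ ij ∈ Finset.HasAntidiagonal.antidiagonal n,
      (n.choose ij.1 : ℂ) • act ((D1L p ^ ij.1) f) ((D1L p ^ ij.2) A) := by
  have h : ∀ n, ∀ t : Two ⊗[ℂ] HahnSeries (ℤ × ℤ) W,
      ((D1L p) ^ n) (TensorProduct.lift act t) = TensorProduct.lift act
        ((((D1L p).rTensor _ + (D1L p).lTensor _ :
          Module.End ℂ (Two ⊗[ℂ] HahnSeries (ℤ × ℤ) W)) ^ n) t) := by
    intro n
    induction n with
    | zero => intro t; simp
    | succ n ih =>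
      intro t
      rw [pow_succ, pow_succ, Module.End.mul_apply, Module.End.mul_apply, ← ih]
      congr 1
      induction t with
      | zero => simp
      | add x y hx hy => rw [map_add, map_add, hx, hy, map_add, map_add]
      | tmul g B =>
        change D1 p (act g B) = TensorProduct.lift act ((D1L p g) ⊗ₜ B + g ⊗ₜ D1L p B)
        rw [D1_act, map_add]
        rfl
  have hc : Commute ((D1L p : Two →ₗ[ℂ] Two).rTensor (HahnSeries (ℤ × ℤ) W))
      ((D1L p).lTensor Two) := by
    change _ ∘ₗ _ = _ ∘ₗ _
    rw [LinearMap.rTensor_comp_lTensor, LinearMap.lTensor_comp_rTensor]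
  have h2 := h n (f ⊗ₜ A)
  rw [TensorProduct.lift.tmul] at h2
  rw [h2, hc.add_pow', LinearMap.sum_apply, map_sum]
  refine Finset.sum_congr rfl fun ij _ => ?_
  rw [← Nat.cast_smul_eq_nsmul ℂ, LinearMap.smul_apply, map_smul]
  congr 1
  rw [LinearMap.rTensor_pow, LinearMap.lTensor_pow]
  rfl

omit [Module ℂ W] in
theorem diag_coeff (A : HahnSeries (ℤ × ℤ) W) (c : ℤ) :
    (diag A).coeff c = ∑ᶠ a : ℤ, A.coeff (a, c - a) := rfl

omit [Module ℂ W] in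
-- The coordinate projections are monotone, so they send the partially well-ordered support to
-- well-founded sets of integers, which have minima. This is what makes diagonal sums finite.
theorem exists_lower_bound (A : HahnSeries (ℤ × ℤ) W) :
    ∃ N : ℤ, ∀ a b : ℤ, A.coeff (a, b) ≠ 0 → N ≤ a ∧ N ≤ b := by
  have hb : ∀ f : ℤ × ℤ → ℤ, Monotone f → ∃ N : ℤ, ∀ x ∈ A.support, N ≤ f x := by
    intro f hf
    have h := A.isPWO_support.image_of_monotone hf
    by_cases he : (f '' A.support).Nonempty
    · refine ⟨h.isWF.min he, fun x hx => ?_⟩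
      exact h.isWF.min_le he ⟨x, hx, rfl⟩
    · rw [Set.not_nonempty_iff_eq_empty] at he
      exact ⟨0, fun x hx => (Set.eq_empty_iff_forall_notMem.mp he _ ⟨x, hx, rfl⟩).elim⟩
  obtain ⟨M, hM⟩ := hb Prod.fst monotone_fst
  obtain ⟨N, hN⟩ := hb Prod.snd monotone_snd
  exact ⟨min M N, fun a b h => ⟨(min_le_left _ _).trans (hM _ h), (min_le_right _ _).trans (hN _ h)⟩⟩

omit [Module ℂ W] in
theorem finite_support_diag (A : HahnSeries (ℤ × ℤ) W) (c : ℤ) :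
    (Function.support fun a : ℤ => A.coeff (a, c - a)).Finite := by
  obtain ⟨N, hN⟩ := exists_lower_bound A
  refine (Set.finite_Icc N (c - N)).subset fun a ha => ?_
  have := hN _ _ ha
  exact ⟨this.1, by omega⟩

/-- Each side is a finite sum over triples of exponents, finite because both supports are bounded
below. The two parametrisations differ by a bijection. -/
theorem diag_act (f : Two) (A : HahnSeries (ℤ × ℤ) W) :
    diag (act f A) = act (diag f) (diag A) := by
  ext c
  obtain ⟨M, hM⟩ := exists_lower_bound f
  obtain ⟨N, hN⟩ := exists_lower_bound A
  -- The source triple is (total degree of the f-term, x₁-exponent of f, x₁-exponent of A). The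
  -- target triple is (x₁-exponent of the product, both exponents of f).
  let e : ℤ × ℤ × ℤ ≃ ℤ × ℤ × ℤ :=
    { toFun := fun t => (t.2.1 + t.2.2, t.2.1, t.1 - t.2.1)
      invFun := fun t => (t.2.1 + t.2.2, t.2.1, t.1 - t.2.1)
      left_inv := fun t => by ext <;> simp
      right_inv := fun t => by ext <;> simp }
  let F : ℤ × ℤ × ℤ → W := fun t => f.coeff (t.2.1, t.2.2) • A.coeff (t.1 - t.2.1, c - t.1 - t.2.2)
  have hF : (Function.support F).Finite := by
    refine ((Set.finite_Icc (M + N) (c - M - N)).prod ((Set.finite_Icc M (c - M - N - N)).prod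
      (Set.finite_Icc M (c - M - N - N)))).subset ?_
    rintro ⟨a, x, y⟩ h
    rw [Function.mem_support] at h
    have h1 := hM x y fun h0 => h (by simp only [F]; rw [h0, zero_smul])
    have h2 := hN (a - x) (c - a - y) fun h0 => h (by simp only [F]; rw [h0, smul_zero])
    simp only [Set.mem_prod, Set.mem_Icc]
    omega
  have hl : (diag (act f A)).coeff c = ∑ᶠ t, F t := by
    rw [finsum_curry F hF, diag_coeff]
    refine finsum_congr fun a => ?_
    rw [act_coeff]
    rfl
  have hr : (act (diag f) (diag A)).coeff c = ∑ᶠ t, F (e t) := by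
    rw [finsum_curry₃ (fun t => F (e t)) ?_, act_coeff]
    · refine finsum_congr fun s => ?_
      rw [diag_coeff, diag_coeff, finsum_smul' (finite_support_diag f s)]
      refine finsum_congr fun x => ?_
      rw [smul_finsum' _ (finite_support_diag A (c - s))]
      refine finsum_congr fun u => ?_
      simp only [F, e, Equiv.coe_fn_mk]
      congr 2
      ext <;> simp
      ring
    · exact hF.preimage e.injective.injOn
  rw [hl, hr, finsum_comp_equiv]

omit [Module ℂ W] in
theorem diag_add (A B : HahnSeries (ℤ × ℤ) W) : diag (A + B) = diag A + diag B := by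
  ext c
  exact finsum_add_distrib (finite_support_diag A c) (finite_support_diag B c)

theorem diag_smul (r : ℂ) (A : HahnSeries (ℤ × ℤ) W) : diag (r • A) = r • diag A := by
  ext c
  exact (smul_finsum' r (finite_support_diag A c)).symm

/-- The diagonal restriction as a linear map. -/
def diagL : HahnSeries (ℤ × ℤ) W →ₗ[ℂ] HahnSeries ℤ W where
  toFun := diag
  map_add' := diag_add
  map_smul' := diag_smul

end TwoVar

/-! ### Convolution of one-variable series along a bilinear map -/

section Bil

variable {A B C D E W : Type*} [AddCommGroup A] [Module ℂ A] [AddCommGroup B] [Module ℂ B]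
variable [AddCommGroup C] [Module ℂ C] [AddCommGroup D] [Module ℂ D] [AddCommGroup E] [Module ℂ E]
variable [AddCommGroup W] [Module ℂ W]

/-- The product of series in one variable induced by a bilinear map of the coefficients. -/
def bil (β : A →ₗ[ℂ] B →ₗ[ℂ] C) :
    HahnSeries ℤ A →ₗ[ℂ] HahnSeries ℤ B →ₗ[ℂ] HahnSeries ℤ C :=
  tensorSeries.compr₂ (mapL (TensorProduct.lift β))

theorem finite_support_bil (β : A →ₗ[ℂ] B →ₗ[ℂ] C) (X : HahnSeries ℤ A) (Y : HahnSeries ℤ B)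
    (c : ℤ) : (Function.support fun a : ℤ => β (X.coeff a) (Y.coeff (c - a))).Finite := by
  refine (finite_support_tmul X Y c).subset fun a ha h => ha ?_
  change β (X.coeff a) (Y.coeff (c - a)) = 0
  rw [← TensorProduct.lift.tmul]
  exact (congrArg (TensorProduct.lift β) h).trans (map_zero _)

theorem bil_coeff (β : A →ₗ[ℂ] B →ₗ[ℂ] C) (X : HahnSeries ℤ A) (Y : HahnSeries ℤ B) (c : ℤ) :
    (bil β X Y).coeff c = ∑ᶠ a : ℤ, β (X.coeff a) (Y.coeff (c - a)) := by
  change TensorProduct.lift β ((tensorSeriesFun X Y).coeff c) = _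
  rw [tensorSeriesFun_coeff, map_finsum _ (finite_support_tmul X Y c)]
  rfl

theorem bil_lsmul (f : HahnSeries ℤ ℂ) (X : HahnSeries ℤ A) :
    bil (LinearMap.lsmul ℂ A) f X = act f X := by
  ext c
  rw [bil_coeff, act_coeff]
  rfl

theorem mapL_bil (l : C →ₗ[ℂ] D) (β : A →ₗ[ℂ] B →ₗ[ℂ] C) (X : HahnSeries ℤ A)
    (Y : HahnSeries ℤ B) : mapL l (bil β X Y) = bil (β.compr₂ l) X Y := by
  ext c
  rw [mapL_coeff, bil_coeff, bil_coeff, map_finsum _ (finite_support_bil β X Y c)]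
  rfl

theorem bil_mapL_left (l : D →ₗ[ℂ] A) (β : A →ₗ[ℂ] B →ₗ[ℂ] C) (X : HahnSeries ℤ D)
    (Y : HahnSeries ℤ B) : bil β (mapL l X) Y = bil (β ∘ₗ l) X Y := by
  ext c
  rw [bil_coeff, bil_coeff]
  rfl

theorem bil_mapL_right (l : D →ₗ[ℂ] B) (β : A →ₗ[ℂ] B →ₗ[ℂ] C) (X : HahnSeries ℤ A)
    (Y : HahnSeries ℤ D) : bil β X (mapL l Y) = bil (β.compl₂ l) X Y := by
  ext c
  rw [bil_coeff, bil_coeff]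
  rfl

theorem bil_flip (β : A →ₗ[ℂ] B →ₗ[ℂ] C) (X : HahnSeries ℤ A) (Y : HahnSeries ℤ B) :
    bil β.flip Y X = bil β X Y := by
  ext c
  rw [bil_coeff, bil_coeff, ← finsum_comp_equiv (Equiv.subLeft c)]
  refine finsum_congr fun a => ?_
  rw [Equiv.subLeft_apply, sub_sub_cancel]
  rfl

theorem bil_single_left (β : A →ₗ[ℂ] B →ₗ[ℂ] C) (n : ℤ) (a : A) (Y : HahnSeries ℤ B) (c : ℤ) :
    (bil β (HahnSeries.single n a) Y).coeff c = β a (Y.coeff (c - n)) := by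
  rw [bil_coeff, finsum_eq_single _ n]
  · rw [HahnSeries.coeff_single_same]
  · intro m hm
    rw [HahnSeries.coeff_single_of_ne hm, map_zero, LinearMap.zero_apply]

theorem bil_single_right (β : A →ₗ[ℂ] B →ₗ[ℂ] C) (n : ℤ) (X : HahnSeries ℤ A) (b : B) (c : ℤ) :
    (bil β X (HahnSeries.single n b)).coeff c = β (X.coeff (c - n)) b := by
  rw [← bil_flip, bil_single_left]
  rfl

theorem finite_support_triple (F : A →ₗ[ℂ] B →ₗ[ℂ] C →ₗ[ℂ] D) (X : HahnSeries ℤ A)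
    (Y : HahnSeries ℤ B) (Z : HahnSeries ℤ C) (c : ℤ) :
    (Function.support fun t : ℤ × ℤ =>
      F (X.coeff t.1) (Y.coeff t.2) (Z.coeff (c - t.1 - t.2))).Finite := by
  refine ((Set.finite_Icc X.order (c - Y.order - Z.order)).prod
    (Set.finite_Icc Y.order (c - X.order - Z.order))).subset ?_
  rintro ⟨a, b⟩ h
  rw [Function.mem_support] at h
  have h1 : X.order ≤ a := by
    by_contra h0
    exact h (by simp [HahnSeries.coeff_eq_zero_of_lt_order (not_le.mp h0)])
  have h2 : Y.order ≤ b := by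
    by_contra h0
    exact h (by simp [HahnSeries.coeff_eq_zero_of_lt_order (not_le.mp h0)])
  have h3 : Z.order ≤ c - a - b := by
    by_contra h0
    exact h (by simp [HahnSeries.coeff_eq_zero_of_lt_order (not_le.mp h0)])
  simp only [Set.mem_prod, Set.mem_Icc]
  omega

theorem bil_bil_right_coeff (β₁ : A →ₗ[ℂ] E →ₗ[ℂ] D) (β₂ : B →ₗ[ℂ] C →ₗ[ℂ] E)
    (X : HahnSeries ℤ A) (Y : HahnSeries ℤ B) (Z : HahnSeries ℤ C) (c : ℤ) :
    (bil β₁ X (bil β₂ Y Z)).coeff c = ∑ᶠ t : ℤ × ℤ,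
      β₁ (X.coeff t.1) (β₂ (Y.coeff t.2) (Z.coeff (c - t.1 - t.2))) := by
  let F : A →ₗ[ℂ] B →ₗ[ℂ] C →ₗ[ℂ] D := (LinearMap.llcomp ℂ C E D ∘ₗ β₁).compl₂ β₂
  have hF : (Function.support fun t : ℤ × ℤ =>
      β₁ (X.coeff t.1) (β₂ (Y.coeff t.2) (Z.coeff (c - t.1 - t.2)))).Finite :=
    finite_support_triple F X Y Z c
  rw [finsum_curry _ hF, bil_coeff]
  refine finsum_congr fun a => ?_
  rw [bil_coeff, map_finsum _ (finite_support_bil β₂ Y Z (c - a))]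

theorem bil_assoc {A' : Type*} [AddCommGroup A'] [Module ℂ A'] (β₁ : A →ₗ[ℂ] E →ₗ[ℂ] D)
    (β₂ : B →ₗ[ℂ] C →ₗ[ℂ] E) (β₃ : A' →ₗ[ℂ] C →ₗ[ℂ] D) (β₄ : A →ₗ[ℂ] B →ₗ[ℂ] A')
    (h : ∀ a b c, β₁ a (β₂ b c) = β₃ (β₄ a b) c)
    (X : HahnSeries ℤ A) (Y : HahnSeries ℤ B) (Z : HahnSeries ℤ C) :
    bil β₁ X (bil β₂ Y Z) = bil β₃ (bil β₄ X Y) Z := by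
  rw [← bil_flip β₃, ← bil_flip β₄]
  ext n
  rw [bil_bil_right_coeff, bil_bil_right_coeff]
  let e : ℤ × ℤ ≃ ℤ × ℤ :=
    { toFun := fun t => (n - t.1 - t.2, t.2)
      invFun := fun t => (n - t.1 - t.2, t.2)
      left_inv := fun t => by ext <;> simp; ring
      right_inv := fun t => by ext <;> simp; ring }
  rw [← finsum_comp_equiv e]
  refine finsum_congr fun t => ?_
  simp only [e, Equiv.coe_fn_mk, LinearMap.flip_apply, h]
  congr 4
  · ring

theorem bil_left_comm {E' : Type*} [AddCommGroup E'] [Module ℂ E'] (β₁ : A →ₗ[ℂ] E →ₗ[ℂ] D)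
    (β₂ : B →ₗ[ℂ] C →ₗ[ℂ] E) (β₃ : B →ₗ[ℂ] E' →ₗ[ℂ] D) (β₄ : A →ₗ[ℂ] C →ₗ[ℂ] E')
    (h : ∀ a b c, β₁ a (β₂ b c) = β₃ b (β₄ a c))
    (X : HahnSeries ℤ A) (Y : HahnSeries ℤ B) (Z : HahnSeries ℤ C) :
    bil β₁ X (bil β₂ Y Z) = bil β₃ Y (bil β₄ X Z) := by
  ext n
  rw [bil_bil_right_coeff, bil_bil_right_coeff, ← finsum_comp_equiv (Equiv.prodComm ℤ ℤ)]
  refine finsum_congr fun t => ?_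
  simp only [Equiv.prodComm_apply, Prod.fst_swap, Prod.snd_swap, h]
  rw [sub_right_comm]

end Bil

/-! ### Iterated series W((y))((z)) -/

section Iterate

variable {W : Type*} [AddCommGroup W] [Module ℂ W]

/-- `HahnSeries.ofIterate` as a linear map. -/
def ofIterateL : HahnSeries ℤ (HahnSeries ℤ W) →ₗ[ℂ] HahnSeries (ℤ ×ₗ ℤ) W where
  toFun := HahnSeries.ofIterate
  map_add' _ _ := rfl
  map_smul' _ _ := rfl

theorem ofIterateL_injective :
    Function.Injective (ofIterateL : HahnSeries ℤ (HahnSeries ℤ W) → HahnSeries (ℤ ×ₗ ℤ) W) :=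
  HahnSeries.iterateEquiv.injective

/-- `HahnSeries.toIterate` as a linear map. -/
def toIterateL : HahnSeries (ℤ ×ₗ ℤ) W →ₗ[ℂ] HahnSeries ℤ (HahnSeries ℤ W) where
  toFun := HahnSeries.toIterate
  map_add' _ _ := rfl
  map_smul' _ _ := rfl

@[simp] theorem toIterateL_ofIterateL (X : HahnSeries ℤ (HahnSeries ℤ W)) :
    toIterateL (ofIterateL X) = X := rfl

/-- A coefficient of a series as a linear map. -/
def coeffL (m : ℤ) : HahnSeries ℤ W →ₗ[ℂ] W where
  toFun A := A.coeff m
  map_add' _ _ := rfl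
  map_smul' _ _ := rfl

/-- Fubini for the finite convolution sums: a product in the lexicographic variables is a
convolution in the outer variable whose terms are products in the inner one. -/
theorem act_ofIterateL (f : Iter) (X : HahnSeries ℤ (HahnSeries ℤ W)) :
    act f (ofIterateL X) = ofIterateL (bil act (toIterateL f) X) := by
  ext c
  obtain ⟨⟨n, m⟩, rfl⟩ := toLex.surjective c
  change _ = ((bil act (toIterateL f) X).coeff n).coeff m
  have h := finite_support_act f (ofIterateL X) (toLex (n, m))
  rw [bil_coeff, act_coeff]
  change _ = coeffL m _
  rw [map_finsum _ (finite_support_bil act (toIterateL f) X n)]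
  rw [← finsum_comp_equiv (toLex : ℤ × ℤ ≃ ℤ ×ₗ ℤ), finsum_curry]
  · refine finsum_congr fun i => ?_
    change _ = (act _ _).coeff m
    rw [act_coeff]
    rfl
  · exact h.preimage (toLex : ℤ × ℤ ≃ ℤ ×ₗ ℤ).injective.injOn

theorem constInX_eq (s : HahnSeries ℤ ℂ) :
    constInX s = ofIterateL (mapL (LinearMap.toSpanSingleton ℂ (HahnSeries ℤ ℂ) 1) s) := by
  ext ⟨n, m⟩
  change (HahnSeries.C (s.coeff n)).coeff m = (s.coeff n • (1 : HahnSeries ℤ ℂ)).coeff m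
  rw [HahnSeries.coeff_smul, HahnSeries.C_apply, HahnSeries.coeff_single, HahnSeries.coeff_one]
  split_ifs <;> simp

theorem constInX_add (s t : HahnSeries ℤ ℂ) : constInX (s + t) = constInX s + constInX t := by
  rw [constInX_eq, constInX_eq, constInX_eq, map_add, map_add]

theorem constInX_smul (c : ℂ) (s : HahnSeries ℤ ℂ) : constInX (c • s) = c • constInX s := by
  rw [constInX_eq, constInX_eq, map_smul, map_smul]

/-- The inclusion of `ℂ((z))` into `ℂ((x))((z))` as a linear map. -/
def constInXL : HahnSeries ℤ ℂ →ₗ[ℂ] Iter where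
  toFun := constInX
  map_add' := constInX_add
  map_smul' := constInX_smul

theorem act_constInX (s : HahnSeries ℤ ℂ) (X : HahnSeries ℤ (HahnSeries ℤ W)) :
    act (constInX s) (ofIterateL X) = ofIterateL (act s X) := by
  have h : act ∘ₗ LinearMap.toSpanSingleton ℂ (HahnSeries ℤ ℂ) 1 =
      LinearMap.lsmul ℂ (HahnSeries ℤ W) := by
    refine LinearMap.ext fun c => LinearMap.ext fun A => ?_
    rw [LinearMap.comp_apply, LinearMap.toSpanSingleton_apply, map_smul, LinearMap.smul_apply,
      act_one]
    rfl
  rw [constInX_eq, act_ofIterateL, toIterateL_ofIterateL, bil_mapL_left, h, bil_lsmul]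

theorem iota12_inX2 (s : HahnSeries ℤ ℂ) : iota12 (inX2 s) = constInX s := by
  rw [constInX_eq]
  ext ⟨n, m⟩
  change (if m = 0 then s.coeff n else 0) = (s.coeff n • (1 : HahnSeries ℤ ℂ)).coeff m
  rw [HahnSeries.coeff_smul, HahnSeries.coeff_one]
  split_ifs <;> simp

theorem iota12_inX1 (A : HahnSeries ℤ W) :
    iota12 (inX1 A) = ofIterateL (HahnSeries.single 0 A) := by
  ext ⟨n, m⟩
  change (if n = 0 then A.coeff m else 0) = ((HahnSeries.single 0 A).coeff n).coeff m
  rw [HahnSeries.coeff_single]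
  split_ifs <;> rfl

/-- Hides the construction behind a coefficient formula, so that later arguments never unfold it. -/
theorem ofCoeffs_eq (c : ℕ → HahnSeries ℤ W) : ∃ X : HahnSeries ℤ (HahnSeries ℤ W),
    ofCoeffs c = ofIterateL X ∧ ∀ n : ℤ, X.coeff n = if 0 ≤ n then c n.toNat else 0 :=
  ⟨_, rfl, fun _ => rfl⟩

theorem act_ofCoeffs (c : ℕ → HahnSeries ℤ ℂ) (d : ℕ → HahnSeries ℤ W) :
    act (ofCoeffs c) (ofCoeffs d) = ofCoeffs fun n =>
      ∑ ij ∈ Finset.HasAntidiagonal.antidiagonal n, act (c ij.1) (d ij.2) := by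
  obtain ⟨X, hX, hXc⟩ := ofCoeffs_eq c
  obtain ⟨Y, hY, hYc⟩ := ofCoeffs_eq d
  obtain ⟨Z, hZ, hZc⟩ := ofCoeffs_eq fun n =>
      ∑ ij ∈ Finset.HasAntidiagonal.antidiagonal n, act (c ij.1) (d ij.2)
  rw [hX, hY, hZ, act_ofIterateL, toIterateL_ofIterateL]
  congr 1
  ext n : 2
  rw [bil_coeff, hZc]
  split_ifs with hn
  · lift n to ℕ using hn
    rw [Int.toNat_natCast, finsum_eq_sum_of_support_subset (s :=
      (Finset.HasAntidiagonal.antidiagonal n).image fun ij => (ij.1 : ℤ)), Finset.sum_image]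
    · refine Finset.sum_congr rfl fun ij hij => ?_
      have h : ij.1 + ij.2 = n := Finset.HasAntidiagonal.mem_antidiagonal.mp hij
      rw [hXc, hYc, if_pos (by omega), if_pos (by omega), Int.toNat_natCast]
      congr 2
      omega
    · intro x hx y hy hxy
      rw [Finset.mem_coe, Finset.HasAntidiagonal.mem_antidiagonal] at hx hy
      ext
      · simpa using hxy
      · have : (x.1 : ℤ) = y.1 := hxy
        omega
    · intro a ha
      rw [Function.mem_support, hXc, hYc] at ha
      rw [Finset.mem_coe, Finset.mem_image]
      have h1 : 0 ≤ a := by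
        by_contra h
        exact ha (by rw [if_neg h, map_zero, LinearMap.zero_apply])
      have h2 : 0 ≤ n - a := by
        by_contra h
        exact ha (by rw [if_neg h, map_zero])
      refine ⟨(a.toNat, (n - a).toNat), ?_, by simp [h1]⟩
      rw [Finset.HasAntidiagonal.mem_antidiagonal]
      simp only []
      omega
  · refine (finsum_congr fun a => ?_).trans finsum_zero
    rw [hXc, hYc]
    by_cases h : 0 ≤ a
    · rw [if_neg (show ¬ 0 ≤ n - a by omega), map_zero]
    · rw [if_neg h, map_zero, LinearMap.zero_apply]

end Iterate

/-! ### The substitution x₁ = φ(x, z), x₂ = x is multiplicative and injective -/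

section Subst

variable {W : Type*} [AddCommGroup W] [Module ℂ W]

theorem subst_eq (p : HahnSeries ℤ ℂ) (A : HahnSeries (ℤ × ℤ) W) :
    subst p A = ofCoeffs fun n => (n.factorial : ℂ)⁻¹ • diagL ((D1L p ^ n) A) := by
  refine congrArg ofCoeffs (funext fun n => ?_)
  rw [Module.End.pow_apply]
  rfl

/-- The substitution `x₁ = φ(x, z)`, `x₂ = x` as a linear map. -/
def substL (p : HahnSeries ℤ ℂ) : HahnSeries (ℤ × ℤ) W →ₗ[ℂ] HahnSeries (ℤ ×ₗ ℤ) W where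
  toFun := subst p
  map_add' A B := by
    ext g
    rw [subst_eq, subst_eq, subst_eq, HahnSeries.coeff_add, ofCoeffs_coeff, ofCoeffs_coeff,
      ofCoeffs_coeff]
    split_ifs
    · rw [map_add, map_add, smul_add, HahnSeries.coeff_add]
    · rw [add_zero]
  map_smul' c A := by
    ext g
    rw [subst_eq, subst_eq, RingHom.id_apply, HahnSeries.coeff_smul, ofCoeffs_coeff,
      ofCoeffs_coeff]
    split_ifs
    · rw [map_smul, map_smul, smul_comm, HahnSeries.coeff_smul]
    · rw [smul_zero]

theorem substL_apply (p : HahnSeries ℤ ℂ) (A : HahnSeries (ℤ × ℤ) W) :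
    substL p A = subst p A := rfl

/-- The exponential of a derivation is multiplicative, and so is the diagonal restriction. The
factorials turn the binomial Leibniz formula into the Cauchy product in z. -/
theorem subst_act (p : HahnSeries ℤ ℂ) (f : Two) (A : HahnSeries (ℤ × ℤ) W) :
    subst p (act f A) = act (subst p f) (subst p A) := by
  rw [subst_eq, subst_eq, subst_eq, act_ofCoeffs]
  refine congrArg ofCoeffs (funext fun n => ?_)
  rw [D1_iterate_act, map_sum, Finset.smul_sum]
  refine Finset.sum_congr rfl fun ij hij => ?_
  have h : ij.1 + ij.2 = n := Finset.HasAntidiagonal.mem_antidiagonal.mp hij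
  rw [map_smul, map_smul, LinearMap.map_smul₂, smul_smul, smul_smul]
  congr 1
  · subst h
    have := Nat.add_choose_mul_factorial_mul_factorial ij.1 ij.2
    have h1 : ((ij.1.factorial : ℕ) : ℂ) ≠ 0 := Nat.cast_ne_zero.mpr (Nat.factorial_ne_zero _)
    have h2 : ((ij.2.factorial : ℕ) : ℂ) ≠ 0 := Nat.cast_ne_zero.mpr (Nat.factorial_ne_zero _)
    have h3 : (((ij.1 + ij.2).factorial : ℕ) : ℂ) ≠ 0 :=
      Nat.cast_ne_zero.mpr (Nat.factorial_ne_zero _)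
    rw [← this] at h3 ⊢
    rw [Nat.choose_symm_add]
    push_cast at h3 ⊢
    field_simp
    exact div_self (left_ne_zero_of_mul (left_ne_zero_of_mul h3))
  · exact diag_act _ _

theorem subst_mul (p : HahnSeries ℤ ℂ) (f g : Two) : subst p (f * g) = subst p f * subst p g :=
  subst_act p f g

theorem pderiv1_single (w : W) : pderiv1 (HahnSeries.single ((0 : ℤ), (0 : ℤ)) w) = 0 := by
  ext ⟨a, b⟩
  rw [pderiv1_coeff, HahnSeries.coeff_single]
  split_ifs with h
  · have : a = -1 := by have := congrArg Prod.fst h; simp at this; omega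
    subst this
    simp
  · simp

omit [Module ℂ W] in
theorem diag_single (w : W) :
    diag (HahnSeries.single ((0 : ℤ), (0 : ℤ)) w) = HahnSeries.single 0 w := by
  ext c
  rw [diag_coeff, finsum_eq_single _ 0]
  · by_cases h : c = 0
    · subst h
      simp
    · rw [HahnSeries.coeff_single_of_ne h, HahnSeries.coeff_single_of_ne]
      intro h2
      exact h (by simpa using congrArg Prod.snd h2)
  · intro a ha
    rw [HahnSeries.coeff_single_of_ne]
    intro h2
    exact ha (congrArg Prod.fst h2)

theorem subst_single (p : HahnSeries ℤ ℂ) (w : W) :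
    subst p (HahnSeries.single ((0 : ℤ), (0 : ℤ)) w) =
      HahnSeries.single (toLex ((0 : ℤ), (0 : ℤ))) w := by
  have h : ∀ n : ℕ, (D1L p ^ (n + 1)) (HahnSeries.single ((0 : ℤ), (0 : ℤ)) w) = 0 := by
    intro n
    rw [pow_succ, Module.End.mul_apply, D1L_apply, D1, pderiv1_single, map_zero, map_zero]
  ext g
  obtain ⟨⟨n, m⟩, rfl⟩ := toLex.surjective g
  rw [subst_eq, ofCoeffs_coeff]
  change (if 0 ≤ n then _ else (0 : W)) = _
  split_ifs with hn
  · lift n to ℕ using hn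
    change ((n.factorial : ℂ)⁻¹ • diagL ((D1L p ^ n) _)).coeff m = _
    cases n with
    | zero =>
      rw [pow_zero, Module.End.one_apply]
      change (((0 : ℕ).factorial : ℂ)⁻¹ • diag _).coeff m = _
      rw [diag_single, Nat.factorial_zero, Nat.cast_one, inv_one, one_smul]
      by_cases h0 : m = 0
      · subst h0
        rw [HahnSeries.coeff_single_same]
        exact (HahnSeries.coeff_single_same _ _).symm
      · rw [HahnSeries.coeff_single_of_ne h0, HahnSeries.coeff_single_of_ne]
        intro h2
        exact h0 (congrArg Prod.snd (congrArg ofLex h2))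
    | succ n =>
      rw [h, map_zero, smul_zero, HahnSeries.coeff_zero, HahnSeries.coeff_single_of_ne]
      intro h2
      have : ((n + 1 : ℕ) : ℤ) = 0 := congrArg Prod.fst (congrArg ofLex h2)
      omega
  · rw [HahnSeries.coeff_single_of_ne]
    intro h2
    have : n = 0 := congrArg Prod.fst (congrArg ofLex h2)
    omega

theorem subst_one (p : HahnSeries ℤ ℂ) : subst p (1 : Two) = 1 := subst_single p 1

/-- The substitution `x₁ = φ(x, z)`, `x₂ = x` as a ring homomorphism. -/
def substHom (p : HahnSeries ℤ ℂ) : Two →+* Iter where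
  toFun := subst p
  map_one' := subst_one p
  map_mul' := subst_mul p
  map_zero' := (substL p).map_zero
  map_add' := (substL p).map_add

/-- The coefficient of zⁿ for the derivative is n + 1 times the coefficient of zⁿ⁺¹ for f, so the
kernel of the substitution is stable under the derivation. -/
theorem subst_D1_eq_zero {p : HahnSeries ℤ ℂ} {f : Two} (h : subst p f = 0) :
    subst p (D1 p f) = 0 := by
  rw [subst_eq] at h ⊢
  ext g
  obtain ⟨⟨n, m⟩, rfl⟩ := toLex.surjective g
  rw [ofCoeffs_coeff]
  change (if 0 ≤ n then _ else (0 : ℂ)) = 0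
  split_ifs with hn
  · lift n to ℕ using hn
    change ((n.factorial : ℂ)⁻¹ • diagL ((D1L p ^ n) (D1L p f))).coeff m = 0
    have h2 := congrArg (fun F : Iter => F.coeff (toLex (((n + 1 : ℕ) : ℤ), m))) h
    simp only [ofCoeffs_coeff] at h2
    change (if 0 ≤ ((n + 1 : ℕ) : ℤ) then _ else (0 : ℂ)) = 0 at h2
    rw [if_pos (by omega)] at h2
    change (((n + 1).factorial : ℂ)⁻¹ • diagL ((D1L p ^ (n + 1)) f)).coeff m = 0 at h2
    rw [HahnSeries.coeff_smul, pow_succ, Module.End.mul_apply] at h2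
    rw [HahnSeries.coeff_smul, (smul_eq_zero.mp h2).resolve_left (inv_ne_zero
      (Nat.cast_ne_zero.mpr (Nat.factorial_ne_zero _))), smul_zero]
  · rfl

theorem diag_eq_zero_of_subst {p : HahnSeries ℤ ℂ} {f : Two} (h : subst p f = 0) :
    diag f = 0 := by
  ext m
  rw [subst_eq] at h
  have h2 := congrArg (fun F : Iter => F.coeff (toLex ((0 : ℤ), m))) h
  simp only [ofCoeffs_coeff] at h2
  change (((0 : ℕ).factorial : ℂ)⁻¹ • diag f).coeff m = 0 at h2
  simpa using h2

theorem exists_euler {p : HahnSeries ℤ ℂ} (hp : p ≠ 0) {f : Two} (h : subst p f = 0) (s : ℤ) :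
    ∃ g : Two, subst p g = 0 ∧ ∀ a b, g.coeff (a, b) = ((a : ℂ) - s) * f.coeff (a, b) := by
  -- Since p is invertible in ℂ((x)), the factor x₁ p(x₁)⁻¹ turns p(x₁)∂₁ into the Euler operator
  -- x₁∂₁, which is diagonal on monomials. The witness is (x₁∂₁ - s)f.
  refine ⟨inX1 (HahnSeries.single 1 1 * p⁻¹) * D1 p f - (s : ℂ) • f, ?_, fun a b => ?_⟩
  · have : subst p (inX1 (HahnSeries.single 1 1 * p⁻¹) * D1 p f - (s : ℂ) • f) =
      substHom p (inX1 (HahnSeries.single 1 1 * p⁻¹)) * subst p (D1 p f) -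
        (s : ℂ) • subst p f := by
      rw [← substL_apply, map_sub, map_smul, substL_apply, subst_mul]
      rfl
    rw [this, subst_D1_eq_zero h, h, mul_zero, smul_zero, sub_zero]
  · have h1 : inX1 (HahnSeries.single 1 1 * p⁻¹) * D1 p f =
        act (inX1 (HahnSeries.single 1 1)) (pderiv1 f) := by
      rw [D1, ← act_eq_mul, ← act_mul, ← inX1_mul, mul_assoc, inv_mul_cancel₀ hp, mul_one]
    rw [h1, HahnSeries.coeff_sub, act_inX1_coeff, finsum_eq_single _ 1, pderiv1_coeff]
    · simp
      ring
    · intro c hc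
      rw [HahnSeries.coeff_single_of_ne hc, zero_smul]

theorem exists_euler_prod {p : HahnSeries ℤ ℂ} (hp : p ≠ 0) {f : Two} (h : subst p f = 0)
    (S : Finset ℤ) : ∃ g : Two, subst p g = 0 ∧
      ∀ a b, g.coeff (a, b) = (∏ s ∈ S, ((a : ℂ) - s)) * f.coeff (a, b) := by
  classical
  induction S using Finset.induction_on with
  | empty => exact ⟨f, h, fun a b => by simp⟩
  | insert s S hs ih =>
    obtain ⟨g, hg, hgc⟩ := ih
    obtain ⟨k, hk, hkc⟩ := exists_euler hp hg s
    exact ⟨k, hk, fun a b => by rw [hkc, hgc, Finset.prod_insert hs, mul_assoc]⟩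

/-- The kernel is stable under the operators x₁∂₁ - s. Only finitely many monomials of a given total
degree occur, so a product of such operators isolates any one of them. The diagonal of the result
vanishes and equals a nonzero multiple of that coefficient. -/
theorem subst_injective {p : HahnSeries ℤ ℂ} (hp : p ≠ 0) :
    Function.Injective (substHom p) := by
  classical
  rw [injective_iff_map_eq_zero]
  intro f hf
  ext ⟨a, b⟩
  by_contra hab
  have hfin := finite_support_diag f (a + b)
  obtain ⟨g, hg, hgc⟩ := exists_euler_prod hp hf (hfin.toFinset.erase a)
  have h := congrArg (fun F : HahnSeries ℤ ℂ => F.coeff (a + b)) (diag_eq_zero_of_subst hg)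
  simp only [diag_coeff, HahnSeries.coeff_zero] at h
  rw [finsum_eq_single _ a] at h
  · rw [add_sub_cancel_left, hgc] at h
    refine (mul_ne_zero (Finset.prod_ne_zero_iff.mpr fun s hs => ?_) hab) h
    rw [sub_ne_zero]
    exact fun h2 => (Finset.mem_erase.mp hs).1 (by exact_mod_cast h2.symm)
  · intro c hc
    rw [hgc]
    by_cases hcs : f.coeff (c, a + b - c) = 0
    · rw [hcs, mul_zero]
    · rw [Finset.prod_eq_zero (i := c), zero_mul]
      · exact Finset.mem_erase.mpr ⟨hc, hfin.mem_toFinset.mpr hcs⟩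
      · exact sub_self _

theorem subst_ne_zero {p : HahnSeries ℤ ℂ} (hp : p ≠ 0) {f : Two} (hf : f ≠ 0) :
    subst p f ≠ 0 :=
  (map_ne_zero_iff (substHom p) (subst_injective hp)).mpr hf

end Subst

/-! ### Fields with values in W ⊗ ℂ((x)) and their products -/

section Extend

variable {V H W : Type*} [AddCommGroup V] [Module ℂ V] [AddCommGroup H] [Module ℂ H]
variable [AddCommGroup W] [Module ℂ W]

theorem extendField_tmul (a : W →ₗ[ℂ] HahnSeries ℤ W) (w : W) (f : HahnSeries ℤ ℂ) :
    extendField a (w ⊗ₜ f) = act f (a w) := rfl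

/-- The inclusion of `W` into `W((x))`. -/
def constL : W →ₗ[ℂ] HahnSeries ℤ W where
  toFun := HahnSeries.single 0
  map_add' _ _ := HahnSeries.single_add _ _ _
  map_smul' c w := by
    ext n
    by_cases h : n = 0 <;> simp [h]

theorem constL_apply (w : W) : constL w = HahnSeries.single 0 w := rfl

theorem toSeries_eq : (toSeries : W ⊗[ℂ] HahnSeries ℤ ℂ →ₗ[ℂ] HahnSeries ℤ W) =
    extendField constL := by
  refine TensorProduct.ext' fun w f => ?_
  rw [extendField_tmul]
  ext n
  rw [← bil_lsmul, constL_apply, bil_single_right, sub_zero]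
  rfl

theorem toSeries_tmul (w : W) (f : HahnSeries ℤ ℂ) :
    toSeries (w ⊗ₜ f) = act f (HahnSeries.single 0 w) := by
  rw [toSeries_eq, extendField_tmul, constL_apply]

theorem toSeries_tmul_coeff (w : W) (f : HahnSeries ℤ ℂ) (n : ℤ) :
    (toSeries (w ⊗ₜ f)).coeff n = f.coeff n • w := rfl

/-- In a basis of W, an element of W ⊗ ℂ((x)) is a finite family of scalar series, and these
coordinates can be read off from its image in W((x)). -/
theorem toSeries_injective :
    Function.Injective (toSeries : W ⊗[ℂ] HahnSeries ℤ ℂ →ₗ[ℂ] HahnSeries ℤ W) := by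
  classical
  rw [injective_iff_map_eq_zero]
  intro t ht
  let b := Module.Basis.ofVectorSpace ℂ W
  have h : ∀ (t : W ⊗[ℂ] HahnSeries ℤ ℂ) i,
      TensorProduct.equivFinsuppOfBasisLeft b t i = mapL (b.coord i) (toSeries t) := by
    intro t i
    induction t with
    | zero => simp
    | add x y hx hy => rw [map_add, Finsupp.add_apply, hx, hy, map_add, map_add]
    | tmul w f =>
      rw [TensorProduct.equivFinsuppOfBasisLeft_apply_tmul_apply]
      ext n
      rw [mapL_coeff, toSeries_tmul_coeff, map_smul, HahnSeries.coeff_smul, smul_eq_mul,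
        smul_eq_mul, mul_comm]
      rfl
  apply (TensorProduct.equivFinsuppOfBasisLeft b).injective
  ext i : 1
  rw [h, ht, map_zero, map_zero, Finsupp.zero_apply]

/-- Multiplication by scalar series on `W ⊗ ℂ((x))`. -/
def mulR : HahnSeries ℤ ℂ →ₗ[ℂ] W ⊗[ℂ] HahnSeries ℤ ℂ →ₗ[ℂ] W ⊗[ℂ] HahnSeries ℤ ℂ :=
  LinearMap.lTensorHom W ∘ₗ act

theorem mulR_tmul (g f : HahnSeries ℤ ℂ) (w : W) : mulR g (w ⊗ₜ[ℂ] f) = w ⊗ₜ (g * f) := rfl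

theorem extendField_mulR (a : W →ₗ[ℂ] HahnSeries ℤ W) (g : HahnSeries ℤ ℂ)
    (t : W ⊗[ℂ] HahnSeries ℤ ℂ) : extendField a (mulR g t) = act g (extendField a t) := by
  induction t with
  | zero => simp
  | add x y hx hy => rw [map_add, map_add, hx, hy, map_add, map_add]
  | tmul w f => rw [mulR_tmul, extendField_tmul, extendField_tmul, act_mul]

/-- Multiplication by an iterated series on `(W ⊗ ℂ((x)))((z))`. -/
def rowAct : Iter →ₗ[ℂ] HahnSeries ℤ (W ⊗[ℂ] HahnSeries ℤ ℂ) →ₗ[ℂ]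
    HahnSeries ℤ (W ⊗[ℂ] HahnSeries ℤ ℂ) :=
  bil mulR ∘ₗ toIterateL

/-- The map `(W ⊗ ℂ((x)))((z)) → W((x))((z))` induced by a field `a(x)`. -/
def extendIter (a : W →ₗ[ℂ] HahnSeries ℤ W) :
    HahnSeries ℤ (W ⊗[ℂ] HahnSeries ℤ ℂ) →ₗ[ℂ] HahnSeries (ℤ ×ₗ ℤ) W :=
  ofIterateL ∘ₗ mapL (extendField a)

theorem extendIter_apply (a : W →ₗ[ℂ] HahnSeries ℤ W)
    (X : HahnSeries ℤ (W ⊗[ℂ] HahnSeries ℤ ℂ)) :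
    extendIter a X = ofIterateL (mapL (extendField a) X) := rfl

theorem extendIter_rowAct (a : W →ₗ[ℂ] HahnSeries ℤ W) (F : Iter)
    (X : HahnSeries ℤ (W ⊗[ℂ] HahnSeries ℤ ℂ)) :
    extendIter a (rowAct F X) = act F (extendIter a X) := by
  rw [extendIter_apply, extendIter_apply, act_ofIterateL, bil_mapL_right]
  change ofIterateL (mapL _ (bil mulR _ _)) = _
  rw [mapL_bil]
  congr 4
  exact LinearMap.ext fun g => LinearMap.ext fun t => extendField_mulR a g t

/-- Lets identities in (W ⊗ ℂ((x)))((z)) be checked in W((x))((z)). In the finer space another field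
in x can still be applied from the left. -/
theorem extendIter_const_injective :
    Function.Injective (extendIter (constL : W →ₗ[ℂ] HahnSeries ℤ W)) := by
  intro X Y h
  have h2 := ofIterateL_injective h
  ext n : 2
  apply toSeries_injective
  rw [toSeries_eq]
  exact congrArg (fun Z : HahnSeries ℤ (HahnSeries ℤ W) => Z.coeff n) h2

/-- `w ↦ w ⊗ 1`. -/
def tmulOne : W →ₗ[ℂ] W ⊗[ℂ] HahnSeries ℤ ℂ := (TensorProduct.mk ℂ W (HahnSeries ℤ ℂ)).flip 1

theorem extendField_tmulOne (a : W →ₗ[ℂ] HahnSeries ℤ W) (w : W) :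
    extendField a (tmulOne w) = a w := by
  change act (1 : HahnSeries ℤ ℂ) (a w) = a w
  rw [act_one]

theorem extendIter_mapL_tmulOne (a : W →ₗ[ℂ] HahnSeries ℤ W) (A : HahnSeries ℤ W) :
    extendIter a (mapL tmulOne A) = ofIterateL (mapL a A) := by
  rw [extendIter_apply]
  congr 1
  ext n : 2
  exact extendField_tmulOne a (A.coeff n)

theorem ofIterateL_mapL_constL (A : HahnSeries ℤ W) :
    ofIterateL (mapL constL A) = iota12 (inX2 A) := by
  ext ⟨n, m⟩
  change (HahnSeries.single 0 (A.coeff n)).coeff m = if m = 0 then A.coeff n else 0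
  rw [HahnSeries.coeff_single]
  split_ifs <;> rfl

/-- `extendField (Y v)` as a bilinear map. -/
def extendL (Y : V →ₗ[ℂ] W →ₗ[ℂ] HahnSeries ℤ W) :
    V →ₗ[ℂ] W ⊗[ℂ] HahnSeries ℤ ℂ →ₗ[ℂ] HahnSeries ℤ W :=
  LinearMap.mk₂ ℂ (fun v t => extendField (Y v) t)
    (fun u v t => by
      have : extendField (Y (u + v)) = extendField (Y u) + extendField (Y v) :=
        TensorProduct.ext' fun w f => by simp [extendField]
      rw [this, LinearMap.add_apply])
    (fun c v t => by
      have : extendField (Y (c • v)) = c • extendField (Y v) :=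
        TensorProduct.ext' fun w f => by simp [extendField]
      rw [this, LinearMap.smul_apply])
    (fun v s t => map_add _ _ _)
    (fun c v t => map_smul _ _ _)

theorem extendL_apply (Y : V →ₗ[ℂ] W →ₗ[ℂ] HahnSeries ℤ W) (v : V)
    (t : W ⊗[ℂ] HahnSeries ℤ ℂ) : extendL Y v t = extendField (Y v) t := rfl

/-- For `A(z) ∈ V((z))` and `X(z) ∈ (W ⊗ ℂ((x)))((z))`, the series `Y(A(z), x) X(z)`. -/
def pairP (Y : V →ₗ[ℂ] W →ₗ[ℂ] HahnSeries ℤ W) :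
    HahnSeries ℤ V →ₗ[ℂ] HahnSeries ℤ (W ⊗[ℂ] HahnSeries ℤ ℂ) →ₗ[ℂ] HahnSeries (ℤ ×ₗ ℤ) W :=
  (bil (extendL Y)).compr₂ ofIterateL

theorem pairP_apply (Y : V →ₗ[ℂ] W →ₗ[ℂ] HahnSeries ℤ W) (A : HahnSeries ℤ V)
    (X : HahnSeries ℤ (W ⊗[ℂ] HahnSeries ℤ ℂ)) :
    pairP Y A X = ofIterateL (bil (extendL Y) A X) := rfl

theorem pairP_rowAct (Y : V →ₗ[ℂ] W →ₗ[ℂ] HahnSeries ℤ W) (A : HahnSeries ℤ V) (F : Iter)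
    (X : HahnSeries ℤ (W ⊗[ℂ] HahnSeries ℤ ℂ)) :
    pairP Y A (rowAct F X) = act F (pairP Y A X) := by
  rw [pairP_apply, pairP_apply, act_ofIterateL]
  congr 1
  exact bil_left_comm _ _ _ _ (fun v g t => extendField_mulR (Y v) g t) _ _ _

theorem pairP_act (Y : V →ₗ[ℂ] W →ₗ[ℂ] HahnSeries ℤ W) (s : HahnSeries ℤ ℂ)
    (A : HahnSeries ℤ V) (X : HahnSeries ℤ (W ⊗[ℂ] HahnSeries ℤ ℂ)) :
    pairP Y (act s A) X = act (constInX s) (pairP Y A X) := by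
  rw [pairP_apply, pairP_apply, act_constInX, ← bil_lsmul, ← bil_lsmul]
  congr 1
  refine (bil_assoc _ _ _ _ (fun c v t => ?_) _ _ _).symm
  rw [LinearMap.lsmul_apply, LinearMap.lsmul_apply, map_smul, LinearMap.smul_apply]

theorem pairP_single (Y : V →ₗ[ℂ] W →ₗ[ℂ] HahnSeries ℤ W) (A : HahnSeries ℤ V) (w : W) :
    pairP Y A (HahnSeries.single 0 (tmulOne w)) = ofIterateL (mapL (Y.flip w) A) := by
  rw [pairP_apply]
  congr 1
  ext n : 2
  rw [bil_single_right, sub_zero, extendL_apply, extendField_tmulOne]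
  rfl

theorem prodField_eq (a b : W →ₗ[ℂ] HahnSeries ℤ W) (w : W) :
    prodField a b w = ofIterateL (mapL a (b w)) := rfl

theorem iterField_eq (Y : V →ₗ[ℂ] V →ₗ[ℂ] HahnSeries ℤ V) (YW : V →ₗ[ℂ] W →ₗ[ℂ] HahnSeries ℤ W)
    (u v : V) (w : W) : iterField Y YW u v w = ofIterateL (mapL (YW.flip w) (Y u v)) := rfl

theorem sharp_tmul (YWV : V →ₗ[ℂ] W →ₗ[ℂ] HahnSeries ℤ W)
    (YWH : H →ₗ[ℂ] W →ₗ[ℂ] W ⊗[ℂ] HahnSeries ℤ ℂ) (v : V) (h : H) (w : W) :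
    sharp YWV YWH (v ⊗ₜ h) w = extendField (YWV v) (YWH h w) := rfl

theorem bil_mk : bil (TensorProduct.mk ℂ V H) = tensorSeries := by
  refine LinearMap.ext fun A => LinearMap.ext fun B => ?_
  ext c
  rw [bil_coeff]
  rfl

theorem tensorSeries_act_left (s : HahnSeries ℤ ℂ) (A : HahnSeries ℤ V) (B : HahnSeries ℤ H) :
    tensorSeries (act s A) B = act s (tensorSeries A B) := by
  rw [← bil_mk, ← bil_lsmul, ← bil_lsmul]
  exact (bil_assoc _ _ _ _ (fun c v t => rfl) _ _ _).symm

/-- Recognises Y^V(A(z), x) Y^H(B(z), x)w as the sharp map evaluated at A(z) ⊗ B(z). This is how the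
iterate appears at the end of the main computation. -/
theorem pairP_mapL (YWV : V →ₗ[ℂ] W →ₗ[ℂ] HahnSeries ℤ W)
    (YWH : H →ₗ[ℂ] W →ₗ[ℂ] W ⊗[ℂ] HahnSeries ℤ ℂ) (A : HahnSeries ℤ V) (B : HahnSeries ℤ H)
    (w : W) : pairP YWV A (mapL (YWH.flip w) B) =
      ofIterateL (mapL ((sharp YWV YWH).flip w) (tensorSeries A B)) := by
  rw [pairP_apply, bil_mapL_right]
  change ofIterateL (mapL _ (tensorSeries A B)) = _
  congr 3
  exact TensorProduct.ext' fun v h => rfl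

end Extend

/-! ### The relation between expansion and substitution -/

section Rel

variable {V H W : Type*} [AddCommGroup V] [Module ℂ V] [AddCommGroup H] [Module ℂ H]
variable [AddCommGroup W] [Module ℂ W]

/-- `L` and `R` are the expansion in `W((x₁))((x₂))` and the restriction to `x₁ = φ(x, z)`,
`x₂ = x` of the same element of `W((x₁, x₂))`. -/
def SubstRel (p : HahnSeries ℤ ℂ) (L R : HahnSeries (ℤ ×ₗ ℤ) W) : Prop :=
  ∃ B : HahnSeries (ℤ × ℤ) W, iota12 B = L ∧ subst p B = R

variable {p : HahnSeries ℤ ℂ} {L L' R R' : HahnSeries (ℤ ×ₗ ℤ) W}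

theorem SubstRel.zero : SubstRel p (0 : HahnSeries (ℤ ×ₗ ℤ) W) 0 :=
  ⟨0, map_zero _, (substL p).map_zero⟩

theorem SubstRel.add (h : SubstRel p L R) (h' : SubstRel p L' R') :
    SubstRel p (L + L') (R + R') := by
  obtain ⟨B, rfl, rfl⟩ := h
  obtain ⟨B', rfl, rfl⟩ := h'
  exact ⟨B + B', map_add _ _ _, (substL p).map_add _ _⟩

theorem SubstRel.sum {ι : Type*} (s : Finset ι) {L R : ι → HahnSeries (ℤ ×ₗ ℤ) W}
    (h : ∀ i ∈ s, SubstRel p (L i) (R i)) : SubstRel p (∑ i ∈ s, L i) (∑ i ∈ s, R i) := by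
  classical
  induction s using Finset.induction_on with
  | empty => exact SubstRel.zero
  | insert i s hi ih =>
    rw [Finset.sum_insert hi, Finset.sum_insert hi]
    exact (h i (Finset.mem_insert_self _ _)).add
      (ih fun j hj => h j (Finset.mem_insert_of_mem hj))

theorem SubstRel.act (f : Two) (h : SubstRel p L R) :
    SubstRel p (act (iota12 f) L) (VertexDeformation.act (subst p f) R) := by
  obtain ⟨B, rfl, rfl⟩ := h
  exact ⟨VertexDeformation.act f B, iota12_act _ _, subst_act _ _ _⟩

theorem SubstRel.act_mul (f g : Two)
    (h : SubstRel p (VertexDeformation.act (iota12 g) L)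
      (VertexDeformation.act (subst p g) R)) :
    SubstRel p (VertexDeformation.act (iota12 (f * g)) L)
      (VertexDeformation.act (subst p (f * g)) R) := by
  have h2 := h.act f
  rwa [← VertexDeformation.act_mul, ← VertexDeformation.act_mul, ← iota12_mul, ← subst_mul] at h2

theorem SubstRel.unique (h : SubstRel p L R) (h' : SubstRel p L R') : R = R' := by
  obtain ⟨B, rfl, rfl⟩ := h
  obtain ⟨B', h1, rfl⟩ := h'
  rw [iota12_injective h1]

/-- The expansion is injective, so the left side determines the right side; f stays nonzero under
substitution and acts injectively there. Used when L turns out to need no denominator. -/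
theorem SubstRel.cancel (hp : p ≠ 0) {f : Two} (hf : f ≠ 0)
    (h : SubstRel p (VertexDeformation.act (iota12 f) L) (VertexDeformation.act (subst p f) R))
    (h' : SubstRel p L R') : R = R' :=
  act_injective (subst_ne_zero hp hf) (h.unique (h'.act f))

theorem SubstRel.single (p : HahnSeries ℤ ℂ) (w : W) :
    SubstRel p (ofIterateL (HahnSeries.single 0 (HahnSeries.single 0 w)))
      (ofIterateL (HahnSeries.single 0 (HahnSeries.single 0 w))) := by
  have h : iota12 (inX1 (HahnSeries.single 0 w)) =
      ofIterateL (HahnSeries.single 0 (HahnSeries.single 0 w)) := iota12_inX1 _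
  have h1 : inX1 (HahnSeries.single 0 w) = HahnSeries.single ((0 : ℤ), (0 : ℤ)) w := by
    ext ⟨a, b⟩
    rw [inX1_coeff, HahnSeries.coeff_single, HahnSeries.coeff_single]
    by_cases ha : a = 0 <;> by_cases hb : b = 0 <;> simp [ha, hb]
  have h2 : HahnSeries.single (toLex ((0 : ℤ), (0 : ℤ))) w =
      ofIterateL (HahnSeries.single 0 (HahnSeries.single 0 w)) := by
    rw [← h, h1]
    ext g
    obtain ⟨⟨n, m⟩, rfl⟩ := toLex.surjective g
    rw [iota12_coeff]
    by_cases hg : n = 0 ∧ m = 0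
    · obtain ⟨rfl, rfl⟩ := hg
      rw [HahnSeries.coeff_single_same, HahnSeries.coeff_single_same]
    · rw [HahnSeries.coeff_single_of_ne, HahnSeries.coeff_single_of_ne]
      · intro h0
        exact hg ⟨congrArg Prod.snd h0, congrArg Prod.fst h0⟩
      · intro h0
        exact hg ⟨congrArg Prod.fst (congrArg ofLex h0), congrArg Prod.snd (congrArg ofLex h0)⟩
  refine ⟨HahnSeries.single ((0 : ℤ), (0 : ℤ)) w, ?_, ?_⟩
  · rw [← h1, h]
  · rw [subst_single, h2]

end Rel

/-! ### Pairings of V ⊗ ℂ((x₁, x₂)) with W ⊗ ℂ((x₁)) -/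

section Pairing

variable {V H W M N Q A B : Type*} [AddCommGroup V] [Module ℂ V] [AddCommGroup H] [Module ℂ H]
variable [AddCommGroup W] [Module ℂ W] [AddCommGroup M] [Module ℂ M] [AddCommGroup N] [Module ℂ N]
variable [AddCommGroup Q] [Module ℂ Q] [AddCommGroup A] [Module ℂ A] [AddCommGroup B] [Module ℂ B]

/-- The bilinear map `(v ⊗ a, w ⊗ b) ↦ μ(K(v, w), κ(a, b))`. -/
def pairMap (K : V →ₗ[ℂ] W →ₗ[ℂ] M) (κ : A →ₗ[ℂ] B →ₗ[ℂ] N) (μ : M →ₗ[ℂ] N →ₗ[ℂ] Q) :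
    V ⊗[ℂ] A →ₗ[ℂ] W ⊗[ℂ] B →ₗ[ℂ] Q :=
  (TensorProduct.map₂ K κ).compr₂ (TensorProduct.lift μ)

theorem tensor_bilin_ext {f g : V ⊗[ℂ] A →ₗ[ℂ] W ⊗[ℂ] B →ₗ[ℂ] Q}
    (h : ∀ v a w b, f (v ⊗ₜ a) (w ⊗ₜ b) = g (v ⊗ₜ a) (w ⊗ₜ b)) : f = g :=
  TensorProduct.ext' fun v a => TensorProduct.ext' fun w b => h v a w b

/-- `(t(x₁, x₂), g(x)) ↦ t(x₁, x₂) g(x₁)`. -/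
def mulX1 : Two →ₗ[ℂ] HahnSeries ℤ ℂ →ₗ[ℂ] Two :=
  (act (Γ := ℤ × ℤ) (W := ℂ)).compl₂ inX1

/-- The map sending `v ⊗ t`, `w ⊗ g` to `t(x₁, x₂) g(x₁) Y_W(v, x₂)w ∈ W((x₁, x₂))`. -/
def pairTwo (YWV : V →ₗ[ℂ] W →ₗ[ℂ] HahnSeries ℤ W) :
    V ⊗[ℂ] Two →ₗ[ℂ] W ⊗[ℂ] HahnSeries ℤ ℂ →ₗ[ℂ] HahnSeries (ℤ × ℤ) W :=
  pairMap (YWV.compr₂ inX2) mulX1 act.flip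

/-- The element of `(W ⊗ ℂ((x₁)))((x₂))` underlying `pairTwo`. -/
def pairRow (YWV : V →ₗ[ℂ] W →ₗ[ℂ] HahnSeries ℤ W) :
    V ⊗[ℂ] Two →ₗ[ℂ] W ⊗[ℂ] HahnSeries ℤ ℂ →ₗ[ℂ] HahnSeries ℤ (W ⊗[ℂ] HahnSeries ℤ ℂ) :=
  pairMap (YWV.compr₂ (mapL tmulOne)) (mulX1.compr₂ iota12) rowAct.flip

/-- The map sending `v ⊗ t`, `w ⊗ g` to `t(x₁, x₂) g(x₁) a(x₁) Y_W(v, x₂)w`. -/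
def pairProd (YWV : V →ₗ[ℂ] W →ₗ[ℂ] HahnSeries ℤ W) (a : W →ₗ[ℂ] HahnSeries ℤ W) :
    V ⊗[ℂ] Two →ₗ[ℂ] W ⊗[ℂ] HahnSeries ℤ ℂ →ₗ[ℂ] HahnSeries (ℤ ×ₗ ℤ) W :=
  pairMap (YWV.compr₂ (ofIterateL ∘ₗ mapL a)) (mulX1.compr₂ iota12) act.flip

/-- The map sending `v ⊗ t`, `w ⊗ g` to `t(φ(x, z), x) g(φ(x, z)) Y_W(Y(u, z)v, x)w`. -/
def pairIter (p : HahnSeries ℤ ℂ) (YV : V →ₗ[ℂ] V →ₗ[ℂ] HahnSeries ℤ V)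
    (YWV : V →ₗ[ℂ] W →ₗ[ℂ] HahnSeries ℤ W) (u : V) :
    V ⊗[ℂ] Two →ₗ[ℂ] W ⊗[ℂ] HahnSeries ℤ ℂ →ₗ[ℂ] HahnSeries (ℤ ×ₗ ℤ) W :=
  pairMap ((pairP YWV ∘ₗ YV u).compl₂ (constL ∘ₗ tmulOne)) (mulX1.compr₂ (substL p)) act.flip

theorem pairTwo_tmul (YWV : V →ₗ[ℂ] W →ₗ[ℂ] HahnSeries ℤ W) (v : V) (t : Two) (w : W)
    (g : HahnSeries ℤ ℂ) :
    pairTwo YWV (v ⊗ₜ t) (w ⊗ₜ g) = act (t * inX1 g) (inX2 (YWV v w)) := rfl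

theorem pairRow_tmul (YWV : V →ₗ[ℂ] W →ₗ[ℂ] HahnSeries ℤ W) (v : V) (t : Two) (w : W)
    (g : HahnSeries ℤ ℂ) :
    pairRow YWV (v ⊗ₜ t) (w ⊗ₜ g) = rowAct (iota12 (t * inX1 g)) (mapL tmulOne (YWV v w)) := rfl

theorem pairProd_tmul (YWV : V →ₗ[ℂ] W →ₗ[ℂ] HahnSeries ℤ W) (a : W →ₗ[ℂ] HahnSeries ℤ W)
    (v : V) (t : Two) (w : W) (g : HahnSeries ℤ ℂ) :
    pairProd YWV a (v ⊗ₜ t) (w ⊗ₜ g) = act (iota12 (t * inX1 g)) (prodField a (YWV v) w) := rfl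

theorem pairIter_tmul (p : HahnSeries ℤ ℂ) (YV : V →ₗ[ℂ] V →ₗ[ℂ] HahnSeries ℤ V)
    (YWV : V →ₗ[ℂ] W →ₗ[ℂ] HahnSeries ℤ W) (u : V) (v : V) (t : Two) (w : W)
    (g : HahnSeries ℤ ℂ) :
    pairIter p YV YWV u (v ⊗ₜ t) (w ⊗ₜ g) =
      act (subst p (t * inX1 g)) (pairP YWV (YV u v) (HahnSeries.single 0 (tmulOne w))) := rfl

theorem extendIter_pairRow (YWV : V →ₗ[ℂ] W →ₗ[ℂ] HahnSeries ℤ W) (a : W →ₗ[ℂ] HahnSeries ℤ W)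
    (T : V ⊗[ℂ] Two) (y : W ⊗[ℂ] HahnSeries ℤ ℂ) :
    extendIter a (pairRow YWV T y) = pairProd YWV a T y := by
  have h : (pairRow YWV).compr₂ (extendIter a) = pairProd YWV a := by
    refine tensor_bilin_ext fun v t w g => ?_
    rw [LinearMap.compr₂_apply, pairRow_tmul, pairProd_tmul, extendIter_rowAct,
      extendIter_mapL_tmulOne]
    rfl
  rw [← h, LinearMap.compr₂_apply]

theorem pairProd_constL (YWV : V →ₗ[ℂ] W →ₗ[ℂ] HahnSeries ℤ W)
    (T : V ⊗[ℂ] Two) (y : W ⊗[ℂ] HahnSeries ℤ ℂ) :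
    pairProd YWV constL T y = iota12 (pairTwo YWV T y) := by
  have h : (pairTwo YWV).compr₂ iota12 = pairProd YWV constL := by
    refine tensor_bilin_ext fun v t w g => ?_
    rw [LinearMap.compr₂_apply, pairTwo_tmul, pairProd_tmul, iota12_act, prodField_eq,
      ofIterateL_mapL_constL]
  rw [← h, LinearMap.compr₂_apply]

theorem prodField_sharp_tmul (YWV : V →ₗ[ℂ] W →ₗ[ℂ] HahnSeries ℤ W)
    (YWH : H →ₗ[ℂ] W →ₗ[ℂ] W ⊗[ℂ] HahnSeries ℤ ℂ) (u : V) (h : H) (b : W →ₗ[ℂ] HahnSeries ℤ W)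
    (w : W) : prodField (sharp YWV YWH (u ⊗ₜ h)) b w =
      extendIter (YWV u) (mapL (YWH h) (b w)) := rfl

/-- An identity for `Y_W^H(h, x₁) b(x₂)w` can be multiplied by `Y_W^V(u, x₁)` from the left. -/
theorem prodField_sharp_of_toField {ι : Type*} (s : Finset ι)
    (YWV : V →ₗ[ℂ] W →ₗ[ℂ] HahnSeries ℤ W) (YWH : H →ₗ[ℂ] W →ₗ[ℂ] W ⊗[ℂ] HahnSeries ℤ ℂ) (h : H)
    (b : W →ₗ[ℂ] HahnSeries ℤ W) (w : W) (F : Iter) (T : ι → V ⊗[ℂ] Two)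
    (y : ι → W ⊗[ℂ] HahnSeries ℤ ℂ)
    (hT : act F (prodField (toField YWH h) b w) = iota12 (∑ i ∈ s, pairTwo YWV (T i) (y i)))
    (u : V) : act F (prodField (sharp YWV YWH (u ⊗ₜ h)) b w) =
      ∑ i ∈ s, pairProd YWV (YWV u) (T i) (y i) := by
  -- The hypothesis is an identity in W((x₁))((x₂)). Since Y^H takes values in W ⊗ ℂ((x₁)), it lifts
  -- to (W ⊗ ℂ((x₁)))((x₂)), where applying the field of u at the same variable x₁ makes sense.
  have h1 : rowAct F (mapL (YWH h) (b w)) = ∑ i ∈ s, pairRow YWV (T i) (y i) := by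
    apply extendIter_const_injective
    rw [extendIter_rowAct, map_sum]
    simp only [extendIter_pairRow, pairProd_constL]
    rw [← map_sum, ← hT]
    congr 1
    rw [extendIter_apply, ← toSeries_eq]
    rfl
  rw [prodField_sharp_tmul, ← extendIter_rowAct, h1, map_sum]
  simp only [extendIter_pairRow]

/-- The map `w ⊗ g ↦ g(φ(x, z)) w`. -/
def rowX1 (p : HahnSeries ℤ ℂ) :
    W ⊗[ℂ] HahnSeries ℤ ℂ →ₗ[ℂ] HahnSeries ℤ (W ⊗[ℂ] HahnSeries ℤ ℂ) :=
  TensorProduct.lift ((rowAct.flip ∘ₗ constL ∘ₗ tmulOne).compl₂ (substL p ∘ₗ inX1))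

theorem rowX1_tmul (p : HahnSeries ℤ ℂ) (w : W) (g : HahnSeries ℤ ℂ) :
    rowX1 p (w ⊗ₜ g) = rowAct (subst p (inX1 g)) (HahnSeries.single 0 (tmulOne w)) := rfl

/-- The map `w ⊗ η ↦ η(x) a(φ(x, z)) w`. -/
def rowX2 (p : HahnSeries ℤ ℂ) (a : W →ₗ[ℂ] W ⊗[ℂ] HahnSeries ℤ ℂ) :
    W ⊗[ℂ] HahnSeries ℤ ℂ →ₗ[ℂ] HahnSeries ℤ (W ⊗[ℂ] HahnSeries ℤ ℂ) :=
  TensorProduct.lift ((rowAct.flip ∘ₗ rowX1 p ∘ₗ a).compl₂ (substL p ∘ₗ inX2))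

theorem rowX2_tmul (p : HahnSeries ℤ ℂ) (a : W →ₗ[ℂ] W ⊗[ℂ] HahnSeries ℤ ℂ) (w : W)
    (g : HahnSeries ℤ ℂ) :
    rowX2 p a (w ⊗ₜ g) = rowAct (subst p (inX2 g)) (rowX1 p (a w)) := rfl

theorem pairIter_eq (p : HahnSeries ℤ ℂ) (YV : V →ₗ[ℂ] V →ₗ[ℂ] HahnSeries ℤ V)
    (YWV : V →ₗ[ℂ] W →ₗ[ℂ] HahnSeries ℤ W) (u v : V) (t : Two) (y : W ⊗[ℂ] HahnSeries ℤ ℂ) :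
    pairIter p YV YWV u (v ⊗ₜ t) y = act (subst p t) (pairP YWV (YV u v) (rowX1 p y)) := by
  induction y with
  | zero => simp
  | add x y hx hy => rw [map_add, hx, hy, map_add, map_add, map_add]
  | tmul w g =>
    rw [pairIter_tmul, rowX1_tmul, pairP_rowAct, subst_mul, act_mul]

/-- The map `v ⊗ F ↦ F(x, z) Y_W(Y(u, z)v, x) X`. -/
def pairPsi (YV : V →ₗ[ℂ] V →ₗ[ℂ] HahnSeries ℤ V) (YWV : V →ₗ[ℂ] W →ₗ[ℂ] HahnSeries ℤ W)
    (u : V) (X : HahnSeries ℤ (W ⊗[ℂ] HahnSeries ℤ ℂ)) :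
    V ⊗[ℂ] Iter →ₗ[ℂ] HahnSeries (ℤ ×ₗ ℤ) W :=
  TensorProduct.lift (act.flip ∘ₗ (pairP YWV).flip X ∘ₗ YV u)

theorem pairPsi_tmul (YV : V →ₗ[ℂ] V →ₗ[ℂ] HahnSeries ℤ V)
    (YWV : V →ₗ[ℂ] W →ₗ[ℂ] HahnSeries ℤ W)
    (u v : V) (F : Iter) (X : HahnSeries ℤ (W ⊗[ℂ] HahnSeries ℤ ℂ)) :
    pairPsi YV YWV u X (v ⊗ₜ F) = act F (pairP YWV (YV u v) X) := rfl

theorem pairPsi_act (YV : V →ₗ[ℂ] V →ₗ[ℂ] HahnSeries ℤ V)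
    (YWV : V →ₗ[ℂ] W →ₗ[ℂ] HahnSeries ℤ W) (u : V) (F : Iter)
    (X : HahnSeries ℤ (W ⊗[ℂ] HahnSeries ℤ ℂ)) (t : V ⊗[ℂ] Iter) :
    pairPsi YV YWV u X ((act F).lTensor V t) = act F (pairPsi YV YWV u X t) := by
  induction t with
  | zero => simp
  | add x y hx hy => rw [map_add, map_add, hx, hy, map_add, map_add]
  | tmul v f => rw [LinearMap.lTensor_tmul, pairPsi_tmul, pairPsi_tmul, act_eq_mul, act_mul]

theorem pairPsi_constInX (YV : V →ₗ[ℂ] V →ₗ[ℂ] HahnSeries ℤ V)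
    (YWV : V →ₗ[ℂ] W →ₗ[ℂ] HahnSeries ℤ W) (u : V)
    (X : HahnSeries ℤ (W ⊗[ℂ] HahnSeries ℤ ℂ)) (y : V ⊗[ℂ] HahnSeries ℤ ℂ) :
    pairPsi YV YWV u X (constInXL.lTensor V y) = pairP YWV (extendField (YV u) y) X := by
  induction y with
  | zero => simp
  | add x y hx hy => rw [map_add, map_add, hx, hy, map_add, map_add, LinearMap.add_apply]
  | tmul v f =>
    rw [LinearMap.lTensor_tmul, pairPsi_tmul, extendField_tmul, pairP_act]
    rfl

/-- The map sending `w ⊗ η` to the product of `η(x)` and the value of `pairIter` at `T` and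
`a(x)w`. -/
def pairIter₂ (p : HahnSeries ℤ ℂ) (YV : V →ₗ[ℂ] V →ₗ[ℂ] HahnSeries ℤ V)
    (YWV : V →ₗ[ℂ] W →ₗ[ℂ] HahnSeries ℤ W) (u : V) (T : V ⊗[ℂ] Two)
    (a : W →ₗ[ℂ] W ⊗[ℂ] HahnSeries ℤ ℂ) :
    W ⊗[ℂ] HahnSeries ℤ ℂ →ₗ[ℂ] HahnSeries (ℤ ×ₗ ℤ) W :=
  TensorProduct.lift ((act.flip ∘ₗ pairIter p YV YWV u T ∘ₗ a).compl₂ (substL p ∘ₗ inX2))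

theorem pairIter₂_tmul (p : HahnSeries ℤ ℂ) (YV : V →ₗ[ℂ] V →ₗ[ℂ] HahnSeries ℤ V)
    (YWV : V →ₗ[ℂ] W →ₗ[ℂ] HahnSeries ℤ W) (u : V) (T : V ⊗[ℂ] Two)
    (a : W →ₗ[ℂ] W ⊗[ℂ] HahnSeries ℤ ℂ) (w : W) (g : HahnSeries ℤ ℂ) :
    pairIter₂ p YV YWV u T a (w ⊗ₜ g) =
      act (subst p (inX2 g)) (pairIter p YV YWV u T (a w)) := rfl

/-- Separates the two ingredients: the restricted coefficient functions enter only through `substL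
p`, the H-product only through `rowX2`. Each can then be replaced by its known value. -/
theorem pairIter₂_eq (p : HahnSeries ℤ ℂ) (YV : V →ₗ[ℂ] V →ₗ[ℂ] HahnSeries ℤ V)
    (YWV : V →ₗ[ℂ] W →ₗ[ℂ] HahnSeries ℤ W) (u : V) (T : V ⊗[ℂ] Two)
    (a : W →ₗ[ℂ] W ⊗[ℂ] HahnSeries ℤ ℂ) (y : W ⊗[ℂ] HahnSeries ℤ ℂ) :
    pairIter₂ p YV YWV u T a y = pairPsi YV YWV u (rowX2 p a y) ((substL p).lTensor V T) := by
  induction y with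
  | zero =>
    rw [map_zero, map_zero]
    induction T with
    | zero => simp
    | add x y hx hy => rw [map_add, map_add, ← hx, ← hy, add_zero]
    | tmul v t => rw [LinearMap.lTensor_tmul, pairPsi_tmul, map_zero, map_zero]
  | add x y hx hy =>
    rw [map_add, hx, hy, map_add]
    generalize (substL p).lTensor V T = T'
    induction T' with
    | zero => simp
    | add x y hx hy => rw [map_add, map_add, map_add, ← hx, ← hy]; abel
    | tmul v t => rw [pairPsi_tmul, pairPsi_tmul, pairPsi_tmul, map_add, map_add]
  | tmul w g =>
    rw [pairIter₂_tmul, rowX2_tmul]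
    induction T with
    | zero => simp
    | add x y hx hy =>
      rw [map_add, map_add, LinearMap.add_apply, map_add, map_add, hx, hy]
    | tmul v t =>
      rw [LinearMap.lTensor_tmul, pairPsi_tmul, pairIter_eq, pairP_rowAct, act_comm]
      rfl

/-- The product `Y_W^H(h, x₁) Y_W^H(k, x₂)w` needs no denominators. -/
theorem substRel_prodField_toField (p : HahnSeries ℤ ℂ)
    (YWH : H →ₗ[ℂ] W →ₗ[ℂ] W ⊗[ℂ] HahnSeries ℤ ℂ) (h k : H) (w : W) :
    SubstRel p (prodField (toField YWH h) (toField YWH k) w)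
      (extendIter constL (rowX2 p (YWH h) (YWH k w))) := by
  -- On a simple tensor w ⊗ g the scalar g(x₁) already lies in ℂ((x₁, x₂)), which leaves the
  -- constant series w. The same reduction handles the scalars in x₂ below.
  have h1 : ∀ y : W ⊗[ℂ] HahnSeries ℤ ℂ,
      SubstRel p (iota12 (inX1 (toSeries y))) (extendIter constL (rowX1 p y)) := by
    intro y
    induction y with
    | zero => simpa using SubstRel.zero
    | add x y hx hy => simpa only [map_add] using hx.add hy
    | tmul w g =>
      rw [toSeries_tmul, inX1_act, iota12_act, rowX1_tmul, extendIter_rowAct]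
      refine SubstRel.act _ ?_
      rw [iota12_inX1]
      convert SubstRel.single p w using 1
      rw [extendIter_apply]
      congr 1
      ext n : 2
      rw [mapL_coeff, HahnSeries.coeff_single, HahnSeries.coeff_single]
      split_ifs
      · rw [extendField_tmulOne]
        rfl
      · rw [map_zero]
  have h2 : ∀ y : W ⊗[ℂ] HahnSeries ℤ ℂ,
      SubstRel p (ofIterateL (mapL (toField YWH h) (toSeries y)))
        (extendIter constL (rowX2 p (YWH h) y)) := by
    intro y
    induction y with
    | zero => simpa using SubstRel.zero
    | add x y hx hy => simpa only [map_add] using hx.add hy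
    | tmul w g =>
      rw [toSeries_tmul, mapL_act, ← act_constInX, ← iota12_inX2, rowX2_tmul, extendIter_rowAct]
      refine SubstRel.act _ ?_
      convert h1 (YWH h w) using 1
      rw [iota12_inX1]
      congr 1
      ext n : 2
      rw [mapL_coeff, HahnSeries.coeff_single, HahnSeries.coeff_single]
      split_ifs
      · rfl
      · rw [map_zero]
  exact h2 (YWH k w)

/-- The product of two H-fields has both a denominator-free lift and, by associativity, a lift after
multiplication by f. Cancelling f identifies the two restrictions, and the identity then lifts to W
⊗ ℂ((x)). -/
theorem rowX2_eq_of_assoc {p : HahnSeries ℤ ℂ} (hp : p ≠ 0)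
    (YH : H →ₗ[ℂ] H →ₗ[ℂ] HahnSeries ℤ H)
    (YWH : H →ₗ[ℂ] W →ₗ[ℂ] W ⊗[ℂ] HahnSeries ℤ ℂ) (h k : H) (w : W) {f : Two} (hf : f ≠ 0)
    (hassoc : SubstRel p (act (iota12 f) (prodField (toField YWH h) (toField YWH k) w))
      (act (subst p f) (iterField YH (toField YWH) h k w))) :
    rowX2 p (YWH h) (YWH k w) = mapL (YWH.flip w) (YH h k) := by
  apply extendIter_const_injective
  rw [← hassoc.cancel hp hf (substRel_prodField_toField p YWH h k w), iterField_eq,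
    extendIter_apply, ← toSeries_eq]
  rfl

end Pairing

/-! ### Associativity of the sharp map over the smash product -/

section Main

/-- Comultiplication produces finite sums whose terms have their own denominators; one element of S
must serve them all. -/
theorem exists_common_multiple {M ι : Type*} [CommMonoid M] (S : Submonoid M) (s : Finset ι)
    (P : ι → M → Prop) (hP : ∀ i ∈ s, ∃ q ∈ S, P i q)
    (hmul : ∀ i q r, r ∈ S → P i q → P i (r * q)) : ∃ q ∈ S, ∀ i ∈ s, P i q := by
  classical
  induction s using Finset.induction_on with
  | empty => exact ⟨1, S.one_mem, by simp⟩
  | insert i s hi ih =>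
    obtain ⟨q, hq, hqs⟩ := ih fun j hj => hP j (Finset.mem_insert_of_mem hj)
    obtain ⟨r, hr, hri⟩ := hP i (Finset.mem_insert_self _ _)
    refine ⟨r * q, S.mul_mem hr hq, fun j hj => ?_⟩
    rcases Finset.mem_insert.mp hj with rfl | hj
    · rw [mul_comm]
      exact hmul _ _ _ hq hri
    · exact hmul _ _ _ hr (hqs j hj)

variable {V H W : Type*} [AddCommGroup V] [Module ℂ V] [AddCommGroup H] [Module ℂ H]
variable [AddCommGroup W] [Module ℂ W]

/-- Associativity of V, extended linearly in the coefficient functions. The denominator depends on T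
but not on y, which is needed because y carries the vector w, over which associativity is uniform.
-/
theorem exists_substRel_pairProd {p : HahnSeries ℤ ℂ} {S : Submonoid Two}
    {YV : V →ₗ[ℂ] V →ₗ[ℂ] HahnSeries ℤ V} {YWV : V →ₗ[ℂ] W →ₗ[ℂ] HahnSeries ℤ W} (u : V)
    (hA : ∀ v, ∃ f ∈ S, ∀ w, SubstRel p (act (iota12 f) (prodField (YWV u) (YWV v) w))
      (act (subst p f) (iterField YV YWV u v w))) (T : V ⊗[ℂ] Two) :
    ∃ f ∈ S, ∀ y, SubstRel p (act (iota12 f) (pairProd YWV (YWV u) T y))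
      (act (subst p f) (pairIter p YV YWV u T y)) := by
  induction T with
  | zero => exact ⟨1, S.one_mem, fun y => by simpa using SubstRel.zero⟩
  | add T T' hT hT' =>
    obtain ⟨f, hf, hfT⟩ := hT
    obtain ⟨g, hg, hgT⟩ := hT'
    refine ⟨f * g, S.mul_mem hf hg, fun y => ?_⟩
    simp only [map_add, LinearMap.add_apply]
    refine SubstRel.add ?_ ((hgT y).act_mul f g)
    rw [mul_comm]
    exact (hfT y).act_mul g f
  | tmul v t =>
    obtain ⟨f, hf, hfv⟩ := hA v
    refine ⟨f, hf, fun y => ?_⟩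
    induction y with
    | zero => simpa using SubstRel.zero
    | add x y hx hy => simpa only [map_add] using hx.add hy
    | tmul w g =>
      rw [pairProd_tmul, pairIter_tmul, pairP_single, ← iterField_eq, act_comm,
        act_comm (subst p f)]
      exact (hfv w).act _

/-- The commutation relation between `Y_W^H(h, x₁)` and `Y_W^V(v, x₂)` after multiplication by
`q(x₁, x₂)`, with the coefficient functions restricted to `x₁ = φ(x, z)`, `x₂ = x`. -/
def IsExchange [Coalgebra ℂ H] (p : HahnSeries ℤ ℂ) (YVH : H →ₗ[ℂ] V →ₗ[ℂ] V ⊗[ℂ] HahnSeries ℤ ℂ)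
    (YWH : H →ₗ[ℂ] W →ₗ[ℂ] W ⊗[ℂ] HahnSeries ℤ ℂ) (YWV : V →ₗ[ℂ] W →ₗ[ℂ] HahnSeries ℤ W)
    (h : H) (v : V) (q : Two) : Prop :=
  ∃ (N : ℕ) (l r : Fin N → H) (T : Fin N → V ⊗[ℂ] Two),
    Coalgebra.comul (R := ℂ) h = ∑ i, l i ⊗ₜ[ℂ] r i ∧
    (∀ i, (substL p).lTensor V (T i) =
      (act (subst p q)).lTensor V (constInXL.lTensor V (YVH (l i) v))) ∧
    ∀ w, act (iota12 q) (prodField (toField YWH h) (YWV v) w) =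
      iota12 (∑ i, pairTwo YWV (T i) (YWH (r i) w))

/-- `∑ Y_V(u, z) Y_V^H(h₍₁₎, z)v ⊗ Y_H(h₍₂₎, z)k`, as a bilinear map of `u ⊗ h` and `v ⊗ k`
which takes `(u ⊗ h₍₂₎) ⊗ h₍₁₎` instead of `u ⊗ h`. -/
def tensorSharp (YV : V →ₗ[ℂ] V →ₗ[ℂ] HahnSeries ℤ V) (YH : H →ₗ[ℂ] H →ₗ[ℂ] HahnSeries ℤ H)
    (YVH : H →ₗ[ℂ] V →ₗ[ℂ] V ⊗[ℂ] HahnSeries ℤ ℂ) :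
    (V ⊗[ℂ] H) ⊗[ℂ] H →ₗ[ℂ] V ⊗[ℂ] H →ₗ[ℂ] HahnSeries ℤ (V ⊗[ℂ] H) :=
  sharp (tensorY YV YH)
    ((LinearMap.rTensorHom H ∘ₗ YVH).compr₂
      (TensorProduct.rightComm ℂ V (HahnSeries ℤ ℂ) H).toLinearMap)

theorem tensorSharp_tmul (YV : V →ₗ[ℂ] V →ₗ[ℂ] HahnSeries ℤ V)
    (YH : H →ₗ[ℂ] H →ₗ[ℂ] HahnSeries ℤ H) (YVH : H →ₗ[ℂ] V →ₗ[ℂ] V ⊗[ℂ] HahnSeries ℤ ℂ)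
    (x : V ⊗[ℂ] H) (l : H) (y : V ⊗[ℂ] H) :
    tensorSharp YV YH YVH (x ⊗ₜ l) y = extendField (tensorY YV YH x)
      (TensorProduct.rightComm ℂ V (HahnSeries ℤ ℂ) H ((YVH l).rTensor H y)) := rfl

theorem tensorY_tmul (YV : V →ₗ[ℂ] V →ₗ[ℂ] HahnSeries ℤ V)
    (YH : H →ₗ[ℂ] H →ₗ[ℂ] HahnSeries ℤ H) (u : V) (h : H) (v : V) (k : H) :
    tensorY YV YH (u ⊗ₜ h) (v ⊗ₜ k) = tensorSeries (YV u v) (YH h k) := rfl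

theorem tensorSharp_tmul_tmul (YV : V →ₗ[ℂ] V →ₗ[ℂ] HahnSeries ℤ V)
    (YH : H →ₗ[ℂ] H →ₗ[ℂ] HahnSeries ℤ H) (YVH : H →ₗ[ℂ] V →ₗ[ℂ] V ⊗[ℂ] HahnSeries ℤ ℂ)
    (u : V) (r l : H) (v : V) (k : H) :
    tensorSharp YV YH YVH ((u ⊗ₜ r) ⊗ₜ l) (v ⊗ₜ k) =
      tensorSeries (extendField (YV u) (YVH l v)) (YH r k) := by
  rw [tensorSharp_tmul, LinearMap.rTensor_tmul]
  generalize YVH l v = y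
  induction y with
  | zero => simp
  | add x y hx hy => simp only [TensorProduct.add_tmul, map_add, LinearMap.add_apply, hx, hy]
  | tmul a s =>
    rw [TensorProduct.rightComm_tmul, extendField_tmul, extendField_tmul, tensorY_tmul,
      tensorSeries_act_left]

/-- The product `(u ⊗ h, v ⊗ k) ↦ ∑ Y_V(u, z) Y_V^H(h₍₁₎, z)v ⊗ Y_H(h₍₂₎, z)k`. -/
def smashY [Coalgebra ℂ H] (YV : V →ₗ[ℂ] V →ₗ[ℂ] HahnSeries ℤ V)
    (YH : H →ₗ[ℂ] H →ₗ[ℂ] HahnSeries ℤ H) (YVH : H →ₗ[ℂ] V →ₗ[ℂ] V ⊗[ℂ] HahnSeries ℤ ℂ) :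
    V ⊗[ℂ] H →ₗ[ℂ] V ⊗[ℂ] H →ₗ[ℂ] HahnSeries ℤ (V ⊗[ℂ] H) :=
  tensorSharp YV YH YVH ∘ₗ (TensorProduct.assoc ℂ V H H).symm.toLinearMap ∘ₗ
    (Coalgebra.comul (R := ℂ) (A := H)).lTensor V

theorem smashY_tmul [Coalgebra ℂ H] [Coalgebra.IsCocomm ℂ H]
    (YV : V →ₗ[ℂ] V →ₗ[ℂ] HahnSeries ℤ V)
    (YH : H →ₗ[ℂ] H →ₗ[ℂ] HahnSeries ℤ H) (YVH : H →ₗ[ℂ] V →ₗ[ℂ] V ⊗[ℂ] HahnSeries ℤ ℂ)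
    {ι : Type*} (s : Finset ι) (l r : ι → H) (u : V) (h : H) (v : V) (k : H)
    (hc : Coalgebra.comul (R := ℂ) h = ∑ i ∈ s, l i ⊗ₜ[ℂ] r i) :
    smashY YV YH YVH (u ⊗ₜ h) (v ⊗ₜ k) =
      ∑ i ∈ s, tensorSeries (extendField (YV u) (YVH (l i) v)) (YH (r i) k) := by
  -- Cocommutativity enters here. Coassociativity of the coaction leaves the second leg of the
  -- coproduct acting on V, whereas the exchange relation uses the first.
  have hc2 : Coalgebra.comul (R := ℂ) h = ∑ i ∈ s, r i ⊗ₜ[ℂ] l i := by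
    rw [← Coalgebra.comm_comul ℂ h, hc, map_sum]
    simp only [TensorProduct.comm_tmul]
  rw [smashY, LinearMap.comp_apply, LinearMap.comp_apply, LinearMap.lTensor_tmul, hc2,
    TensorProduct.tmul_sum, map_sum, map_sum, LinearMap.sum_apply]
  refine Finset.sum_congr rfl fun i _ => ?_
  rw [LinearEquiv.coe_coe, TensorProduct.assoc_symm_tmul, tensorSharp_tmul_tmul]

/-- The coaction is multiplicative (`h1`) and passes through the H-action, which touches only the
V-leg (`h2`). Coassociativity then rewrites the doubly coacted u by means of the coproduct of H. -/
theorem mapL_deform [Coalgebra ℂ H] {YV : V →ₗ[ℂ] V →ₗ[ℂ] HahnSeries ℤ V} {vacV : V}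
    {YH : H →ₗ[ℂ] H →ₗ[ℂ] HahnSeries ℤ H} {vacH : H}
    {YVH : H →ₗ[ℂ] V →ₗ[ℂ] V ⊗[ℂ] HahnSeries ℤ ℂ} {ρ : V →ₗ[ℂ] V ⊗[ℂ] H}
    (hρ : IsComoduleAlgebra YH vacH YV vacV ρ) (hρVH : IsCompatible YVH ρ) (u v : V) :
    mapL ρ (deform YV YVH ρ u v) = smashY YV YH YVH (ρ u) (ρ v) := by
  have h1 : ∀ (u : V) (y : V ⊗[ℂ] HahnSeries ℤ ℂ), mapL ρ (extendField (YV u) y) =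
      extendField (tensorY YV YH (ρ u)) (ρ.rTensor (HahnSeries ℤ ℂ) y) := by
    intro u y
    induction y with
    | zero => simp
    | add x y hx hy => rw [map_add, map_add, hx, hy, map_add, map_add]
    | tmul a s =>
      rw [extendField_tmul, mapL_act, LinearMap.rTensor_tmul, extendField_tmul, ← hρ.map_Y]
      rfl
  have h2 : ∀ ξ : V ⊗[ℂ] H, mapL ρ (sharp YV YVH ξ v) =
      tensorSharp YV YH YVH (ρ.rTensor H ξ) (ρ v) := by
    intro ξ
    induction ξ with
    | zero => simp
    | add x y hx hy => simp only [map_add, LinearMap.add_apply, hx, hy]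
    | tmul a h =>
      rw [sharp_tmul, h1, LinearMap.rTensor_tmul, tensorSharp_tmul, hρVH]
  rw [smashY, LinearMap.comp_apply, LinearMap.comp_apply, ← hρ.coassoc]
  rw [LinearEquiv.coe_coe, LinearEquiv.symm_apply_apply, ← h2]
  rfl

variable [Coalgebra ℂ H] [Coalgebra.IsCocomm ℂ H] {p : HahnSeries ℤ ℂ} {S : Submonoid Two}
variable {YV : V →ₗ[ℂ] V →ₗ[ℂ] HahnSeries ℤ V} {YH : H →ₗ[ℂ] H →ₗ[ℂ] HahnSeries ℤ H}
variable {YVH : H →ₗ[ℂ] V →ₗ[ℂ] V ⊗[ℂ] HahnSeries ℤ ℂ}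
variable {YWH : H →ₗ[ℂ] W →ₗ[ℂ] W ⊗[ℂ] HahnSeries ℤ ℂ} {YWV : V →ₗ[ℂ] W →ₗ[ℂ] HahnSeries ℤ W}

/-- The central computation: exchange the inner two of the four factors at the cost of q, merge the
V-factors at the cost of f, merge the H-factors for free. -/
theorem exists_substRel_sharp_tmul (hp : p ≠ 0)
    (hA : ∀ u v, ∃ f ∈ S, ∀ w, SubstRel p (act (iota12 f) (prodField (YWV u) (YWV v) w))
      (act (subst p f) (iterField YV YWV u v w)))
    (hB : ∀ h k, ∃ f : Two, f ≠ 0 ∧ ∀ w,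
      SubstRel p (act (iota12 f) (prodField (toField YWH h) (toField YWH k) w))
      (act (subst p f) (iterField YH (toField YWH) h k w)))
    (hC : ∀ h v, ∃ q ∈ S, IsExchange p YVH YWH YWV h v q) (u : V) (h : H) (v : V) (k : H) :
    ∃ f ∈ S, ∀ w, SubstRel p
      (act (iota12 f) (prodField (sharp YWV YWH (u ⊗ₜ h)) (sharp YWV YWH (v ⊗ₜ k)) w))
      (act (subst p f) (ofIterateL (mapL ((sharp YWV YWH).flip w)
        (smashY YV YH YVH (u ⊗ₜ h) (v ⊗ₜ k))))) := by
  obtain ⟨q, hq, N, l, r, T, hcom, hT, hex⟩ := hC h v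
  obtain ⟨f, hf, hfT⟩ := exists_common_multiple S Finset.univ
    (fun i f => ∀ y, SubstRel p (act (iota12 f) (pairProd YWV (YWV u) (T i) y))
      (act (subst p f) (pairIter p YV YWV u (T i) y)))
    (fun i _ => exists_substRel_pairProd u (hA u) (T i))
    (fun i q r _ hq y => (hq y).act_mul r q)
  refine ⟨f * q, S.mul_mem hf hq, fun w => ?_⟩
  -- An arbitrary y stands for Y^H(k, x₂)w. On w ⊗ g the scalar g(x₂) can be pulled out of both
  -- sides, so only the three remaining fields have to be treated.
  have h1 : ∀ y : W ⊗[ℂ] HahnSeries ℤ ℂ, SubstRel p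
      (act (iota12 (f * q)) (ofIterateL (mapL (sharp YWV YWH (u ⊗ₜ h)) (extendField (YWV v) y))))
      (act (subst p f) (∑ i, pairIter₂ p YV YWV u (T i) (YWH (r i)) y)) := by
    intro y
    induction y with
    | zero => simpa using SubstRel.zero
    | add x y hx hy => simpa only [map_add, Finset.sum_add_distrib] using hx.add hy
    | tmul w g =>
      rw [extendField_tmul, mapL_act, ← act_constInX, ← iota12_inX2, act_comm]
      simp only [pairIter₂_tmul]
      rw [← map_sum, act_comm (subst p f)]
      refine SubstRel.act _ ?_
      rw [← prodField_eq, iota12_mul, act_mul, prodField_sharp_of_toField _ YWV YWH h (YWV v) w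
        (iota12 q) T (fun i => YWH (r i) w) (hex w) u, map_sum, map_sum]
      exact SubstRel.sum _ fun i hi => hfT i hi _
  have h2 := h1 (YWH k w)
  convert h2 using 1
  · rfl
  rw [subst_mul, act_mul, smashY_tmul YV YH YVH Finset.univ l r u h v k hcom, map_sum, map_sum,
    map_sum]
  congr 1
  refine Finset.sum_congr rfl fun i _ => ?_
  obtain ⟨g, hg, hgB⟩ := hB (r i) k
  -- `hT` trades the restricted coefficients for q times Y_V^H(h₍₁₎, z)v, which is absorbed into
  -- Y(u, z). The H-part becomes Y^H(Y(h₍₂₎, z)k, x)w, with no trace left of the denominator g.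
  rw [pairIter₂_eq, hT, pairPsi_act, pairPsi_constInX, rowX2_eq_of_assoc hp YH YWH _ _ _ hg (hgB w),
    pairP_mapL]

theorem exists_substRel_sharp (hp : p ≠ 0)
    (hA : ∀ u v, ∃ f ∈ S, ∀ w, SubstRel p (act (iota12 f) (prodField (YWV u) (YWV v) w))
      (act (subst p f) (iterField YV YWV u v w)))
    (hB : ∀ h k, ∃ f : Two, f ≠ 0 ∧ ∀ w,
      SubstRel p (act (iota12 f) (prodField (toField YWH h) (toField YWH k) w))
      (act (subst p f) (iterField YH (toField YWH) h k w)))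
    (hC : ∀ h v, ∃ q ∈ S, IsExchange p YVH YWH YWV h v q) (ξ ζ : V ⊗[ℂ] H) :
    ∃ f ∈ S, ∀ w, SubstRel p
      (act (iota12 f) (prodField (sharp YWV YWH ξ) (sharp YWV YWH ζ) w))
      (act (subst p f) (ofIterateL (mapL ((sharp YWV YWH).flip w) (smashY YV YH YVH ξ ζ)))) := by
  have hadd : ∀ a a' b : W →ₗ[ℂ] HahnSeries ℤ W, ∀ w,
      prodField (a + a') b w = prodField a b w + prodField a' b w := fun a a' b w => rfl
  have hadd' : ∀ a b b' : W →ₗ[ℂ] HahnSeries ℤ W, ∀ w,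
      prodField a (b + b') w = prodField a b w + prodField a b' w := fun a b b' w => by
    rw [prodField_eq, LinearMap.add_apply, map_add, map_add]
    rfl
  have hzero : ∀ b : W →ₗ[ℂ] HahnSeries ℤ W, ∀ w, prodField 0 b w = 0 := fun b w => rfl
  have hzero' : ∀ a : W →ₗ[ℂ] HahnSeries ℤ W, ∀ w, prodField a 0 w = 0 := fun a w => by
    rw [prodField_eq, LinearMap.zero_apply, map_zero, map_zero]
  induction ξ with
  | zero => exact ⟨1, S.one_mem, fun w => by simpa [hzero] using SubstRel.zero⟩
  | add x y hx hy =>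
    obtain ⟨f, hf, hfx⟩ := hx
    obtain ⟨g, hg, hgy⟩ := hy
    refine ⟨f * g, S.mul_mem hf hg, fun w => ?_⟩
    simp only [map_add, LinearMap.add_apply, hadd]
    refine SubstRel.add ?_ ((hgy w).act_mul f g)
    rw [mul_comm]
    exact (hfx w).act_mul g f
  | tmul u h =>
    induction ζ with
    | zero => exact ⟨1, S.one_mem, fun w => by simpa [hzero'] using SubstRel.zero⟩
    | add x y hx hy =>
      obtain ⟨f, hf, hfx⟩ := hx
      obtain ⟨g, hg, hgy⟩ := hy
      refine ⟨f * g, S.mul_mem hf hg, fun w => ?_⟩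
      simp only [map_add, hadd']
      refine SubstRel.add ?_ ((hgy w).act_mul f g)
      rw [mul_comm]
      exact (hfx w).act_mul g f
    | tmul v k => exact exists_substRel_sharp_tmul hp hA hB hC u h v k

theorem exists_substRel_sharpRho (hp : p ≠ 0) {vacV : V} {vacH : H} {ρ : V →ₗ[ℂ] V ⊗[ℂ] H}
    (hρ : IsComoduleAlgebra YH vacH YV vacV ρ) (hρVH : IsCompatible YVH ρ)
    (hA : ∀ u v, ∃ f ∈ S, ∀ w, SubstRel p (act (iota12 f) (prodField (YWV u) (YWV v) w))
      (act (subst p f) (iterField YV YWV u v w)))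
    (hB : ∀ h k, ∃ f : Two, f ≠ 0 ∧ ∀ w,
      SubstRel p (act (iota12 f) (prodField (toField YWH h) (toField YWH k) w))
      (act (subst p f) (iterField YH (toField YWH) h k w)))
    (hC : ∀ h v, ∃ q ∈ S, IsExchange p YVH YWH YWV h v q) (u v : V) :
    ∃ f ∈ S, ∀ w, SubstRel p
      (act (iota12 f) (prodField (sharpRho YWV YWH ρ u) (sharpRho YWV YWH ρ v) w))
      (act (subst p f) (iterField (deform YV YVH ρ) (sharpRho YWV YWH ρ) u v w)) := by
  obtain ⟨f, hf, h⟩ := exists_substRel_sharp hp hA hB hC (ρ u) (ρ v)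
  refine ⟨f, hf, fun w => ?_⟩
  have h2 := h w
  rw [← mapL_deform hρ hρVH] at h2
  exact h2

end Main

/-! ### Rescaling the variable and equivariance -/

section Scale

variable {V H W : Type*} [AddCommGroup V] [Module ℂ V] [AddCommGroup H] [Module ℂ H]
variable [AddCommGroup W] [Module ℂ W]

/-- The substitution `x ↦ c x`. -/
def scaleL (c : ℂ) : HahnSeries ℤ W →ₗ[ℂ] HahnSeries ℤ W where
  toFun A :=
    { coeff := fun n => c ^ n • A.coeff n
      isPWO_support' := A.isPWO_support.mono fun n hn h => hn (by
        change c ^ n • A.coeff n = 0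
        rw [h, smul_zero]) }
  map_add' A B := by
    ext n
    exact smul_add _ _ _
  map_smul' r A := by
    ext n
    exact smul_comm _ _ _

theorem scaleL_coeff (c : ℂ) (A : HahnSeries ℤ W) (n : ℤ) :
    (scaleL c A).coeff n = c ^ n • A.coeff n := rfl

theorem scaleL_act {c : ℂ} (hc : c ≠ 0) (f : HahnSeries ℤ ℂ) (A : HahnSeries ℤ W) :
    scaleL c (act f A) = act (scaleL c f) (scaleL c A) := by
  ext n
  rw [scaleL_coeff, act_coeff, act_coeff, smul_finsum' _ (finite_support_act f A n)]
  refine finsum_congr fun a => ?_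
  rw [scaleL_coeff, scaleL_coeff, smul_smul, smul_smul, smul_eq_mul, mul_right_comm,
    ← zpow_add₀ hc, add_sub_cancel]

theorem scaleL_single (c : ℂ) (w : W) :
    scaleL c (HahnSeries.single 0 w) = HahnSeries.single 0 w := by
  ext n
  rw [scaleL_coeff, HahnSeries.coeff_single]
  split_ifs with h
  · subst h
    rw [zpow_zero, one_smul]
  · rw [smul_zero]

theorem extendField_scaleL {c : ℂ} (hc : c ≠ 0) {a b : W →ₗ[ℂ] HahnSeries ℤ W}
    (h : ∀ w, b w = scaleL c (a w)) (y : W ⊗[ℂ] HahnSeries ℤ ℂ) :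
    extendField b ((scaleL c).lTensor W y) = scaleL c (extendField a y) := by
  induction y with
  | zero => simp
  | add x y hx hy => rw [map_add, map_add, hx, hy, map_add, map_add]
  | tmul w s => rw [LinearMap.lTensor_tmul, extendField_tmul, extendField_tmul, h, scaleL_act hc]

theorem toSeries_scaleL {c : ℂ} (hc : c ≠ 0) (y : W ⊗[ℂ] HahnSeries ℤ ℂ) :
    toSeries ((scaleL c).lTensor W y) = scaleL c (toSeries y) := by
  rw [toSeries_eq]
  exact extendField_scaleL hc (fun w => (scaleL_single c w).symm) y

theorem toSeries_rTensor (l : W →ₗ[ℂ] W) (y : W ⊗[ℂ] HahnSeries ℤ ℂ) :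
    toSeries (l.rTensor (HahnSeries ℤ ℂ) y) = mapL l (toSeries y) := by
  induction y with
  | zero => simp
  | add x y hx hy => rw [map_add, map_add, hx, hy, map_add, map_add]
  | tmul w s =>
    ext n
    rw [LinearMap.rTensor_tmul, mapL_coeff, toSeries_tmul_coeff, toSeries_tmul_coeff, map_smul]

theorem extendField_rTensor {l : W →ₗ[ℂ] W} {a b : W →ₗ[ℂ] HahnSeries ℤ W}
    (h : ∀ w, mapL l (a w) = b (l w)) (y : W ⊗[ℂ] HahnSeries ℤ ℂ) :
    extendField b (l.rTensor (HahnSeries ℤ ℂ) y) = mapL l (extendField a y) := by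
  induction y with
  | zero => simp
  | add x y hx hy => rw [map_add, map_add, hx, hy, map_add, map_add]
  | tmul w s => rw [LinearMap.rTensor_tmul, extendField_tmul, extendField_tmul, mapL_act, h]

theorem sharp_vacuum {vacV : V} {vacH : H} {YWV : V →ₗ[ℂ] W →ₗ[ℂ] HahnSeries ℤ W}
    {YWH : H →ₗ[ℂ] W →ₗ[ℂ] W ⊗[ℂ] HahnSeries ℤ ℂ}
    (hV : ∀ w, YWV vacV w = HahnSeries.single 0 w)
    (hH : ∀ w, toField YWH vacH w = HahnSeries.single 0 w) (w : W) :
    sharp YWV YWH (vacV ⊗ₜ vacH) w = HahnSeries.single 0 w := by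
  have h : YWV vacV = constL := LinearMap.ext hV
  rw [sharp_tmul, h, ← toSeries_eq]
  exact hH w

/-- For c ≠ 0 the substitution x ↦ cx respects products of series, so it may be applied to both
factors at once. The hypothesis on H is first lifted from W((x)) to W ⊗ ℂ((x)). -/
theorem sharp_equivariant {YWV : V →ₗ[ℂ] W →ₗ[ℂ] HahnSeries ℤ W}
    {YWH : H →ₗ[ℂ] W →ₗ[ℂ] W ⊗[ℂ] HahnSeries ℤ ℂ} {c : ℂ} (hc : c ≠ 0) {a : V →ₗ[ℂ] V}
    {b : H →ₗ[ℂ] H} (hV : ∀ v w, YWV (a v) w = scaleL c (YWV v w))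
    (hH : ∀ h w, toField YWH (b h) w = scaleL c (toField YWH h w)) (ξ : V ⊗[ℂ] H) (w : W) :
    sharp YWV YWH (TensorProduct.map a b ξ) w = scaleL c (sharp YWV YWH ξ w) := by
  induction ξ with
  | zero => simp
  | add x y hx hy => simp only [map_add, LinearMap.add_apply, hx, hy]
  | tmul v h =>
    have h1 : YWH (b h) w = (scaleL c).lTensor W (YWH h w) := by
      apply toSeries_injective
      rw [toSeries_scaleL hc]
      exact hH h w
    rw [TensorProduct.map_tmul, sharp_tmul, sharp_tmul, h1, extendField_scaleL hc (hV v)]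

theorem sharp_conj {YV : V →ₗ[ℂ] V →ₗ[ℂ] HahnSeries ℤ V}
    {YVH : H →ₗ[ℂ] V →ₗ[ℂ] V ⊗[ℂ] HahnSeries ℤ ℂ} {c : ℂ} (hc : c ≠ 0) {a : V →ₗ[ℂ] V}
    {b : H →ₗ[ℂ] H} (hV : ∀ u v, mapL a (YV u v) = scaleL c (YV (a u) (a v)))
    (hH : ∀ h v, mapL a (toField YVH h v) = scaleL c (toField YVH (b h) (a v)))
    (ξ : V ⊗[ℂ] H) (w : V) :
    mapL a (sharp YV YVH ξ w) = scaleL c (sharp YV YVH (TensorProduct.map a b ξ) (a w)) := by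
  induction ξ with
  | zero => simp
  | add x y hx hy => simp only [map_add, LinearMap.add_apply, hx, hy]
  | tmul v h =>
    have h1 : a.rTensor (HahnSeries ℤ ℂ) (YVH h w) = (scaleL c).lTensor V (YVH (b h) (a w)) := by
      apply toSeries_injective
      rw [toSeries_scaleL hc, toSeries_rTensor]
      exact hH h w
    rw [TensorProduct.map_tmul, sharp_tmul, sharp_tmul,
      ← extendField_rTensor (b := scaleL c ∘ₗ YV (a v)) (hV v), h1,
      extendField_scaleL hc (fun w => rfl)]

end Scale

/-! ### Series in x₁ - x₂ and the substitution x₁ = x₂ + z -/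

section Shift

/-- For `c(x) ∈ ℂ[[x]]`, the series `c(x₁ - x₂) ∈ ℂ[[x₁, x₂]]`. -/
def shiftTwo (c : HahnSeries ℤ ℂ) : Two where
  coeff g := if 0 ≤ g.1 ∧ 0 ≤ g.2 then
    (-1) ^ g.2.toNat * ((g.1 + g.2).toNat.choose g.2.toNat : ℂ) * c.coeff (g.1 + g.2) else 0
  isPWO_support' := by
    have h : (Set.Ici (0 : ℤ)).IsPWO := (bddBelow_Ici (a := (0 : ℤ))).isWF.isPWO
    refine (h.prod h).mono fun g hg => ?_
    by_contra h2
    exact hg (if_neg h2)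

theorem shiftTwo_coeff (c : HahnSeries ℤ ℂ) (a b : ℤ) :
    (shiftTwo c).coeff (a, b) = if 0 ≤ a ∧ 0 ≤ b then
      (-1) ^ b.toNat * ((a + b).toNat.choose b.toNat : ℂ) * c.coeff (a + b) else 0 := rfl

/-- The chain rule for c(x₁ - x₂), with d the derivative of c. On coefficients it is the absorption
identity for binomials. -/
theorem pderiv1_shiftTwo {c d : HahnSeries ℤ ℂ}
    (h : ∀ n : ℤ, d.coeff n = ((n : ℂ) + 1) * c.coeff (n + 1)) :
    pderiv1 (shiftTwo c) = shiftTwo d := by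
  ext ⟨a, b⟩
  rw [pderiv1_coeff, shiftTwo_coeff, shiftTwo_coeff, h, smul_eq_mul]
  by_cases hb : 0 ≤ b
  swap
  · rw [if_neg (by omega), if_neg (by omega), mul_zero]
  by_cases ha : 0 ≤ a
  · rw [if_pos (by omega), if_pos (by omega)]
    lift a to ℕ using ha
    lift b to ℕ using hb
    have h1 : ((a : ℤ) + 1 + b).toNat = a + b + 1 := by omega
    have h2 : ((a : ℤ) + b).toNat = a + b := by omega
    rw [h1, h2, Int.toNat_natCast, show (a : ℤ) + 1 + b = a + b + 1 by ring]
    have h3 := Nat.add_one_mul_choose_eq (a + b) a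
    have h4 : (a + b + 1).choose b = (a + b + 1).choose (a + 1) := by
      rw [← Nat.choose_symm_of_eq_add (show a + b + 1 = (a + 1) + b by ring)]
    have h5 : (a + b).choose b = (a + b).choose a := Nat.choose_symm_add.symm
    rw [h4, h5]
    have h6 : ((a : ℂ) + b + 1) * ((a + b).choose a : ℂ) =
        ((a + b + 1).choose (a + 1) : ℂ) * ((a : ℂ) + 1) := by exact_mod_cast h3
    push_cast
    linear_combination (-(-1) ^ b * c.coeff (a + b + 1)) * h6
  · rw [if_neg (show ¬(0 ≤ a ∧ 0 ≤ b) by omega)]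
    -- At a = -1 the shifted index is 0, inside the support condition, but the factor a + 1
    -- vanishes.
    by_cases ha1 : a = -1
    · subst ha1
      simp
    · rw [if_neg (by omega), mul_zero]

/-- In degree n the diagonal sum is (1 - 1)ⁿ times the coefficient of c, so only the constant term
survives. -/
theorem diag_shiftTwo (c : HahnSeries ℤ ℂ) :
    diag (shiftTwo c) = HahnSeries.single 0 (c.coeff 0) := by
  ext n
  rw [diag_coeff]
  by_cases hn : 0 ≤ n
  · lift n to ℕ using hn
    rw [finsum_eq_sum_of_support_subset (s := (Finset.range (n + 1)).image fun b : ℕ => (n : ℤ) - b),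
      Finset.sum_image]
    · have h1 : ∀ b ∈ Finset.range (n + 1), (shiftTwo c).coeff ((n : ℤ) - b, n - (n - b)) =
          ((((-1) ^ b * (n.choose b : ℤ) : ℤ)) : ℂ) * c.coeff n := by
        intro b hb
        have := Finset.mem_range.mp hb
        rw [shiftTwo_coeff, if_pos (by omega), sub_sub_cancel, sub_add_cancel, Int.toNat_natCast,
          Int.toNat_natCast]
        push_cast
        rfl
      rw [Finset.sum_congr rfl h1, ← Finset.sum_mul, ← Int.cast_sum,
        Int.alternating_sum_range_choose]
      by_cases h0 : n = 0
      · subst h0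
        simp
      · rw [if_neg h0, HahnSeries.coeff_single_of_ne (by omega)]
        simp
    · intro a _ b _ hab
      simpa using hab
    · intro a ha
      rw [Function.mem_support, shiftTwo_coeff] at ha
      have h2 : 0 ≤ a ∧ 0 ≤ n - a := by
        by_contra h
        exact ha (if_neg h)
      rw [Finset.mem_coe, Finset.mem_image]
      exact ⟨(n - a).toNat, by rw [Finset.mem_range]; omega, by omega⟩
  · rw [HahnSeries.coeff_single_of_ne (by omega)]
    refine (finsum_congr fun a => ?_).trans finsum_zero
    rw [shiftTwo_coeff, if_neg (by omega)]

theorem inX1_one : inX1 (1 : HahnSeries ℤ ℂ) = 1 := by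
  ext ⟨a, b⟩
  rw [inX1_coeff, HahnSeries.coeff_one, HahnSeries.coeff_one]
  by_cases ha : a = 0 <;> by_cases hb : b = 0 <;> simp [ha, hb]

theorem diag_D1_shiftTwo (n : ℕ) (c : HahnSeries ℤ ℂ) :
    diagL ((D1L 1 ^ n) (shiftTwo c)) = HahnSeries.single 0 ((n.factorial : ℂ) * c.coeff n) := by
  induction n generalizing c with
  | zero =>
    rw [pow_zero, Module.End.one_apply, Nat.factorial_zero, Nat.cast_one, one_mul]
    exact diag_shiftTwo c
  | succ n ih =>
    have h1 : ∀ m : ℤ, (LaurentSeries.derivative ℂ c).coeff m = ((m : ℂ) + 1) * c.coeff (m + 1) := by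
      intro m
      rw [LaurentSeries.derivative_apply, LaurentSeries.hasseDeriv_coeff]
      simp
    rw [pow_succ, Module.End.mul_apply, D1L_apply, D1, inX1_one, act_one, pderiv1_shiftTwo h1, ih,
      h1, Nat.factorial_succ]
    congr 1
    push_cast
    ring

/-- Taylor's formula: the n-th derivative of c(x₁ - x₂) restricts to n! times the n-th coefficient
of c on the diagonal. -/
theorem subst_shiftTwo {c : HahnSeries ℤ ℂ} (hc : ∀ n < 0, c.coeff n = 0) :
    subst 1 (shiftTwo c) = constInX c := by
  obtain ⟨X, hX, hXc⟩ := ofCoeffs_eq fun n : ℕ =>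
    (n.factorial : ℂ)⁻¹ • diagL ((D1L 1 ^ n) (shiftTwo c))
  rw [subst_eq, hX]
  change ofIterateL X = ofIterateL (c.map (HahnSeries.C : ℂ →+* HahnSeries ℤ ℂ))
  congr 1
  ext n : 2
  rw [hXc, HahnSeries.map_coeff]
  split_ifs with hn
  · lift n to ℕ using hn
    rw [diag_D1_shiftTwo, Int.toNat_natCast]
    ext m
    have h : (n.factorial : ℂ) ≠ 0 := Nat.cast_ne_zero.mpr (Nat.factorial_ne_zero _)
    rw [HahnSeries.coeff_smul, HahnSeries.C_apply, HahnSeries.coeff_single,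
      HahnSeries.coeff_single]
    split_ifs
    · rw [smul_eq_mul, inv_mul_cancel_left₀ h]
    · rw [smul_zero]
  · rw [hc n (not_le.mp hn), map_zero]

theorem shiftSub_coeff (s : HahnSeries ℤ ℂ) (n m : ℤ) :
    (shiftSub s).coeff (toLex (n, m)) = if 0 ≤ n then
      (-1) ^ n.toNat * ((Ring.choose (m + n) n.toNat : ℤ) : ℂ) * s.coeff (m + n) else 0 := by
  change (ofCoeffs fun n => (-1 : ℂ) ^ n • LaurentSeries.hasseDeriv ℂ n s).coeff _ = _
  rw [ofCoeffs_coeff]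
  change (if 0 ≤ n then _ else (0 : ℂ)) = _
  split_ifs with hn
  · change ((-1 : ℂ) ^ n.toNat • LaurentSeries.hasseDeriv ℂ n.toNat s).coeff m = _
    rw [HahnSeries.coeff_smul, LaurentSeries.hasseDeriv_coeff, Int.toNat_of_nonneg hn,
      zsmul_eq_mul, smul_eq_mul, mul_assoc]
  · rfl

theorem iota12_shiftTwo {c : HahnSeries ℤ ℂ} (hc : ∀ n < 0, c.coeff n = 0) :
    iota12 (shiftTwo c) = shiftSub c := by
  ext g
  obtain ⟨⟨n, m⟩, rfl⟩ := toLex.surjective g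
  rw [iota12_coeff, shiftSub_coeff, shiftTwo_coeff]
  by_cases hn : 0 ≤ n
  swap
  · rw [if_neg (by omega), if_neg hn]
  rw [if_pos hn]
  by_cases hm : 0 ≤ m
  · rw [if_pos ⟨hm, hn⟩]
    lift n to ℕ using hn
    lift m to ℕ using hm
    rw [← Nat.cast_add, Int.toNat_natCast, Int.toNat_natCast, Ring.choose_natCast]
    simp
  · rw [if_neg (by omega)]
    by_cases h : 0 ≤ m + n
    · lift n to ℕ using hn
      obtain ⟨k, hk⟩ := Int.eq_ofNat_of_zero_le h
      -- Here m < 0 and 0 ≤ m + n < n, so the binomial coefficient vanishes; for m + n < 0 the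
      -- regularity of c is needed instead.
      rw [hk, Int.toNat_natCast, Ring.choose_natCast, Nat.choose_eq_zero_of_lt (by omega)]
      simp
    · rw [hc _ (not_le.mp h), mul_zero]

theorem iota12_single (a b : ℤ) (r : ℂ) :
    iota12 (HahnSeries.single (a, b) r) = HahnSeries.single (toLex (b, a)) r := by
  ext g
  obtain ⟨⟨n, m⟩, rfl⟩ := toLex.surjective g
  rw [iota12_coeff]
  by_cases hg : n = b ∧ m = a
  · obtain ⟨rfl, rfl⟩ := hg
    rw [HahnSeries.coeff_single_same, HahnSeries.coeff_single_same]
  · rw [HahnSeries.coeff_single_of_ne, HahnSeries.coeff_single_of_ne]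
    · intro h0
      exact hg ⟨congrArg Prod.fst (congrArg ofLex h0), congrArg Prod.snd (congrArg ofLex h0)⟩
    · intro h0
      exact hg ⟨congrArg Prod.snd h0, congrArg Prod.fst h0⟩

/-- `x₁ - x₂`. -/
abbrev diffTwo : Two := HahnSeries.single (1, 0) 1 - HahnSeries.single (0, 1) 1

/-- Coefficientwise this is Pascal's rule for generalised binomials. It allows the poles of s(x₁ -
x₂) to be cleared by powers of x₁ - x₂. -/
theorem shiftSub_single_mul (s : HahnSeries ℤ ℂ) :
    shiftSub (HahnSeries.single 1 1 * s) = act (iota12 diffTwo) (shiftSub s) := by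
  ext g
  obtain ⟨⟨n, m⟩, rfl⟩ := toLex.surjective g
  have h1 : ∀ k : ℤ, (HahnSeries.single 1 1 * s : HahnSeries ℤ ℂ).coeff k = s.coeff (k - 1) := by
    intro k
    rw [← act_eq_mul, act_single, one_smul]
  rw [map_sub, map_sub, iota12_single, iota12_single, LinearMap.sub_apply, HahnSeries.coeff_sub,
    act_single, act_single, one_smul, one_smul]
  change _ = (shiftSub s).coeff (toLex (n - 0, m - 1)) - (shiftSub s).coeff (toLex (n - 1, m - 0))
  rw [shiftSub_coeff, shiftSub_coeff, shiftSub_coeff, h1, sub_zero, sub_zero]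
  by_cases hn : 0 ≤ n
  swap
  · rw [if_neg hn, if_neg hn, if_neg (by omega), sub_zero]
  rw [if_pos hn, if_pos hn]
  lift n to ℕ using hn
  cases n with
  | zero =>
    rw [if_neg (by simp)]
    simp
  | succ n =>
    rw [if_pos (by push_cast; omega)]
    have e1 : ((n + 1 : ℕ) : ℤ).toNat = n + 1 := by omega
    have e2 : (((n + 1 : ℕ) : ℤ) - 1).toNat = n := by omega
    rw [e1, e2]
    have e3 : m + ((n + 1 : ℕ) : ℤ) = (m + n) + 1 := by push_cast; ring
    have e4 : m - 1 + ((n + 1 : ℕ) : ℤ) = m + n := by push_cast; ring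
    have e5 : m + (((n + 1 : ℕ) : ℤ) - 1) = m + n := by push_cast; ring
    rw [e3, e4, e5, Ring.choose_succ_succ, add_sub_cancel_right]
    push_cast
    ring

theorem shiftSub_single_pow_mul (k : ℕ) (s : HahnSeries ℤ ℂ) :
    shiftSub (HahnSeries.single (k : ℤ) 1 * s) = act (iota12 (diffTwo ^ k)) (shiftSub s) := by
  induction k with
  | zero =>
    rw [pow_zero, iota12_one, act_one]
    change shiftSub (1 * s) = _
    rw [one_mul]
  | succ k ih =>
    have h : (HahnSeries.single ((k + 1 : ℕ) : ℤ) 1 : HahnSeries ℤ ℂ) =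
        HahnSeries.single 1 1 * HahnSeries.single (k : ℤ) 1 := by
      rw [HahnSeries.single_mul_single, one_mul, Nat.cast_add, Nat.cast_one, add_comm]
    rw [h, mul_assoc, shiftSub_single_mul, ih, ← act_mul, ← iota12_mul, ← pow_succ']

theorem diffTwo_eq : diffTwo = shiftTwo (HahnSeries.single 1 1) := by
  ext ⟨a, b⟩
  rw [HahnSeries.coeff_sub, shiftTwo_coeff]
  by_cases h : a + b = 1
  · rw [h, HahnSeries.coeff_single_same]
    by_cases hb : b = 0
    · obtain rfl : a = 1 := by omega
      subst hb
      simp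
    by_cases hb1 : b = 1
    · obtain rfl : a = 0 := by omega
      subst hb1
      simp
    rw [if_neg (by omega), HahnSeries.coeff_single_of_ne, HahnSeries.coeff_single_of_ne, sub_zero]
    · exact fun h0 => hb1 (congrArg Prod.snd h0)
    · exact fun h0 => hb (congrArg Prod.snd h0)
  · rw [HahnSeries.coeff_single_of_ne, HahnSeries.coeff_single_of_ne,
      HahnSeries.coeff_single_of_ne h]
    · simp
    · intro h0
      have h1 : a = 0 := congrArg Prod.fst h0
      have h2 : b = 1 := congrArg Prod.snd h0
      omega
    · intro h0
      have h1 : a = 1 := congrArg Prod.fst h0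
      have h2 : b = 0 := congrArg Prod.snd h0
      omega

theorem constInX_mul (s t : HahnSeries ℤ ℂ) : constInX (s * t) = constInX s * constInX t := by
  rw [constInX_eq t, ← act_eq_mul (constInX s), act_constInX, ← mapL_act, ← constInX_eq, act_eq_mul]

theorem constInX_single (k : ℤ) :
    constInX (HahnSeries.single k 1) = HahnSeries.single (toLex (k, (0 : ℤ))) 1 := by
  rw [← iota12_inX2, ← iota12_single]
  congr 1
  ext ⟨a, b⟩
  rw [inX2_coeff]
  by_cases ha : a = 0
  · subst ha
    by_cases hb : b = k
    · subst hb
      rw [if_pos rfl, HahnSeries.coeff_single_same, HahnSeries.coeff_single_same]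
    · rw [if_pos rfl, HahnSeries.coeff_single_of_ne hb, HahnSeries.coeff_single_of_ne]
      exact fun h0 => hb (congrArg Prod.snd h0)
  · rw [if_neg ha, HahnSeries.coeff_single_of_ne]
    exact fun h0 => ha (congrArg Prod.fst h0)

theorem subst_diffTwo_pow (k : ℕ) :
    subst 1 (diffTwo ^ k) = constInX (HahnSeries.single (k : ℤ) 1) := by
  induction k with
  | zero =>
    rw [pow_zero, subst_one, constInX_single]
    rfl
  | succ k ih =>
    have h : (HahnSeries.single ((k + 1 : ℕ) : ℤ) 1 : HahnSeries ℤ ℂ) =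
        HahnSeries.single (k : ℤ) 1 * HahnSeries.single 1 1 := by
      rw [HahnSeries.single_mul_single, one_mul, Nat.cast_add, Nat.cast_one]
    rw [pow_succ, subst_mul, ih, h, constInX_mul]
    congr 1
    rw [diffTwo_eq, subst_shiftTwo]
    intro n hn
    exact HahnSeries.coeff_single_of_ne (by omega)

theorem diffTwo_pow_ne_zero (k : ℕ) : diffTwo ^ k ≠ 0 := by
  refine pow_ne_zero _ fun h => ?_
  have h2 := congrArg (fun f : Two => f.coeff (1, 0)) h
  simp only [HahnSeries.coeff_sub, HahnSeries.coeff_single_same, HahnSeries.coeff_zero] at h2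
  rw [HahnSeries.coeff_single_of_ne (by simp)] at h2
  simp at h2

end Shift

/-! ### The case p = 1: exchange in module algebras and the deformed algebra -/

section Exchange

variable {V H W : Type*} [AddCommGroup V] [Module ℂ V] [AddCommGroup H] [Module ℂ H]
variable [AddCommGroup W] [Module ℂ W]

theorem exists_comul_repr [Coalgebra ℂ H] (h : H) : ∃ (N : ℕ) (l r : Fin N → H),
    Coalgebra.comul (R := ℂ) h = ∑ i, l i ⊗ₜ[ℂ] r i := by
  let R := Coalgebra.Repr.arbitrary ℂ h
  let e := R.index.equivFin
  refine ⟨R.index.card, fun i => R.left (e.symm i), fun i => R.right (e.symm i), ?_⟩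
  rw [← R.eq, ← Finset.sum_coe_sort, ← Equiv.sum_comp e.symm]

/-- The map sending `v ⊗ F` and `w ⊗ g` to `F(x₁, x₂) g(x₁) Y_W(v, x₂)w ∈ W((x₁))((x₂))`. -/
def pairOuter (YWV : V →ₗ[ℂ] W →ₗ[ℂ] HahnSeries ℤ W) :
    V ⊗[ℂ] Iter →ₗ[ℂ] W ⊗[ℂ] HahnSeries ℤ ℂ →ₗ[ℂ] HahnSeries (ℤ ×ₗ ℤ) W :=
  pairMap YWV ((act (Γ := ℤ ×ₗ ℤ) (W := ℂ)).compl₂ (iota12 ∘ₗ inX1)) (act.flip ∘ₗ iota12 ∘ₗ inX2)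

/-- The map sending `v ⊗ F` and `w ⊗ g` to `F(x₁, x₂) g(x₁) Y_W(v, x₂)w ∈ W((x₂))((x₁))`. -/
def pairInner (YWV : V →ₗ[ℂ] W →ₗ[ℂ] HahnSeries ℤ W) :
    V ⊗[ℂ] Iter →ₗ[ℂ] W ⊗[ℂ] HahnSeries ℤ ℂ →ₗ[ℂ] HahnSeries (ℤ ×ₗ ℤ) W :=
  pairMap YWV ((act (Γ := ℤ ×ₗ ℤ) (W := ℂ)).compl₂ (iota21 ∘ₗ inX1)) (act.flip ∘ₗ iota21 ∘ₗ inX2)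

theorem pairOuter_tmul (YWV : V →ₗ[ℂ] W →ₗ[ℂ] HahnSeries ℤ W) (v : V) (F : Iter) (w : W)
    (g : HahnSeries ℤ ℂ) : pairOuter YWV (v ⊗ₜ F) (w ⊗ₜ g) =
      act (act F (iota12 (inX1 g))) (iota12 (inX2 (YWV v w))) := rfl

theorem pairInner_tmul (YWV : V →ₗ[ℂ] W →ₗ[ℂ] HahnSeries ℤ W) (v : V) (F : Iter) (w : W)
    (g : HahnSeries ℤ ℂ) : pairInner YWV (v ⊗ₜ F) (w ⊗ₜ g) =
      act (act F (iota21 (inX1 g))) (iota21 (inX2 (YWV v w))) := rfl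

theorem pairOuter_act (YWV : V →ₗ[ℂ] W →ₗ[ℂ] HahnSeries ℤ W) (F : Iter) (t : V ⊗[ℂ] Iter)
    (y : W ⊗[ℂ] HahnSeries ℤ ℂ) :
    pairOuter YWV ((act F).lTensor V t) y = act F (pairOuter YWV t y) := by
  have h : pairOuter YWV ∘ₗ (act F).lTensor V = (pairOuter YWV).compr₂ (act F) := by
    refine tensor_bilin_ext fun v f w g => ?_
    rw [LinearMap.comp_apply, LinearMap.compr₂_apply, LinearMap.lTensor_tmul, pairOuter_tmul,
      pairOuter_tmul, ← act_mul, act_eq_mul, act_eq_mul, act_eq_mul, mul_assoc]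
  rw [← LinearMap.comp_apply, h, LinearMap.compr₂_apply]

theorem pairInner_act (YWV : V →ₗ[ℂ] W →ₗ[ℂ] HahnSeries ℤ W) (F : Iter) (t : V ⊗[ℂ] Iter)
    (y : W ⊗[ℂ] HahnSeries ℤ ℂ) :
    pairInner YWV ((act F).lTensor V t) y = act F (pairInner YWV t y) := by
  have h : pairInner YWV ∘ₗ (act F).lTensor V = (pairInner YWV).compr₂ (act F) := by
    refine tensor_bilin_ext fun v f w g => ?_
    rw [LinearMap.comp_apply, LinearMap.compr₂_apply, LinearMap.lTensor_tmul, pairInner_tmul,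
      pairInner_tmul, ← act_mul, act_eq_mul, act_eq_mul, act_eq_mul, mul_assoc]
  rw [← LinearMap.comp_apply, h, LinearMap.compr₂_apply]

theorem pairOuter_iota12 (YWV : V →ₗ[ℂ] W →ₗ[ℂ] HahnSeries ℤ W) (T : V ⊗[ℂ] Two)
    (y : W ⊗[ℂ] HahnSeries ℤ ℂ) :
    pairOuter YWV (iota12.lTensor V T) y = iota12 (pairTwo YWV T y) := by
  have h : pairOuter YWV ∘ₗ iota12.lTensor V = (pairTwo YWV).compr₂ iota12 := by
    refine tensor_bilin_ext fun v f w g => ?_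
    rw [LinearMap.comp_apply, LinearMap.compr₂_apply, LinearMap.lTensor_tmul, pairOuter_tmul,
      pairTwo_tmul, iota12_act, iota12_mul, act_eq_mul]
  rw [← LinearMap.comp_apply, h, LinearMap.compr₂_apply]

theorem pairInner_iota21 (YWV : V →ₗ[ℂ] W →ₗ[ℂ] HahnSeries ℤ W) (T : V ⊗[ℂ] Two)
    (y : W ⊗[ℂ] HahnSeries ℤ ℂ) :
    pairInner YWV (iota21.lTensor V T) y = iota21 (pairTwo YWV T y) := by
  have h : pairInner YWV ∘ₗ iota21.lTensor V = (pairTwo YWV).compr₂ iota21 := by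
    refine tensor_bilin_ext fun v f w g => ?_
    rw [LinearMap.comp_apply, LinearMap.compr₂_apply, LinearMap.lTensor_tmul, pairInner_tmul,
      pairTwo_tmul, iota21_act, ← act_eq_mul, iota21_act]
  rw [← LinearMap.comp_apply, h, LinearMap.compr₂_apply]

/-- In this form a scalar q can be moved onto the coefficient functions by `pairOuter_act` and the
result recognised as an expansion. -/
theorem moduleAlgebraRHS_eq (YV : V →ₗ[ℂ] V →ₗ[ℂ] HahnSeries ℤ V)
    (YVH : H →ₗ[ℂ] V →ₗ[ℂ] V ⊗[ℂ] HahnSeries ℤ ℂ) (u v : V) (h k : H) :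
    moduleAlgebraRHS YV YVH u v h k = pairOuter YV (shiftSub.lTensor V (YVH h u)) (YVH k v) := by
  have h1 : pairMap YV ((act (Γ := ℤ ×ₗ ℤ) (W := ℂ)).compl₁₂ shiftSub (iota12 ∘ₗ inX1))
      (act.flip ∘ₗ iota12 ∘ₗ inX2) = pairOuter YV ∘ₗ shiftSub.lTensor V :=
    tensor_bilin_ext fun v f w g => rfl
  exact congrArg (fun F : V ⊗[ℂ] HahnSeries ℤ ℂ →ₗ[ℂ] V ⊗[ℂ] HahnSeries ℤ ℂ →ₗ[ℂ]
    HahnSeries (ℤ ×ₗ ℤ) V => F (YVH h u) (YVH k v)) h1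

theorem pairRHS_eq (YWV : V →ₗ[ℂ] W →ₗ[ℂ] HahnSeries ℤ W) (t : V ⊗[ℂ] TwoFrac)
    (y : W ⊗[ℂ] HahnSeries ℤ ℂ) :
    pairRHS YWV t y = pairInner YWV (iota21Frac.toLinearMap.lTensor V t) y := by
  have h1 : pairRHS YWV = pairInner YWV ∘ₗ iota21Frac.toLinearMap.lTensor V :=
    tensor_bilin_ext fun v f w g => rfl
  rw [h1, LinearMap.comp_apply]

theorem substL_lTensor_act (p : HahnSeries ℤ ℂ) (r : Two) (T : V ⊗[ℂ] Two) :
    (substL p).lTensor V ((act r).lTensor V T) =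
      (act (subst p r)).lTensor V ((substL p).lTensor V T) := by
  rw [← LinearMap.comp_apply, ← LinearMap.comp_apply, ← LinearMap.lTensor_comp,
    ← LinearMap.lTensor_comp]
  exact congrArg (fun l : Two →ₗ[ℂ] Iter => l.lTensor V T)
    (LinearMap.ext fun f => subst_act p r f)

theorem iota12_lTensor_act (r : Two) (T : V ⊗[ℂ] Two) :
    iota12.lTensor V ((act r).lTensor V T) =
      (act (iota12 r)).lTensor V (iota12.lTensor V T) := by
  rw [← LinearMap.comp_apply, ← LinearMap.comp_apply, ← LinearMap.lTensor_comp,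
    ← LinearMap.lTensor_comp]
  exact congrArg (fun l : Two →ₗ[ℂ] Iter => l.lTensor V T)
    (LinearMap.ext fun f => iota12_act r f)

theorem act_lTensor_mul (r s : Iter) (T : V ⊗[ℂ] Iter) :
    (act (r * s)).lTensor V T = (act r).lTensor V ((act s).lTensor V T) := by
  rw [← LinearMap.comp_apply, ← LinearMap.lTensor_comp]
  exact congrArg (fun l : Iter →ₗ[ℂ] Iter => l.lTensor V T)
    (LinearMap.ext fun f => act_mul r s f)

/-- `q(x₁, x₂) y(x₁ - x₂)` is the expansion of an element of `V ⊗ ℂ((x₁, x₂))` whose value at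
`x₁ = x₂ + z` is `q(x₂ + z, x₂) y(z)`. -/
def IsShiftLift (y : V ⊗[ℂ] HahnSeries ℤ ℂ) (q : Two) : Prop :=
  ∃ T : V ⊗[ℂ] Two,
    (substL 1).lTensor V T = (act (subst 1 q)).lTensor V (constInXL.lTensor V y) ∧
    iota12.lTensor V T = (act (iota12 q)).lTensor V (shiftSub.lTensor V y)

theorem IsShiftLift.mul {y : V ⊗[ℂ] HahnSeries ℤ ℂ} {q : Two} (h : IsShiftLift y q) (r : Two) :
    IsShiftLift y (r * q) := by
  obtain ⟨T, h1, h2⟩ := h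
  refine ⟨(act r).lTensor V T, ?_, ?_⟩
  · rw [substL_lTensor_act, h1, subst_mul, act_lTensor_mul]
  · rw [iota12_lTensor_act, h2, iota12_mul, act_lTensor_mul]

theorem exists_isShiftLift (y : V ⊗[ℂ] HahnSeries ℤ ℂ) :
    ∃ q ∈ Submonoid.powers diffTwo, IsShiftLift y q := by
  induction y with
  | zero => exact ⟨1, one_mem _, 0, by simp, by simp⟩
  | add x y hx hy =>
    obtain ⟨q, hq, hx⟩ := hx
    obtain ⟨r, hr, hy⟩ := hy
    obtain ⟨T, h1, h2⟩ := hx.mul r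
    obtain ⟨T', h1', h2'⟩ := hy.mul q
    rw [mul_comm] at h1' h2'
    exact ⟨r * q, mul_mem hr hq, T + T', by simp only [map_add, h1, h1'],
      by simp only [map_add, h2, h2']⟩
  | tmul v s =>
    have hc : ∀ n < 0, (HahnSeries.single ((-s.order).toNat : ℤ) 1 * s : HahnSeries ℤ ℂ).coeff n =
        0 := by
      intro n hn
      rw [← act_eq_mul, act_single, HahnSeries.coeff_eq_zero_of_lt_order (by omega), smul_zero]
    -- The exponent is the pole order of s, or 0 if there is no pole; after multiplication the
    -- series is regular and its shift lies in ℂ[[x₁, x₂]].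
    refine ⟨diffTwo ^ (-s.order).toNat, ⟨_, rfl⟩,
      v ⊗ₜ shiftTwo (HahnSeries.single ((-s.order).toNat : ℤ) 1 * s), ?_, ?_⟩
    · simp only [LinearMap.lTensor_tmul]
      congr 1
      rw [substL_apply, subst_shiftTwo hc, constInX_mul, subst_diffTwo_pow, act_eq_mul]
      rfl
    · simp only [LinearMap.lTensor_tmul]
      congr 1
      rw [iota12_shiftTwo hc, shiftSub_single_pow_mul]

/-- The module algebra axiom already is an exchange relation with coefficients in x₁ - x₂; a common
power of x₁ - x₂ clears the poles of all terms of the coproduct. -/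
theorem exists_isExchange_of_moduleAlgebra [Coalgebra ℂ H]
    {YH : H →ₗ[ℂ] H →ₗ[ℂ] HahnSeries ℤ H} {vacH : H} {YV : V →ₗ[ℂ] V →ₗ[ℂ] HahnSeries ℤ V}
    {vacV : V} {YVH : H →ₗ[ℂ] V →ₗ[ℂ] V ⊗[ℂ] HahnSeries ℤ ℂ}
    (hVH : IsModuleAlgebra YH vacH YV vacV YVH) (h : H) (v : V) :
    ∃ q ∈ Submonoid.powers diffTwo, IsExchange 1 YVH YVH YV h v q := by
  obtain ⟨N, l, r, hcom⟩ := exists_comul_repr h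
  obtain ⟨q, hq, hqT⟩ := exists_common_multiple (Submonoid.powers diffTwo) Finset.univ
    (fun i q => IsShiftLift (YVH (l i) v) q) (fun i _ => exists_isShiftLift _)
    (fun i q r _ hq => hq.mul r)
  choose T hT using fun i => hqT i (Finset.mem_univ _)
  refine ⟨q, hq, N, l, r, T, hcom, fun i => (hT i).1, fun w => ?_⟩
  rw [hVH.act_Y, hcom, map_sum, map_sum, map_sum]
  refine Finset.sum_congr rfl fun i _ => ?_
  rw [TensorProduct.lift.tmul, moduleAlgebraRHS_eq, ← pairOuter_act, ← (hT i).2, pairOuter_iota12]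

theorem IsModule.exists_substRel {Y : V →ₗ[ℂ] V →ₗ[ℂ] HahnSeries ℤ V} {vac : V}
    {YW : V →ₗ[ℂ] W →ₗ[ℂ] HahnSeries ℤ W} (h : IsModule Y vac YW) (u v : V) :
    ∃ f ∈ Submonoid.powers diffTwo, ∀ w,
      SubstRel 1 (act (iota12 f) (prodField (YW u) (YW v) w))
        (act (subst 1 f) (iterField Y YW u v w)) := by
  obtain ⟨k, hk⟩ := h.assoc u v
  refine ⟨diffTwo ^ k, ⟨k, rfl⟩, fun w => ?_⟩
  rw [subst_diffTwo_pow, constInX_single]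
  exact hk w

theorem ne_zero_of_mem_powers_diffTwo {f : Two} (h : f ∈ Submonoid.powers diffTwo) : f ≠ 0 := by
  obtain ⟨k, rfl⟩ := h
  exact diffTwo_pow_ne_zero k

theorem isGroupModuleAlgebra_deform {G : Type*} [Group G] {χ : G →* ℂˣ}
    [Coalgebra ℂ H] [Coalgebra.IsCocomm ℂ H]
    {YH : H →ₗ[ℂ] H →ₗ[ℂ] HahnSeries ℤ H} {vacH : H} {RH : Representation ℂ G H}
    {YV : V →ₗ[ℂ] V →ₗ[ℂ] HahnSeries ℤ V} {vacV : V} {RV : Representation ℂ G V}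
    (hV : IsGroupModuleAlgebra χ YV vacV RV)
    {YVH : H →ₗ[ℂ] V →ₗ[ℂ] V ⊗[ℂ] HahnSeries ℤ ℂ}
    (hVH : IsModuleAlgebra YH vacH YV vacV YVH) (hG : IsGroupCompatible χ RH RV YVH)
    {ρ : V →ₗ[ℂ] V ⊗[ℂ] H} (hρ : IsComoduleAlgebra YH vacH YV vacV ρ)
    (hρVH : IsCompatible YVH ρ)
    (hρG : ∀ g v, ρ (RV g v) = TensorProduct.map (RV g) (RH g) (ρ v)) :
    IsGroupModuleAlgebra χ (deform YV YVH ρ) vacV RV := by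
  -- On the vacuum H acts through its counit, and the counit axiom of the comodule undoes the
  -- coaction. Hence both creation properties are inherited unchanged.
  have hvac : ∀ v, deform YV YVH ρ v vacV = YV v vacV := by
    have h1 : ∀ ξ : V ⊗[ℂ] H, sharp YV YVH ξ vacV =
        YV.flip vacV (TensorProduct.rid ℂ V
          ((Coalgebra.counit (R := ℂ) (A := H)).lTensor V ξ)) := by
      intro ξ
      induction ξ with
      | zero => simp
      | add x y hx hy => simp only [map_add, LinearMap.add_apply, hx, hy]
      | tmul v h =>
        rw [sharp_tmul, hVH.act_vacuum, map_smul, extendField_tmul, act_one,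
          LinearMap.lTensor_tmul, TensorProduct.rid_tmul, map_smul]
        rfl
    intro v
    refine (h1 (ρ v)).trans ?_
    rw [hρ.counit, TensorProduct.rid_tmul, one_smul]
    rfl
  refine
    { vacuum := ?_
      assoc := ?_
      creation_regular := ?_
      creation := ?_
      map_vacuum := ?_
      map_Y := ?_ }
  · intro w
    change sharp YV YVH (ρ vacV) w = _
    rw [hρ.map_vacuum]
    exact sharp_vacuum hV.vacuum hVH.vacuum w
  · intro u v
    -- The general result with p = 1 and V acting on itself. Since S consists of powers of x₁ - x₂,
    -- the denominator has the shape the axiom asks for.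
    obtain ⟨f, ⟨k, rfl⟩, hf⟩ := exists_substRel_sharpRho one_ne_zero hρ hρVH
      hV.toIsModule.exists_substRel
      (fun h k => by
        obtain ⟨f, hf, hf'⟩ := hVH.toIsModule.exists_substRel h k
        exact ⟨f, ne_zero_of_mem_powers_diffTwo hf, hf'⟩)
      (exists_isExchange_of_moduleAlgebra hVH) u v
    refine ⟨k, fun w => ?_⟩
    have h2 := hf w
    simp only [subst_diffTwo_pow, constInX_single] at h2
    exact h2
  · intro v n hn
    rw [hvac]
    exact hV.creation_regular v n hn
  · intro v
    rw [hvac]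
    exact hV.creation v
  · exact hV.map_vacuum
  · intro g v w n
    have hinv : ∀ w, RV g (RV g⁻¹ w) = w := RV.self_inv_apply g
    have h1 := sharp_conj (YV := YV) (YVH := YVH) (c := χ g) (Units.ne_zero _) (a := RV g)
      (b := RH g)
      (fun u v => by
        ext n
        have h2 := hV.map_Y g u (RV g v) n
        rwa [RV.inv_self_apply] at h2)
      (fun h v => by
        ext n
        exact hG g h v n) (ρ v) (RV g⁻¹ w)
    rw [hinv, ← hρG] at h1
    exact congrArg (fun A : HahnSeries ℤ V => A.coeff n) h1

end Exchange

/-! ### General p: exchange for pair modules and the equivariant quasi module -/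

section Phi

variable {V H W : Type*} [AddCommGroup V] [Module ℂ V] [AddCommGroup H] [Module ℂ H]
variable [AddCommGroup W] [Module ℂ W]
variable {G : Type*} [Group G]

/-- The multiplicative monoid of the `q(x₁ / x₂)` with `q ∈ ℂ_{χ_φ(G)}[x]`. -/
def ratioMonoid (χφ : G →* ℂˣ) : Submonoid Two :=
  (rootMonoid χφ).map
    (Polynomial.aeval (HahnSeries.single ((1 : ℤ), (-1 : ℤ)) (1 : ℂ)) : Polynomial ℂ →ₐ[ℂ] Two)

theorem mem_ratioMonoid {χφ : G →* ℂˣ} {f : Two} :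
    f ∈ ratioMonoid χφ ↔ ∃ q ∈ rootMonoid χφ, evalRatio12 q = f := Iff.rfl

theorem evalRatio12_X_sub_C (c : ℂ) : evalRatio12 (Polynomial.X - Polynomial.C c) =
    HahnSeries.single ((1 : ℤ), (-1 : ℤ)) 1 - algebraMap ℂ Two c := by
  rw [evalRatio12, map_sub, Polynomial.aeval_X, Polynomial.aeval_C]

theorem evalRatio21_X_sub_C (c : ℂ) : evalRatio21 (Polynomial.X - Polynomial.C c) =
    HahnSeries.single ((-1 : ℤ), (1 : ℤ)) 1 - algebraMap ℂ Two c := by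
  rw [evalRatio21, map_sub, Polynomial.aeval_X, Polynomial.aeval_C]

theorem evalRatio12_ne_zero {χφ : G →* ℂˣ} {q : Polynomial ℂ} (hq : q ∈ rootMonoid χφ) :
    evalRatio12 q ≠ 0 := by
  induction hq using Submonoid.closure_induction with
  | mem q hq =>
    obtain ⟨g, rfl⟩ := hq
    dsimp only
    rw [evalRatio12_X_sub_C, ← HahnSeries.C_eq_algebraMap]
    intro h
    have h2 := congrArg (fun f : Two => f.coeff (1, -1)) h
    simp only [HahnSeries.coeff_sub, HahnSeries.coeff_single_same, HahnSeries.coeff_zero,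
      HahnSeries.C_apply] at h2
    rw [HahnSeries.coeff_single_of_ne (by simp), sub_zero] at h2
    exact one_ne_zero h2
  | one => rw [evalRatio12, map_one]; exact one_ne_zero
  | mul x y _ _ hx hy => rw [evalRatio12, map_mul]; exact mul_ne_zero hx hy

theorem ne_zero_of_mem_ratioMonoid {χφ : G →* ℂˣ} {f : Two} (hf : f ∈ ratioMonoid χφ) :
    f ≠ 0 := by
  obtain ⟨q, hq, rfl⟩ := mem_ratioMonoid.mp hf
  exact evalRatio12_ne_zero hq

/-- Up to a factor, `q(x₂ / x₁)` is of the form `q'(x₁ / x₂)`. -/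
theorem exists_mul_evalRatio21_mem {χφ : G →* ℂˣ} {q : Polynomial ℂ} (hq : q ∈ rootMonoid χφ) :
    ∃ m : Two, m * evalRatio21 q ∈ ratioMonoid χφ := by
  induction hq using Submonoid.closure_induction with
  | mem q hq =>
    obtain ⟨g, rfl⟩ := hq
    have hg : ((χφ g : ℂˣ) : ℂ) ≠ 0 := Units.ne_zero _
    -- For c = χ_φ(g), multiplying x₂/x₁ - c by -c⁻¹ x₁/x₂ gives x₁/x₂ - c⁻¹, and c⁻¹ is the value
    -- of χ_φ at g⁻¹.
    refine ⟨-(algebraMap ℂ Two (χφ g : ℂ)⁻¹ * HahnSeries.single ((1 : ℤ), (-1 : ℤ)) 1),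
      mem_ratioMonoid.mpr ⟨Polynomial.X - Polynomial.C (χφ g⁻¹ : ℂ),
        Submonoid.subset_closure ⟨g⁻¹, rfl⟩, ?_⟩⟩
    have h1 : (HahnSeries.single ((1 : ℤ), (-1 : ℤ)) 1 : Two) *
        HahnSeries.single ((-1 : ℤ), (1 : ℤ)) 1 = 1 := by
      rw [HahnSeries.single_mul_single, mul_one]
      rfl
    have h2 : algebraMap ℂ Two (χφ g : ℂ)⁻¹ * algebraMap ℂ Two (χφ g : ℂ) = 1 := by
      rw [← map_mul, inv_mul_cancel₀ hg, map_one]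
    rw [evalRatio12_X_sub_C, evalRatio21_X_sub_C, map_inv, Units.val_inv_eq_inv_val]
    linear_combination algebraMap ℂ Two (χφ g : ℂ)⁻¹ * h1 -
      HahnSeries.single ((1 : ℤ), (-1 : ℤ)) 1 * h2
  | one => exact ⟨1, by rw [evalRatio21, map_one, mul_one]; exact one_mem _⟩
  | mul x y _ _ hx hy =>
    obtain ⟨m, hm⟩ := hx
    obtain ⟨n, hn⟩ := hy
    refine ⟨m * n, ?_⟩
    rw [evalRatio21, map_mul, mul_mul_mul_comm]
    exact mul_mem hm hn

/-- The substitution `x₁ = φ(x, z)`, `x₂ = x` as a homomorphism of algebras. -/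
def substAlgHom (p : HahnSeries ℤ ℂ) : Two →ₐ[ℂ] Iter :=
  AlgHom.ofLinearMap (substL p) (subst_one p) (subst_mul p)

theorem substAlgHom_injective {p : HahnSeries ℤ ℂ} (hp : p ≠ 0) :
    Function.Injective (substAlgHom p) :=
  subst_injective hp

/-- The substitution `x₁ = φ(x, z)`, `x₂ = x` for fractions. -/
def substFrac {p : HahnSeries ℤ ℂ} (hp : p ≠ 0) : TwoFrac →ₐ[ℂ] Iter :=
  IsFractionRing.liftAlgHom (substAlgHom_injective hp)

theorem substFrac_algebraMap {p : HahnSeries ℤ ℂ} (hp : p ≠ 0) (f : Two) :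
    substFrac hp (algebraMap Two TwoFrac f) = subst p f :=
  IsFractionRing.lift_algebraMap (K := TwoFrac) (g := (substAlgHom p).toRingHom)
    (substAlgHom_injective hp) f

theorem iota21Frac_algebraMap (f : Two) : iota21Frac (algebraMap Two TwoFrac f) = iota21 f :=
  IsFractionRing.lift_algebraMap (K := TwoFrac) (g := iota21Hom.toRingHom) iota21Hom_injective f

/-- The substitution is injective, hence extends to the fraction field, so the value of F does not
depend on the chosen numerator and denominator. -/
theorem IsPhiValue.substFrac_eq {p : HahnSeries ℤ ℂ} (hp : p ≠ 0) {F : TwoFrac}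
    {s : HahnSeries ℤ ℂ} (h : IsPhiValue p F s) : substFrac hp F = constInX s := by
  obtain ⟨f, g, hg, rfl, hs⟩ := h
  rw [hs, map_div₀, substFrac_algebraMap, substFrac_algebraMap]

theorem IsPhiLift.substFrac_eq {p : HahnSeries ℤ ℂ} (hp : p ≠ 0) {y : V ⊗[ℂ] HahnSeries ℤ ℂ}
    {t : V ⊗[ℂ] TwoFrac} (h : IsPhiLift p y t) :
    (substFrac hp).toLinearMap.lTensor V t = constInXL.lTensor V y := by
  obtain ⟨n, a, F, s, hF, rfl, rfl⟩ := h
  rw [map_sum, map_sum]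
  refine Finset.sum_congr rfl fun i _ => ?_
  rw [LinearMap.lTensor_tmul, LinearMap.lTensor_tmul]
  congr 1
  exact (hF i).2.substFrac_eq hp

/-- `q t` lies in `V ⊗ ℂ((x₁, x₂))`. -/
def IsDenominator (t : V ⊗[ℂ] TwoFrac) (q : Two) : Prop :=
  ∃ T : V ⊗[ℂ] Two, (LinearMap.mulLeft ℂ (algebraMap Two TwoFrac q)).lTensor V t =
    (IsScalarTower.toAlgHom ℂ Two TwoFrac).toLinearMap.lTensor V T

theorem IsDenominator.mul {t : V ⊗[ℂ] TwoFrac} {q : Two} (h : IsDenominator t q) (r : Two) :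
    IsDenominator t (r * q) := by
  obtain ⟨T, hT⟩ := h
  refine ⟨(act r).lTensor V T, ?_⟩
  rw [map_mul, LinearMap.mulLeft_mul, LinearMap.lTensor_comp, LinearMap.comp_apply, hT,
    ← LinearMap.comp_apply, ← LinearMap.comp_apply, ← LinearMap.lTensor_comp,
    ← LinearMap.lTensor_comp]
  refine congrArg (fun l : Two →ₗ[ℂ] TwoFrac => l.lTensor V T) (LinearMap.ext fun f => ?_)
  exact (map_mul (algebraMap Two TwoFrac) r f).symm

/-- Used for both maps out of the fraction field, the substitution and ι_{x₂,x₁}: one T with q t = T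
controls the restricted coefficients and the expanded ones. -/
theorem lTensor_algHom_of_isDenominator (φ : TwoFrac →ₐ[ℂ] Iter) {ψ : Two →ₗ[ℂ] Iter}
    (h : ∀ f, φ (algebraMap Two TwoFrac f) = ψ f) {t : V ⊗[ℂ] TwoFrac} {q : Two} {T : V ⊗[ℂ] Two}
    (hT : (LinearMap.mulLeft ℂ (algebraMap Two TwoFrac q)).lTensor V t =
      (IsScalarTower.toAlgHom ℂ Two TwoFrac).toLinearMap.lTensor V T) :
    (act (ψ q)).lTensor V (φ.toLinearMap.lTensor V t) = ψ.lTensor V T := by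
  have h1 : φ.toLinearMap ∘ₗ (IsScalarTower.toAlgHom ℂ Two TwoFrac).toLinearMap = ψ :=
    LinearMap.ext h
  have h2 : act (ψ q) ∘ₗ φ.toLinearMap =
      φ.toLinearMap ∘ₗ LinearMap.mulLeft ℂ (algebraMap Two TwoFrac q) := by
    refine LinearMap.ext fun F => ?_
    rw [LinearMap.comp_apply, LinearMap.comp_apply, LinearMap.mulLeft_apply, act_eq_mul, ← h]
    exact (map_mul φ _ _).symm
  have h3 : ψ.lTensor V T = φ.toLinearMap.lTensor V
      ((IsScalarTower.toAlgHom ℂ Two TwoFrac).toLinearMap.lTensor V T) := by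
    rw [← LinearMap.comp_apply, ← LinearMap.lTensor_comp, h1]
  rw [h3, ← hT, ← LinearMap.comp_apply, ← LinearMap.lTensor_comp, h2, LinearMap.lTensor_comp,
    LinearMap.comp_apply]

variable {χφ : G →* ℂˣ} {p : HahnSeries ℤ ℂ}

/-- φ-compatibility supplies the denominators, rewritten from x₂/x₁ to x₁/x₂. Multiplied by q, the
right side of the commutation relation is the expansion of an element of W((x₁, x₂)). -/
theorem exists_isExchange_of_pairModule [Coalgebra ℂ H] (hp : p ≠ 0)
    {YH : H →ₗ[ℂ] H →ₗ[ℂ] HahnSeries ℤ H} {vacH : H} {RH : Representation ℂ G H}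
    {YV : V →ₗ[ℂ] V →ₗ[ℂ] HahnSeries ℤ V} {vacV : V} {RV : Representation ℂ G V}
    {YVH : H →ₗ[ℂ] V →ₗ[ℂ] V ⊗[ℂ] HahnSeries ℤ ℂ}
    (hVH : IsPhiCompatibleModuleAlgebra χφ p YH vacH YV vacV YVH)
    {YWH : H →ₗ[ℂ] W →ₗ[ℂ] W ⊗[ℂ] HahnSeries ℤ ℂ} {YWV : V →ₗ[ℂ] W →ₗ[ℂ] HahnSeries ℤ W}
    (hW : IsEquivariantPhiQuasiPairModule χφ p YH vacH RH YV vacV RV YVH YWH YWV) (h : H) (v : V) :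
    ∃ q ∈ ratioMonoid χφ, IsExchange p YVH YWH YWV h v q := by
  obtain ⟨N, l, r, hcom⟩ := exists_comul_repr h
  choose t ht ht' using fun i => hVH.phi_compatible (l i) v
  obtain ⟨q, hq, hqT⟩ := exists_common_multiple (ratioMonoid χφ) Finset.univ
    (fun i q => IsDenominator (t i) q)
    (fun i _ => by
      obtain ⟨q, hq, hT⟩ := ht' i
      obtain ⟨m, hm⟩ := exists_mul_evalRatio21_mem hq
      exact ⟨_, hm, IsDenominator.mul hT m⟩)
    (fun i q r _ hq => hq.mul r)
  choose T hT using fun i => hqT i (Finset.mem_univ _)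
  refine ⟨q, hq, N, l, r, T, hcom, fun i => ?_, fun w => ?_⟩
  · rw [← lTensor_algHom_of_isDenominator (substFrac hp) (ψ := substL p)
      (substFrac_algebraMap hp) (hT i), (ht i).substFrac_eq hp]
    rfl
  · have h1 : act (iota21 q) (∑ i, pairRHS YWV (t i) (YWH (r i) w)) =
        iota21 (∑ i, pairTwo YWV (T i) (YWH (r i) w)) := by
      rw [map_sum, map_sum]
      refine Finset.sum_congr rfl fun i _ => ?_
      rw [pairRHS_eq, ← pairInner_act, lTensor_algHom_of_isDenominator iota21Frac
        iota21Frac_algebraMap (hT i), pairInner_iota21]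
    ext g
    obtain ⟨⟨n, m⟩, rfl⟩ := toLex.surjective g
    -- The two sides of the relation live in opposite completions and are compared coefficientwise;
    -- multiplication by q respects this. As the right side is now ι₂₁ of a two-variable series, the
    -- left is ι₁₂ of the same series.
    rw [act_swap q _ _ (hW.commute h v w N l r t hcom ht) m n, h1]
    rfl

/-- Associativity comes with an arbitrary f, quasi-locality with a q in the prescribed monoid.
Multiplying by both and cancelling f shows that q alone suffices. -/
theorem IsEquivariantPhiQuasiModule.exists_substRel (hp : p ≠ 0)
    {Y : V →ₗ[ℂ] V →ₗ[ℂ] HahnSeries ℤ V} {vac : V} {R : Representation ℂ G V}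
    {YW : V →ₗ[ℂ] W →ₗ[ℂ] HahnSeries ℤ W}
    (h : IsEquivariantPhiQuasiModule χφ p Y vac R YW) (u v : V) :
    ∃ f ∈ ratioMonoid χφ, ∀ w, SubstRel p (act (iota12 f) (prodField (YW u) (YW v) w))
      (act (subst p f) (iterField Y YW u v w)) := by
  obtain ⟨f, hf, hfB⟩ := h.assoc u v
  obtain ⟨q, hq, hqB⟩ := h.quasi_local u v
  refine ⟨evalRatio12 q, mem_ratioMonoid.mpr ⟨q, hq, rfl⟩, fun w => ?_⟩
  obtain ⟨B, hB⟩ := hqB w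
  refine ⟨B, hB, ?_⟩
  have h1 : SubstRel p (act (iota12 f) (prodField (YW u) (YW v) w))
      (act (subst p f) (iterField Y YW u v w)) := hfB w
  have h2 := h1.act (evalRatio12 q)
  rw [act_comm, act_comm (subst p (evalRatio12 q))] at h2
  exact (h2.cancel hp hf ⟨B, hB, rfl⟩).symm

theorem isEquivariantPhiQuasiModule_sharpRho [Coalgebra ℂ H] [Coalgebra.IsCocomm ℂ H] (hp : p ≠ 0)
    {YH : H →ₗ[ℂ] H →ₗ[ℂ] HahnSeries ℤ H} {vacH : H} {RH : Representation ℂ G H}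
    {YV : V →ₗ[ℂ] V →ₗ[ℂ] HahnSeries ℤ V} {vacV : V} {RV : Representation ℂ G V}
    {YVH : H →ₗ[ℂ] V →ₗ[ℂ] V ⊗[ℂ] HahnSeries ℤ ℂ}
    (hVH : IsPhiCompatibleModuleAlgebra χφ p YH vacH YV vacV YVH)
    {ρ : V →ₗ[ℂ] V ⊗[ℂ] H} (hρ : IsComoduleAlgebra YH vacH YV vacV ρ)
    (hρVH : IsCompatible YVH ρ)
    (hρG : ∀ g v, ρ (RV g v) = TensorProduct.map (RV g) (RH g) (ρ v))
    {YWH : H →ₗ[ℂ] W →ₗ[ℂ] W ⊗[ℂ] HahnSeries ℤ ℂ} {YWV : V →ₗ[ℂ] W →ₗ[ℂ] HahnSeries ℤ W}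
    (hW : IsEquivariantPhiQuasiPairModule χφ p YH vacH RH YV vacV RV YVH YWH YWV) :
    IsEquivariantPhiQuasiModule χφ p (deform YV YVH ρ) vacV RV (sharpRho YWV YWH ρ) := by
  -- With S the monoid of all q(x₁/x₂), this single statement provides both the associativity and
  -- the quasi-locality axiom.
  have hassoc := exists_substRel_sharpRho hp hρ hρVH (hW.module_V.exists_substRel hp)
    (fun h k => by
      obtain ⟨f, hf, hf'⟩ := hW.module_H.exists_substRel hp h k
      exact ⟨f, ne_zero_of_mem_ratioMonoid hf, hf'⟩)
    (exists_isExchange_of_pairModule hp hVH hW)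
  refine { vacuum := ?_, assoc := ?_, equivariant := ?_, quasi_local := ?_ }
  · intro w
    change sharp YWV YWH (ρ vacV) w = _
    rw [hρ.map_vacuum]
    exact sharp_vacuum hW.module_V.vacuum hW.module_H.vacuum w
  · intro u v
    obtain ⟨f, hf, h⟩ := hassoc u v
    exact ⟨f, ne_zero_of_mem_ratioMonoid hf, h⟩
  · intro g v w n
    have h1 := sharp_equivariant (YWV := YWV) (YWH := YWH) (c := (χφ g : ℂ)⁻¹)
      (inv_ne_zero (Units.ne_zero _)) (a := RV g) (b := RH g)
      (fun v w => by
        ext n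
        exact hW.module_V.equivariant g v w n)
      (fun v w => by
        ext n
        exact hW.module_H.equivariant g v w n) (ρ v) w
    rw [← hρG] at h1
    exact congrArg (fun A : HahnSeries ℤ W => A.coeff n) h1
  · intro u v
    obtain ⟨f, hf, h⟩ := hassoc u v
    obtain ⟨q, hq, rfl⟩ := mem_ratioMonoid.mp hf
    refine ⟨q, hq, fun w => ?_⟩
    obtain ⟨B, hB, -⟩ := h w
    exact ⟨B, hB⟩

end Phi

end VertexDeformation

end

theorem corollary4p24 {G : Type*} [Group G] (χ χφ : G →* ℂˣ)
    (p : HahnSeries ℤ ℂ) (hp : p ≠ 0)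
    (hχ : VertexDeformation.IsPhiCharacter χ χφ p)
    {H : Type*} [AddCommGroup H] [Module ℂ H] [Coalgebra ℂ H] [Coalgebra.IsCocomm ℂ H]
    (YH : H →ₗ[ℂ] H →ₗ[ℂ] HahnSeries ℤ H) (vacH : H) (RH : Representation ℂ G H)
    (hH : VertexDeformation.IsGroupModuleBialgebra χ YH vacH RH)
    {V : Type*} [AddCommGroup V] [Module ℂ V]
    (YV : V →ₗ[ℂ] V →ₗ[ℂ] HahnSeries ℤ V) (vacV : V) (RV : Representation ℂ G V)
    (hV : VertexDeformation.IsGroupModuleAlgebra χ YV vacV RV)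
    (YVH : H →ₗ[ℂ] V →ₗ[ℂ] V ⊗[ℂ] HahnSeries ℤ ℂ)
    (hVH : VertexDeformation.IsPhiCompatibleModuleAlgebra χφ p YH vacH YV vacV YVH)
    (hG : VertexDeformation.IsGroupCompatible χ RH RV YVH)
    (ρ : V →ₗ[ℂ] V ⊗[ℂ] H)
    (hρ : VertexDeformation.IsComoduleAlgebra YH vacH YV vacV ρ)
    (hρVH : VertexDeformation.IsCompatible YVH ρ)
    (hρG : ∀ g v, ρ (RV g v) = TensorProduct.map (RV g) (RH g) (ρ v))
    {W : Type*} [AddCommGroup W] [Module ℂ W]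
    (YWH : H →ₗ[ℂ] W →ₗ[ℂ] W ⊗[ℂ] HahnSeries ℤ ℂ)
    (YWV : V →ₗ[ℂ] W →ₗ[ℂ] HahnSeries ℤ W)
    (hW : VertexDeformation.IsEquivariantPhiQuasiPairModule χφ p YH vacH RH YV vacV RV
      YVH YWH YWV) :
    VertexDeformation.IsGroupModuleAlgebra χ
      (VertexDeformation.deform YV YVH ρ) vacV RV ∧
    VertexDeformation.IsEquivariantPhiQuasiModule χφ p
      (VertexDeformation.deform YV YVH ρ) vacV RV
      (VertexDeformation.sharpRho YWV YWH ρ) :=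
  ⟨VertexDeformation.isGroupModuleAlgebra_deform hV hVH.toIsModuleAlgebra hG hρ hρVH hρG,
    VertexDeformation.isEquivariantPhiQuasiModule_sharpRho hp hVH hρ hρVH hρG hW⟩
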